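/- The following is a theorem of Bishop-style constructive mathematics, here formalised as intuitionistic first-order logic over Aczel's constructive set theory CZF together with the axiom of dependent choice (no excluded middle); equivalently, it holds with truth value $\top$ in every model of CZF + dependent choice whose truth values lie in a complete Heyting algebra. Let $(X,\rho)$ be a compact (that is, complete and totally bounded) metric space, let $Y$ be a normed space, let $f:X\to Y$ be a mapping, and let $Z_f=\{x\in X: f(x)=0\}$. Write "$\rho(x,Z_f)<\varepsilon$" for "there exists $z\in Z_f$ with $\rho(x,z)<\varepsilon$". Suppose that (a) $X$ has the limited anti-Specker property $\mathbf{AS}_L^X$: whenever $X\cup\{\omega\}$ is a metric space extending $X$ for which there is $r>0$ with $\rho(\omega,x)\ge r$ for all $x\in X$, and $(x_n)$ is a sequence in $X\cup\{\omega\}$ that is eventually bounded away from each $x\in X$ (there exist $N$ and $\delta>0$ such that $\rho(x,x_n)\ge\delta$ for all $n\ge N$), then there exists $n$ with $x_n=\omega$; (b) $f$ is Z-stable on $X$: for each $x\in X$ and each $\varepsilon>0$ there exists $\delta>0$ such that if $\|f(x)\|<\delta$, then $\rho(x,Z_f)<\varepsilon$; (c) $f$ is uniformly continuous on $X$; (d)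 $Z_f$ is separable: it has a dense subset that is enumerated by a function on a detachable (decidable) set of natural numbers. Then $f$ is uniformly Z-stable on $X$: for each $\varepsilon>0$ there exists $\delta>0$ such that for each $x\in X$, if $\|f(x)\|<\delta$, then $\rho(x,Z_f)<\varepsilon$. -/

import Mathlib

open scoped symmDiff

/-!
Bishop's constructive mathematics is taken to be intuitionistic first-order logic over
Aczel's constructive set theory CZF together with dependent choice.  Truth values of
formulas lie in an arbitrary frame (complete Heyting algebra); a statement is a theorem
of intuitionistic logic over a theory exactly when it has value `⊤` in every frame-valued
model of the theory.  Frame operations are the connectives: `⊓` is "and", `⊔` is "or",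
`⇨` is "implies", `⇔` is "iff", `ᶜ` is "not", `⨅` is "for all", `⨆` is "there exists".
No Boolean law is assumed, so excluded middle is not available inside a model.
-/

/-- A frame-valued structure for the first-order language of set theory with equality. -/
structure SetInterp (H : Type*) [Order.Frame H] (M : Type*) where
  /-- truth value of `a ∈ b` -/
  mem : M → M → H
  /-- truth value of `a = b` -/
  eq : M → M → H
  eq_refl : ∀ a, eq a a = ⊤
  eq_symm : ∀ a b, eq a b ≤ eq b a
  eq_trans : ∀ a b c, eq a b ⊓ eq b c ≤ eq a c
  mem_congr_left : ∀ a b c, eq a b ⊓ mem a c ≤ mem b c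
  mem_congr_right : ∀ a b c, eq a b ⊓ mem c a ≤ mem c b

/-- First-order formulas of set theory (de Bruijn indices), needed for the axiom schemes. -/
inductive SetFormula : Type
  | mem (i j : ℕ)
  | eq (i j : ℕ)
  | bot
  | and (φ ψ : SetFormula)
  | or (φ ψ : SetFormula)
  | imp (φ ψ : SetFormula)
  | all (φ : SetFormula)
  | ex (φ : SetFormula)

/-- Bounded (`Δ₀`) formulas: all quantifiers have the form `∀ x ∈ a` or `∃ x ∈ a`. -/
inductive SetFormula.IsBounded : SetFormula → Prop
  | mem (i j : ℕ) : IsBounded (.mem i j)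
  | eq (i j : ℕ) : IsBounded (.eq i j)
  | bot : IsBounded .bot
  | and {φ ψ : SetFormula} : IsBounded φ → IsBounded ψ → IsBounded (.and φ ψ)
  | or {φ ψ : SetFormula} : IsBounded φ → IsBounded ψ → IsBounded (.or φ ψ)
  | imp {φ ψ : SetFormula} : IsBounded φ → IsBounded ψ → IsBounded (.imp φ ψ)
  | ball (i : ℕ) {φ : SetFormula} : IsBounded φ →
      IsBounded (.all (.imp (.mem 0 (i + 1)) φ))
  | bex (i : ℕ) {φ : SetFormula} : IsBounded φ →
      IsBounded (.ex (.and (.mem 0 (i + 1)) φ))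

/-- Extend an assignment of the variables by a value for the innermost variable. -/
def pushVar {M : Type*} (x : M) (e : ℕ → M) : ℕ → M
  | 0 => x
  | n + 1 => e n

namespace SetInterp

section

variable {H : Type*} [Order.Frame H] {M : Type*} (S : SetInterp H M)

/-- Truth value of a formula under an assignment. -/
def eval : SetFormula → (ℕ → M) → H
  | .mem i j, e => S.mem (e i) (e j)
  | .eq i j, e => S.eq (e i) (e j)
  | .bot, _ => ⊥
  | .and φ ψ, e => eval φ e ⊓ eval ψ e
  | .or φ ψ, e => eval φ e ⊔ eval ψ e
  | .imp φ ψ, e => eval φ e ⇨ eval ψ e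
  | .all φ, e => ⨅ x, eval φ (pushVar x e)
  | .ex φ, e => ⨆ x, eval φ (pushVar x e)

/-! ### Elementary set-theoretic vocabulary -/

/-- `∀ x ∈ a, φ x` -/
def all (a : M) (φ : M → H) : H := ⨅ x, S.mem x a ⇨ φ x

/-- `∃ x ∈ a, φ x` -/
def ex (a : M) (φ : M → H) : H := ⨆ x, S.mem x a ⊓ φ x

/-- `z = ∅` -/
def isEmpty (z : M) : H := ⨅ x, (S.mem x z)ᶜ

/-- `s = n ∪ {n}` -/
def isSucc (s n : M) : H := ⨅ x, S.mem x s ⇔ (S.mem x n ⊔ S.eq x n)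

/-- `p = {a, b}` -/
def isUPair (p a b : M) : H := ⨅ x, S.mem x p ⇔ (S.eq x a ⊔ S.eq x b)

/-- `p = ⟨a, b⟩ = {{a}, {a, b}}` -/
def isOPair (p a b : M) : H :=
  ⨆ s, ⨆ t, S.isUPair s a a ⊓ S.isUPair t a b ⊓ S.isUPair p s t

/-- `⟨a, b⟩ ∈ r` -/
def rel (r a b : M) : H := S.ex r fun p => S.isOPair p a b

/-- `⟨⟨a, b⟩, c⟩ ∈ g` -/
def rel₂ (g a b c : M) : H := ⨆ p, S.isOPair p a b ⊓ S.rel g p c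

/-- `a` contains `∅` and is closed under `n ↦ n ∪ {n}`. -/
def isInductive (a : M) : H :=
  (⨅ z, S.isEmpty z ⇨ S.mem z a) ⊓ S.all a fun n => ⨅ s, S.isSucc s n ⇨ S.mem s a

/-- `N` is the set of natural numbers, the least inductive set. -/
def isOmega (N : M) : H :=
  S.isInductive N ⊓ ⨅ a, S.isInductive a ⇨ S.all N fun n => S.mem n a

/-- `r ⊆ a × b` -/
def isRel (r a b : M) : H :=
  S.all r fun p => S.ex a fun x => S.ex b fun y => S.isOPair p x y

/-- `g` is a function from `a` to `b`. -/
def isFun (g a b : M) : H :=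
  S.isRel g a b ⊓ (S.all a fun x => S.ex b fun y => S.rel g x y) ⊓
    ⨅ x, ⨅ y, ⨅ y', S.rel g x y ⊓ S.rel g x y' ⇨ S.eq y y'

/-- `g` is a function from `a × b` to `c`. -/
def isFun₂ (g a b c : M) : H :=
  (S.all g fun q => S.ex a fun x => S.ex b fun y => S.ex c fun z =>
      ⨆ p, S.isOPair p x y ⊓ S.isOPair q p z) ⊓
    (S.all a fun x => S.all b fun y => S.ex c fun z => S.rel₂ g x y z) ⊓
    ⨅ x, ⨅ y, ⨅ z, ⨅ z', S.rel₂ g x y z ⊓ S.rel₂ g x y z' ⇨ S.eq z z'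

/-! ### Constructive set theory with dependent choice -/

/-- `S` is a model of CZF with the axiom of dependent choice. -/
structure IsBishopModel : Prop where
  extensionality : ∀ a b, (⨅ x, S.mem x a ⇔ S.mem x b) ≤ S.eq a b
  pairing : ∀ a b, (⨆ p, S.isUPair p a b) = ⊤
  union : ∀ a, (⨆ u, ⨅ x, S.mem x u ⇔ S.ex a fun y => S.mem x y) = ⊤
  infinity : (⨆ N, S.isOmega N) = ⊤
  set_induction : ∀ (φ : SetFormula) (e : ℕ → M),
    (⨅ x, (S.all x fun y => S.eval φ (pushVar y e)) ⇨ S.eval φ (pushVar x e)) ≤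
      ⨅ x, S.eval φ (pushVar x e)
  bounded_separation : ∀ (φ : SetFormula), φ.IsBounded → ∀ (e : ℕ → M) (a : M),
    (⨆ b, ⨅ x, S.mem x b ⇔ (S.mem x a ⊓ S.eval φ (pushVar x e))) = ⊤
  strong_collection : ∀ (φ : SetFormula) (e : ℕ → M) (a : M),
    (S.all a fun x => ⨆ y, S.eval φ (pushVar x (pushVar y e))) ≤
      ⨆ b, (S.all a fun x => S.ex b fun y => S.eval φ (pushVar x (pushVar y e))) ⊓
        S.all b fun y => S.ex a fun x => S.eval φ (pushVar x (pushVar y e))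
  subset_collection : ∀ (φ : SetFormula) (e : ℕ → M) (a b : M),
    (⨆ c, ⨅ u,
      (S.all a fun x => S.ex b fun y =>
          S.eval φ (pushVar x (pushVar y (pushVar u e)))) ⇨
        S.ex c fun d =>
          (S.all a fun x => S.ex d fun y =>
            S.eval φ (pushVar x (pushVar y (pushVar u e)))) ⊓
          S.all d fun y => S.ex a fun x =>
            S.eval φ (pushVar x (pushVar y (pushVar u e)))) = ⊤
  dependent_choice : ∀ N a r b,
    S.isOmega N ⊓ S.mem b a ⊓ (S.all a fun x => S.ex a fun y => S.rel r x y) ≤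
      ⨆ g, S.isFun g N a ⊓ (⨅ z, S.isEmpty z ⇨ S.rel g z b) ⊓
        S.all N fun n => ⨅ m, S.isSucc m n ⇨
          ⨆ x, ⨆ y, S.rel g n x ⊓ S.rel g m y ⊓ S.rel r x y

/-! ### Terms

A term is given by the truth value of "the term denotes `r`"; an atomic statement about
terms asserts that they have denotations which stand in the relation in question. -/

/-- The term `x`. -/
def var (x : M) : M → H := fun r => S.eq r x

/-- The term `g(s)`. -/
def app (g : M) (s : M → H) : M → H := fun r => ⨆ a, s a ⊓ S.rel g a r

/-- The term `g(s, t)`. -/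
def app₂ (g : M) (s t : M → H) : M → H := fun r => ⨆ a, ⨆ b, s a ⊓ t b ⊓ S.rel₂ g a b r

end

/-- The statement `s = t` about terms. -/
def teq {H : Type*} [Order.Frame H] {M : Type*} (s t : M → H) : H := ⨆ a, s a ⊓ t a

end SetInterp

/-! ### The real line -/

/-- The data of a real line inside a model: underlying set, addition, multiplication,
zero, one, strict order. -/
structure RealLineData (M : Type*) where
  carrier : M
  add : M
  mul : M
  zero : M
  one : M
  lt : M

/-- The data of a metric space inside a model: underlying set and metric. -/
structure MetricData (M : Type*) where
  carrier : M
  dist : M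

/-- The data of a (real) normed space inside a model. -/
structure NormedData (M : Type*) where
  carrier : M
  add : M
  smul : M
  zero : M
  norm : M

namespace SetInterp

section

variable {H : Type*} [Order.Frame H] {M : Type*} (S : SetInterp H M)

/-- The statement `s < t` about real terms. -/
def lt (R : RealLineData M) (s t : M → H) : H :=
  ⨆ a, ⨆ b, s a ⊓ t b ⊓ S.rel R.lt a b

/-- The statement `s ≤ t`, that is `¬ (t < s)`, about real terms. -/
def le (R : RealLineData M) (s t : M → H) : H :=
  ⨆ a, ⨆ b, s a ⊓ t b ⊓ (S.rel R.lt b a)ᶜ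

/-- `∀ ε > 0, φ ε` -/
def allPos (R : RealLineData M) (φ : M → H) : H :=
  S.all R.carrier fun ε => S.lt R (S.var R.zero) (S.var ε) ⇨ φ ε

/-- `∃ ε > 0, φ ε` -/
def exPos (R : RealLineData M) (φ : M → H) : H :=
  S.ex R.carrier fun ε => S.lt R (S.var R.zero) (S.var ε) ⊓ φ ε

/-- `∀ n ≥ k, φ n`, for natural numbers `n` -/
def allGe (N k : M) (φ : M → H) : H := S.all N fun n => (S.mem k n ⊔ S.eq k n) ⇨ φ n

/-- `R` is a commutative ring in which every positive element is invertible. -/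
def isField (R : RealLineData M) : H :=
  let A := R.carrier
  let v := S.var
  let add := S.app₂ R.add
  let mul := S.app₂ R.mul
  S.isFun₂ R.add A A A ⊓ S.isFun₂ R.mul A A A ⊓ S.isRel R.lt A A ⊓
  S.mem R.zero A ⊓ S.mem R.one A ⊓
  (S.all A fun x => S.all A fun y => S.all A fun z =>
    teq (add (add (v x) (v y)) (v z)) (add (v x) (add (v y) (v z)))) ⊓
  (S.all A fun x => S.all A fun y => teq (add (v x) (v y)) (add (v y) (v x))) ⊓
  (S.all A fun x => teq (add (v x) (v R.zero)) (v x)) ⊓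
  (S.all A fun x => S.ex A fun y => teq (add (v x) (v y)) (v R.zero)) ⊓
  (S.all A fun x => S.all A fun y => S.all A fun z =>
    teq (mul (mul (v x) (v y)) (v z)) (mul (v x) (mul (v y) (v z)))) ⊓
  (S.all A fun x => S.all A fun y => teq (mul (v x) (v y)) (mul (v y) (v x))) ⊓
  (S.all A fun x => teq (mul (v x) (v R.one)) (v x)) ⊓
  (S.all A fun x => S.all A fun y => S.all A fun z =>
    teq (mul (v x) (add (v y) (v z))) (add (mul (v x) (v y)) (mul (v x) (v z)))) ⊓
  S.allPos R fun x => S.ex A fun y => teq (mul (v x) (v y)) (v R.one)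

/-- The strict order of `R` is asymmetric, cotransitive and tight, and is compatible with
the algebraic operations. -/
def isOrdered (R : RealLineData M) : H :=
  let A := R.carrier
  let v := S.var
  let add := S.app₂ R.add
  let mul := S.app₂ R.mul
  S.lt R (v R.zero) (v R.one) ⊓
  (S.all A fun x => S.all A fun y => (S.lt R (v x) (v y) ⊓ S.lt R (v y) (v x))ᶜ) ⊓
  (S.all A fun x => S.all A fun y => S.all A fun z =>
    S.lt R (v x) (v y) ⇨ (S.lt R (v x) (v z) ⊔ S.lt R (v z) (v y))) ⊓
  (S.all A fun x => S.all A fun y =>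
    ((S.lt R (v x) (v y))ᶜ ⊓ (S.lt R (v y) (v x))ᶜ) ⇨ S.eq x y) ⊓
  (S.all A fun x => S.all A fun y => S.all A fun z =>
    S.lt R (v x) (v y) ⇨ S.lt R (add (v x) (v z)) (add (v y) (v z))) ⊓
  S.allPos R fun x => S.allPos R fun y => S.lt R (v R.zero) (mul (v x) (v y))

/-- Every element of `R` lies below some natural multiple of one; `i` is the canonical
map from the natural numbers to `R`. -/
def isArchimedean (N : M) (R : RealLineData M) : H :=
  ⨆ i, S.isFun i N R.carrier ⊓
    (⨅ z, S.isEmpty z ⇨ S.rel i z R.zero) ⊓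
    (S.all N fun n => ⨅ m, S.isSucc m n ⇨
      teq (S.app i (S.var m)) (S.app₂ R.add (S.app i (S.var n)) (S.var R.one))) ⊓
    S.all R.carrier fun x => S.ex N fun n => S.lt R (S.var x) (S.app i (S.var n))

/-- Every Cauchy sequence of elements of `R` converges in `R`. -/
def isCauchyComplete (N : M) (R : RealLineData M) : H :=
  ⨅ s, S.isFun s N R.carrier ⊓
      (S.allPos R fun ε => S.ex N fun k => S.allGe N k fun m => S.allGe N k fun n =>
        S.lt R (S.app s (S.var m)) (S.app₂ R.add (S.app s (S.var n)) (S.var ε))) ⇨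
    S.ex R.carrier fun l => S.allPos R fun ε => S.ex N fun k => S.allGe N k fun n =>
      S.lt R (S.app s (S.var n)) (S.app₂ R.add (S.var l) (S.var ε)) ⊓
      S.lt R (S.var l) (S.app₂ R.add (S.app s (S.var n)) (S.var ε))

/-- `R` is the real line: a Cauchy complete Archimedean ordered field in the constructive
sense.  In the presence of dependent choice such an `R` exists and is unique up to a
unique isomorphism. -/
def isRealLine (N : M) (R : RealLineData M) : H :=
  S.isField R ⊓ S.isOrdered R ⊓ S.isArchimedean N R ⊓ S.isCauchyComplete N R

/-! ### Metric spaces and normed spaces -/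

/-- The term `ρ(x, y)`. -/
def dist (X : MetricData M) (x y : M) : M → H := S.app₂ X.dist (S.var x) (S.var y)

/-- `X` is a metric space. -/
def isMetricSpace (R : RealLineData M) (X : MetricData M) : H :=
  let A := X.carrier
  S.isFun₂ X.dist A A R.carrier ⊓
  (S.all A fun x => S.all A fun y => S.le R (S.var R.zero) (S.dist X x y)) ⊓
  (S.all A fun x => S.all A fun y => teq (S.dist X x y) (S.var R.zero) ⇔ S.eq x y) ⊓
  (S.all A fun x => S.all A fun y => teq (S.dist X x y) (S.dist X y x)) ⊓
  S.all A fun x => S.all A fun y => S.all A fun z =>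
    S.le R (S.dist X x z) (S.app₂ R.add (S.dist X x y) (S.dist X y z))

/-- Every Cauchy sequence in `X` converges in `X`. -/
def isComplete (N : M) (R : RealLineData M) (X : MetricData M) : H :=
  ⨅ s, S.isFun s N X.carrier ⊓
      (S.allPos R fun ε => S.ex N fun k => S.allGe N k fun m => S.allGe N k fun n =>
        S.lt R (S.app₂ X.dist (S.app s (S.var m)) (S.app s (S.var n))) (S.var ε)) ⇨
    S.ex X.carrier fun l => S.allPos R fun ε => S.ex N fun k => S.allGe N k fun n =>
      S.lt R (S.app₂ X.dist (S.app s (S.var n)) (S.var l)) (S.var ε)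

/-- For each `ε > 0` there are a natural number `k = {0, …, k - 1}` and points `p₀, …, pₖ₋₁`
of `X` such that each point of `X` is within `ε` of one of them. -/
def isTotallyBounded (N : M) (R : RealLineData M) (X : MetricData M) : H :=
  S.allPos R fun ε => S.ex N fun k => ⨆ p, S.isFun p k X.carrier ⊓
    S.all X.carrier fun x => S.ex k fun i =>
      S.lt R (S.app₂ X.dist (S.var x) (S.app p (S.var i))) (S.var ε)

/-- `X` is compact, that is, complete and totally bounded. -/
def isCompact (N : M) (R : RealLineData M) (X : MetricData M) : H :=
  S.isComplete N R X ⊓ S.isTotallyBounded N R X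

/-- `c = |a|`, the least upper bound of `a` and `-a` -/
def isAbs (R : RealLineData M) (c a : M) : H :=
  let bd := fun d => S.le R (S.var a) (S.var d) ⊓
    S.le R (S.var R.zero) (S.app₂ R.add (S.var a) (S.var d))
  S.mem c R.carrier ⊓ bd c ⊓
    S.all R.carrier fun d => bd d ⇨ S.le R (S.var c) (S.var d)

/-- `Y` is a normed space over the real line `R`. -/
def isNormedSpace (R : RealLineData M) (Y : NormedData M) : H :=
  let A := R.carrier
  let B := Y.carrier
  let v := S.var
  let add := S.app₂ Y.add
  let smul := S.app₂ Y.smul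
  let norm := S.app Y.norm
  S.isFun₂ Y.add B B B ⊓ S.isFun₂ Y.smul A B B ⊓ S.isFun Y.norm B A ⊓ S.mem Y.zero B ⊓
  (S.all B fun x => S.all B fun y => S.all B fun z =>
    teq (add (add (v x) (v y)) (v z)) (add (v x) (add (v y) (v z)))) ⊓
  (S.all B fun x => S.all B fun y => teq (add (v x) (v y)) (add (v y) (v x))) ⊓
  (S.all B fun x => teq (add (v x) (v Y.zero)) (v x)) ⊓
  (S.all B fun x => S.ex B fun y => teq (add (v x) (v y)) (v Y.zero)) ⊓
  (S.all B fun x => teq (smul (v R.one) (v x)) (v x)) ⊓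
  (S.all A fun a => S.all A fun b => S.all B fun x =>
    teq (smul (S.app₂ R.mul (v a) (v b)) (v x)) (smul (v a) (smul (v b) (v x)))) ⊓
  (S.all A fun a => S.all A fun b => S.all B fun x =>
    teq (smul (S.app₂ R.add (v a) (v b)) (v x))
      (add (smul (v a) (v x)) (smul (v b) (v x)))) ⊓
  (S.all A fun a => S.all B fun x => S.all B fun y =>
    teq (smul (v a) (add (v x) (v y))) (add (smul (v a) (v x)) (smul (v a) (v y)))) ⊓
  (S.all B fun x => S.le R (v R.zero) (norm (v x))) ⊓
  (S.all B fun x => teq (norm (v x)) (v R.zero) ⇔ S.eq x Y.zero) ⊓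
  (S.all A fun a => ⨅ c, S.isAbs R c a ⇨ S.all B fun x =>
    teq (norm (smul (v a) (v x))) (S.app₂ R.mul (v c) (norm (v x)))) ⊓
  S.all B fun x => S.all B fun y =>
    S.le R (norm (add (v x) (v y))) (S.app₂ R.add (norm (v x)) (norm (v y)))

/-! ### One-point extensions and the limited anti-Specker property -/

/-- `E = X ∪ {w}` is a one-point extension of `X`: the metric of `E` extends that of `X`,
and `ρ(w, X) > 0`. -/
def isOnePointExtension (R : RealLineData M) (X E : MetricData M) (w : M) : H :=
  S.isMetricSpace R E ⊓
  (⨅ x, S.mem x E.carrier ⇔ (S.mem x X.carrier ⊔ S.eq x w)) ⊓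
  (S.all X.carrier fun x => S.all X.carrier fun y => teq (S.dist E x y) (S.dist X x y)) ⊓
  S.exPos R fun δ => S.all X.carrier fun x => S.le R (S.var δ) (S.dist E w x)

/-- The sequence `s` in `E` is eventually bounded away from the point `x` of `E`. -/
def isEventuallyBoundedAway (N : M) (R : RealLineData M) (E : MetricData M) (s x : M) : H :=
  S.ex N fun k => S.exPos R fun δ => S.allGe N k fun n =>
    S.le R (S.var δ) (S.app₂ E.dist (S.var x) (S.app s (S.var n)))

/-- The limited anti-Specker property of `X`: every sequence in a one-point extension
`X ∪ {w}` that is eventually bounded away from each point of `X` takes the value `w`. -/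
def hasLimitedAntiSpecker (N : M) (R : RealLineData M) (X : MetricData M) : H :=
  ⨅ E : M, ⨅ d : M, ⨅ w : M, ⨅ s : M,
    let EE : MetricData M := ⟨E, d⟩
    S.isOnePointExtension R X EE w ⊓ S.isFun s N E ⊓
        (S.all X.carrier fun x => S.isEventuallyBoundedAway N R EE s x) ⇨
      S.ex N fun n => S.rel s n w

/-! ### Properties of a mapping `f : X → Y` -/

/-- `x` belongs to the zero set `Z_f`. -/
def isZero (X : MetricData M) (Y : NormedData M) (f x : M) : H :=
  S.mem x X.carrier ⊓ S.rel f x Y.zero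

/-- `ρ(x, Z_f) < ε`: there is a zero `z` of `f` with `ρ(x, z) < ε`. -/
def nearZero (R : RealLineData M) (X : MetricData M) (Y : NormedData M) (f x ε : M) : H :=
  ⨆ z, S.isZero X Y f z ⊓ S.lt R (S.dist X x z) (S.var ε)

/-- `‖f(x)‖ < δ` -/
def normLt (R : RealLineData M) (Y : NormedData M) (f x δ : M) : H :=
  S.lt R (S.app Y.norm (S.app f (S.var x))) (S.var δ)

/-- `f` is uniformly continuous on `X`; `d` stands for `f(x) - f(y)`. -/
def isUniformlyContinuous (R : RealLineData M) (X : MetricData M) (Y : NormedData M)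
    (f : M) : H :=
  S.allPos R fun ε => S.exPos R fun δ =>
    S.all X.carrier fun x => S.all X.carrier fun y =>
      S.lt R (S.dist X x y) (S.var δ) ⇨
        S.ex Y.carrier fun d =>
          teq (S.app₂ Y.add (S.var d) (S.app f (S.var y))) (S.app f (S.var x)) ⊓
          S.lt R (S.app Y.norm (S.var d)) (S.var ε)

/-- `f` is Z-stable at the point `x`. -/
def isZStableAt (R : RealLineData M) (X : MetricData M) (Y : NormedData M) (f x : M) : H :=
  S.allPos R fun ε => S.exPos R fun δ => S.normLt R Y f x δ ⇨ S.nearZero R X Y f x ε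

/-- `f` is Z-stable on `X`. -/
def isZStable (R : RealLineData M) (X : MetricData M) (Y : NormedData M) (f : M) : H :=
  S.all X.carrier fun x => S.isZStableAt R X Y f x

/-- `f` is uniformly Z-stable on `X`. -/
def isUniformlyZStable (R : RealLineData M) (X : MetricData M) (Y : NormedData M)
    (f : M) : H :=
  S.allPos R fun ε => S.exPos R fun δ => S.all X.carrier fun x =>
    S.normLt R Y f x δ ⇨ S.nearZero R X Y f x ε

/-- The zero set of `f` is separable: it has a dense subset enumerated by a function `z` on
a detachable set of natural numbers (all of them, if the enumeration is a sequence). -/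
def hasSeparableZeroSet (N : M) (R : RealLineData M) (X : MetricData M) (Y : NormedData M)
    (f : M) : H :=
  ⨆ D, ⨆ z,
    (S.all D fun n => S.mem n N) ⊓
    (S.all N fun n => S.mem n D ⊔ (S.mem n D)ᶜ) ⊓
    S.isFun z D X.carrier ⊓
    (S.all D fun n => ⨅ y, S.rel z n y ⇨ S.isZero X Y f y) ⊓
    ⨅ x, S.isZero X Y f x ⇨ S.allPos R fun ε => S.ex D fun n =>
      S.lt R (S.app₂ X.dist (S.var x) (S.app z (S.var n))) (S.var ε)

end

end SetInterp

/-! ### Forcing at a stage of a frame -/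

/-! Fix ε > 0 and put h₁ = ε/2, h = ε/4. For each n, total boundedness and uniform continuity
provide a finite net on which finitely many cotransitive comparisons settle a dichotomy
(`exists_isFar_or_isUniformlyZStableFor`): either some x has n‖f(x)‖ < 1 and distance greater than
h₁ from every enumerated zero z_j with j ≤ n, or a single δ serves ε on all of X. The enumeration of
zeros matters here, since it replaces the distance to the zero set by finitely many distances.

Countable choice turns the dichotomy into a sequence in X ∪ {w}: the nth term is such a far point,
or it is w and the desired δ exists. This sequence is eventually bounded away from each x in X
(`isEventuallyBoundedAway_of_isFar`). Let δ come from stability at x for h/2; cotransitivity gives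
‖f(x)‖ > 0 or ‖f(x)‖ < δ. In the first case continuity keeps ‖f‖ above ‖f(x)‖/2 near x, which n‖f‖ <
1 forbids for large n. In the second, some z_j lies within h of x, so a far point with n ≥ j within
h of x would be within 2h = h₁ of z_j. The anti-Specker property now yields a term equal to w, and
the disjunct attached to w is the conclusion. A one-point extension has to be constructed first
(`exists_onePointExtension`); this needs a point of X, and total boundedness decides whether there
is one.

All this happens inside the model. `Γ ≤ φ` is read as "stage Γ forces φ"; the rules of natural
deduction take premisses at all stages `Δ ≤ Γ`, and `grw [← hΔ] at *` moves the context down to such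
a stage. Real arithmetic is done outside: a prime filter of `H` containing `Γ` evaluates real terms
in a linearly ordered ring, where inequalities are checked classically (`le_of_linear`). Classical
reasoning serves only to prove inequalities between elements of `H`; no excluded middle enters the
model. -/

namespace Frm

variable {H : Type*} [Order.Frame H] {Γ a b ψ : H} {ι : Sort*} {φ : ι → H}

/-- Distributivity of the frame splits `Γ` into the pieces `Γ ⊓ φ x`, and it is enough to argue on
each piece. The continuation accepts any smaller stage, so that eliminations can be nested. -/
theorem iSup_elim (h : Γ ≤ ⨆ x, φ x) (k : ∀ x, ∀ Δ ≤ Γ, Δ ≤ φ x → Δ ≤ ψ) : Γ ≤ ψ := by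
  have : Γ = ⨆ x, Γ ⊓ φ x := by rw [← inf_iSup_eq, inf_eq_left.2 h]
  rw [this]
  exact iSup_le fun x => k x _ inf_le_left inf_le_right

theorem iSup_intro (x : ι) (h : Γ ≤ φ x) : Γ ≤ ⨆ x, φ x := h.trans (le_iSup φ x)

theorem iInf_elim (h : Γ ≤ ⨅ x, φ x) (x : ι) : Γ ≤ φ x := h.trans (iInf_le φ x)

theorem sup_elim (h : Γ ≤ a ⊔ b) (ka : ∀ Δ ≤ Γ, Δ ≤ a → Δ ≤ ψ) (kb : ∀ Δ ≤ Γ, Δ ≤ b → Δ ≤ ψ) :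
    Γ ≤ ψ := by
  have : Γ = Γ ⊓ a ⊔ Γ ⊓ b := by rw [← inf_sup_left, inf_eq_left.2 h]
  rw [this]
  exact sup_le (ka _ inf_le_left inf_le_right) (kb _ inf_le_left inf_le_right)

theorem himp_intro (k : ∀ Δ ≤ Γ, Δ ≤ a → Δ ≤ b) : Γ ≤ a ⇨ b :=
  le_himp_iff.2 (k _ inf_le_left inf_le_right)

theorem himp_elim (h : Γ ≤ a ⇨ b) (ha : Γ ≤ a) : Γ ≤ b :=
  (le_inf le_rfl ha).trans (le_himp_iff.1 h)

theorem compl_intro (k : ∀ Δ ≤ Γ, Δ ≤ a → Δ ≤ ⊥) : Γ ≤ aᶜ := by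
  rw [← himp_bot]; exact himp_intro k

theorem compl_elim (h : Γ ≤ aᶜ) (ha : Γ ≤ a) : Γ ≤ ψ := by
  rw [← himp_bot] at h; exact (himp_elim h ha).trans bot_le

theorem iff_intro (k : ∀ Δ ≤ Γ, Δ ≤ a → Δ ≤ b) (k' : ∀ Δ ≤ Γ, Δ ≤ b → Δ ≤ a) : Γ ≤ a ⇔ b :=
  le_inf (himp_intro k') (himp_intro k)

theorem iff_mp (h : Γ ≤ a ⇔ b) (ha : Γ ≤ a) : Γ ≤ b := himp_elim (h.trans inf_le_right) ha

theorem iff_mpr (h : Γ ≤ a ⇔ b) (hb : Γ ≤ b) : Γ ≤ a := himp_elim (h.trans inf_le_left) hb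

theorem and_left (h : Γ ≤ a ⊓ b) : Γ ≤ a := h.trans inf_le_left

theorem and_right (h : Γ ≤ a ⊓ b) : Γ ≤ b := h.trans inf_le_right

theorem inl (h : Γ ≤ a) : Γ ≤ a ⊔ b := h.trans le_sup_left

theorem inr (h : Γ ≤ b) : Γ ≤ a ⊔ b := h.trans le_sup_right

end Frm

open Frm

/-! ### Bounded quantifiers and equality at a stage. -/

namespace SetInterp

variable {H : Type*} [Order.Frame H] {M : Type*} (S : SetInterp H M)
  {Γ Δ ψ : H} {a b c d x y z w g r s t N : M} {φ : M → H}

section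

variable {S}

theorem ex_intro (x : M) (hx : Γ ≤ S.mem x a) (h : Γ ≤ φ x) : Γ ≤ S.ex a φ :=
  iSup_intro x (le_inf hx h)

theorem ex_elim (h : Γ ≤ S.ex a φ)
    (k : ∀ x, ∀ Δ ≤ Γ, Δ ≤ S.mem x a → Δ ≤ φ x → Δ ≤ ψ) : Γ ≤ ψ :=
  iSup_elim h fun x Δ hΔ hx => k x Δ hΔ (and_left hx) (and_right hx)

theorem all_intro (k : ∀ x, ∀ Δ ≤ Γ, Δ ≤ S.mem x a → Δ ≤ φ x) : Γ ≤ S.all a φ :=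
  le_iInf fun x => himp_intro (k x)

theorem all_elim (h : Γ ≤ S.all a φ) (hx : Γ ≤ S.mem x a) : Γ ≤ φ x :=
  himp_elim (iInf_elim h x) hx

theorem eq_rfl : Γ ≤ S.eq a a := by rw [S.eq_refl]; exact le_top

theorem eq_sym (h : Γ ≤ S.eq a b) : Γ ≤ S.eq b a := h.trans (S.eq_symm _ _)

theorem eq_tr (h : Γ ≤ S.eq a b) (h' : Γ ≤ S.eq b c) : Γ ≤ S.eq a c :=
  (le_inf h h').trans (S.eq_trans _ _ _)

theorem mem_left (h : Γ ≤ S.eq a b) (h' : Γ ≤ S.mem a c) : Γ ≤ S.mem b c :=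
  (le_inf h h').trans (S.mem_congr_left _ _ _)

theorem mem_right (h : Γ ≤ S.eq a b) (h' : Γ ≤ S.mem c a) : Γ ≤ S.mem c b :=
  (le_inf h h').trans (S.mem_congr_right _ _ _)

end

end SetInterp

/-! ### Definable predicates -/

namespace SetFormula

/-- Renaming of the free variables. -/
def rename : (ℕ → ℕ) → SetFormula → SetFormula
  | ρ, .mem i j => .mem (ρ i) (ρ j)
  | ρ, .eq i j => .eq (ρ i) (ρ j)
  | _, .bot => .bot
  | ρ, .and φ ψ => .and (rename ρ φ) (rename ρ ψ)
  | ρ, .or φ ψ => .or (rename ρ φ) (rename ρ ψ)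
  | ρ, .imp φ ψ => .imp (rename ρ φ) (rename ρ ψ)
  | ρ, .all φ => .all (rename (fun n => n.casesOn 0 fun m => ρ m + 1) φ)
  | ρ, .ex φ => .ex (rename (fun n => n.casesOn 0 fun m => ρ m + 1) φ)

end SetFormula

namespace SetInterp

variable {H : Type*} [Order.Frame H] {M : Type*} (S : SetInterp H M) {Γ : H}

theorem eval_rename (φ : SetFormula) (ρ : ℕ → ℕ) (e : ℕ → M) :
    S.eval (φ.rename ρ) e = S.eval φ (fun n => e (ρ n)) := by
  have aux : ∀ (ρ : ℕ → ℕ) (x : M) (e : ℕ → M),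
      (fun n => pushVar x e ((fun n => n.casesOn 0 fun m => ρ m + 1 : ℕ → ℕ) n)) =
        pushVar x (fun n => e (ρ n)) := by
    intro ρ x e; funext n; cases n <;> rfl
  induction φ generalizing ρ e with
  | mem i j => rfl
  | eq i j => rfl
  | bot => rfl
  | and φ ψ h1 h2 => simp only [SetFormula.rename, eval, h1, h2]
  | or φ ψ h1 h2 => simp only [SetFormula.rename, eval, h1, h2]
  | imp φ ψ h1 h2 => simp only [SetFormula.rename, eval, h1, h2]
  | all φ h => simp only [SetFormula.rename, eval, h, aux]
  | ex φ h => simp only [SetFormula.rename, eval, h, aux]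

/-- Induction on the formula. Implication uses the equalities backwards and at smaller stages, so
the stage and both environments are generalized. -/
theorem eval_congr (φ : SetFormula) (e e' : ℕ → M) (h : ∀ n, Γ ≤ S.eq (e n) (e' n))
    (h' : Γ ≤ S.eval φ e) : Γ ≤ S.eval φ e' := by
  have push : ∀ {Δ : H} (e e' : ℕ → M) (x : M), (∀ n, Δ ≤ S.eq (e n) (e' n)) →
      ∀ n, Δ ≤ S.eq (pushVar x e n) (pushVar x e' n) := by
    intro Δ e e' x h n; cases n
    · exact eq_rfl
    · exact h _
  induction φ generalizing Γ e e' with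
  | mem i j => exact mem_left (h i) (mem_right (h j) h')
  | eq i j => exact eq_tr (eq_sym (h i)) (eq_tr h' (h j))
  | bot => exact h'
  | and φ ψ h1 h2 => exact le_inf (h1 _ _ h (and_left h')) (h2 _ _ h (and_right h'))
  | or φ ψ h1 h2 =>
    exact sup_elim h' (fun Δ hΔ k => inl (h1 _ _ (fun n => hΔ.trans (h n)) k))
      (fun Δ hΔ k => inr (h2 _ _ (fun n => hΔ.trans (h n)) k))
  | imp φ ψ h1 h2 =>
    exact himp_intro fun Δ hΔ k => h2 _ _ (fun n => hΔ.trans (h n))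
      (himp_elim (hΔ.trans h') (h1 _ _ (fun n => hΔ.trans (eq_sym (h n))) k))
  | all φ ih => exact le_iInf fun x => ih _ _ (push _ _ x h) (iInf_elim h' x)
  | ex φ ih =>
    exact iSup_elim h' fun x Δ hΔ k =>
      iSup_intro x (ih _ _ (push _ _ x fun n => hΔ.trans (h n)) k)

/-- The environment given by variables and parameters. -/
def env (τ : ℕ → ℕ ⊕ M) (v : ℕ → M) : ℕ → M := fun n => Sum.elim v id (τ n)

/-- A truth value depending on variables is definable if it is the value of a formula with
parameters. -/
class Definable (F : (ℕ → M) → H) : Prop where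
  out : ∃ (φ : SetFormula) (τ : ℕ → ℕ ⊕ M), ∀ v, S.eval φ (env τ v) = F v

/-- Variables and parameters. -/
class IsAtom (T : (ℕ → M) → M) : Prop where
  out : ∃ τ : ℕ ⊕ M, ∀ v, Sum.elim v id τ = T v

/-- A term depending on variables is definable if its graph is. -/
class DefinableTerm (s : (ℕ → M) → M → H) : Prop where
  out : S.Definable fun v => s (fun n => v (n + 1)) (v 0)

instance IsAtom.var (i : ℕ) : IsAtom (fun v : ℕ → M => v i) := ⟨.inl i, fun _ => rfl⟩

instance IsAtom.const (c : M) : IsAtom (fun _ : ℕ → M => c) := ⟨.inr c, fun _ => rfl⟩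

/-- Passing under a binder shifts the outer variables by one. The lines `have := hT.tail` below hand
this fact to instance search. -/
theorem IsAtom.tail {T : (ℕ → M) → M} (h : IsAtom T) :
    IsAtom (fun v : ℕ → M => T fun n => v (n + 1)) := by
  obtain ⟨τ | c, h⟩ := h
  · exact ⟨.inl (τ + 1), fun v => h fun n => v (n + 1)⟩
  · exact ⟨.inr c, fun v => h fun n => v (n + 1)⟩

variable {S} {F G : (ℕ → M) → H} {T U V : (ℕ → M) → M}

instance Definable.mem [hT : IsAtom T] [hU : IsAtom U] :
    S.Definable fun v => S.mem (T v) (U v) := by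
  obtain ⟨τ, h⟩ := hT
  obtain ⟨σ, h'⟩ := hU
  exact ⟨.mem 0 1, fun n => n.casesOn τ fun _ => σ, fun v => by simp [eval, env, h, h']⟩

instance Definable.eq [hT : IsAtom T] [hU : IsAtom U] :
    S.Definable fun v => S.eq (T v) (U v) := by
  obtain ⟨τ, h⟩ := hT
  obtain ⟨σ, h'⟩ := hU
  exact ⟨.eq 0 1, fun n => n.casesOn τ fun _ => σ, fun v => by simp [eval, env, h, h']⟩

instance Definable.bot : S.Definable fun _ => ⊥ :=
  ⟨.bot, fun n => .inl n, fun _ => rfl⟩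

/-- Two formulas come with unrelated environments. Sending the variables of one to even and of the
other to odd slots lets them share one. -/
theorem Definable.merge (hF : S.Definable F) (hG : S.Definable G) :
    ∃ (φ ψ : SetFormula) (τ : ℕ → ℕ ⊕ M), (∀ v, S.eval φ (env τ v) = F v) ∧
      ∀ v, S.eval ψ (env τ v) = G v := by
  obtain ⟨φ, τ, h⟩ := hF
  obtain ⟨ψ, σ, h'⟩ := hG
  refine ⟨φ.rename (fun n => 2 * n), ψ.rename (fun n => 2 * n + 1),
    fun n => if n % 2 = 0 then τ (n / 2) else σ (n / 2), fun v => ?_, fun v => ?_⟩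
  · rw [eval_rename, ← h]
    congr 1; funext n; simp [env]
  · rw [eval_rename, ← h']
    congr 1; funext n
    have : (2 * n + 1) / 2 = n := by omega
    simp [env, this, Nat.add_mod]

instance Definable.inf [hF : S.Definable F] [hG : S.Definable G] :
    S.Definable fun v => F v ⊓ G v := by
  obtain ⟨φ, ψ, τ, h, h'⟩ := hF.merge hG
  exact ⟨.and φ ψ, τ, fun v => by simp only [eval, h, h']⟩

instance Definable.sup [hF : S.Definable F] [hG : S.Definable G] :
    S.Definable fun v => F v ⊔ G v := by
  obtain ⟨φ, ψ, τ, h, h'⟩ := hF.merge hG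
  exact ⟨.or φ ψ, τ, fun v => by simp only [eval, h, h']⟩

instance Definable.himp [hF : S.Definable F] [hG : S.Definable G] :
    S.Definable fun v => F v ⇨ G v := by
  obtain ⟨φ, ψ, τ, h, h'⟩ := hF.merge hG
  exact ⟨.imp φ ψ, τ, fun v => by simp only [eval, h, h']⟩

instance Definable.compl [S.Definable F] : S.Definable fun v => (F v)ᶜ := by
  simp only [← himp_bot]
  exact Definable.himp (G := fun _ => ⊥)

instance Definable.bihimp [S.Definable F] [S.Definable G] :
    S.Definable fun v => F v ⇔ G v :=
  Definable.inf (F := fun v => G v ⇨ F v) (G := fun v => F v ⇨ G v)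

theorem Definable.subst (σ : ℕ → (ℕ → M) → M) (hσ : ∀ n, IsAtom (σ n)) (hF : S.Definable F) :
    S.Definable fun v => F fun n => σ n v := by
  obtain ⟨φ, τ, h⟩ := hF
  choose κ hκ using fun n => (hσ n).out
  refine ⟨φ, fun n => (τ n).elim κ .inr, fun v => ?_⟩
  rw [← h]
  congr 1; funext n
  rcases hn : τ n with i | c
  · simpa [env, hn] using hκ i v
  · simp [env, hn]

theorem Definable.comp (ρ : ℕ → ℕ) (hF : S.Definable F) :
    S.Definable fun v => F fun n => v (ρ n) :=
  hF.subst (fun n v => v (ρ n)) fun n => .var (ρ n)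

theorem Definable.binary_subst {P : M → M → H} (hP : S.Definable fun v => P (v 0) (v 1))
    (T U : (ℕ → M) → M) [hT : IsAtom T] [hU : IsAtom U] :
    S.Definable fun v => P (T v) (U v) :=
  hP.subst (fun n => n.casesOn T fun _ => U) fun n => by cases n <;> assumption

theorem Definable.ternary_subst {P : M → M → M → H}
    (hP : S.Definable fun v => P (v 0) (v 1) (v 2)) (T U V : (ℕ → M) → M) [hT : IsAtom T]
    [hU : IsAtom U] [hV : IsAtom V] : S.Definable fun v => P (T v) (U v) (V v) :=
  hP.subst (fun n => n.casesOn T fun m => m.casesOn U fun _ => V) fun n => by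
    rcases n with _ | _ | n <;> assumption

theorem Definable.quantifier {G : (ℕ → M) → M → H}
    (hG : S.Definable fun v => G (fun n => v (n + 1)) (v 0)) :
    ∃ (φ : SetFormula) (τ : ℕ → ℕ ⊕ M), ∀ v x, S.eval φ (pushVar x (env τ v)) = G v x := by
  obtain ⟨φ, τ, h⟩ := hG
  -- A slot that reads variable 0 becomes the bound variable; every other slot `n` moves to `n + 1`,
  -- and its variable `i` is read as `i - 1` outside the quantifier.
  refine ⟨φ.rename fun n => (τ n).elim (fun i => i.casesOn 0 fun _ => n + 1) fun _ => n + 1,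
    fun n => (τ n).elim (fun i => .inl (i - 1)) .inr, fun v x => ?_⟩
  rw [eval_rename]
  have := h (pushVar x v)
  change _ = G v x at this
  rw [← this]
  congr 1; funext n
  rcases hn : τ n with (_ | i) | c <;> simp [env, pushVar, hn]

instance Definable.iInf {G : (ℕ → M) → M → H}
    [hG : S.Definable fun v => G (fun n => v (n + 1)) (v 0)] :
    S.Definable fun v => ⨅ x, G v x := by
  obtain ⟨φ, τ, h⟩ := quantifier hG
  exact ⟨.all φ, τ, fun v => by simp only [eval, h]⟩

instance Definable.iSup {G : (ℕ → M) → M → H}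
    [hG : S.Definable fun v => G (fun n => v (n + 1)) (v 0)] :
    S.Definable fun v => ⨆ x, G v x := by
  obtain ⟨φ, τ, h⟩ := quantifier hG
  exact ⟨.ex φ, τ, fun v => by simp only [eval, h]⟩

instance Definable.all {G : (ℕ → M) → M → H} [hT : IsAtom T]
    [S.Definable fun v => G (fun n => v (n + 1)) (v 0)] :
    S.Definable fun v => S.all (T v) (G v) := by
  have := hT.tail
  unfold SetInterp.all
  infer_instance

instance Definable.ex {G : (ℕ → M) → M → H} [hT : IsAtom T]
    [S.Definable fun v => G (fun n => v (n + 1)) (v 0)] :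
    S.Definable fun v => S.ex (T v) (G v) := by
  have := hT.tail
  unfold SetInterp.ex
  infer_instance

instance Definable.isEmpty [hT : IsAtom T] : S.Definable fun v => S.isEmpty (T v) := by
  have := hT.tail
  unfold SetInterp.isEmpty
  infer_instance

instance Definable.isSucc [hT : IsAtom T] [hU : IsAtom U] :
    S.Definable fun v => S.isSucc (T v) (U v) := by
  have := hT.tail
  have := hU.tail
  unfold SetInterp.isSucc
  infer_instance

instance Definable.isUPair [hT : IsAtom T] [hU : IsAtom U] [hV : IsAtom V] :
    S.Definable fun v => S.isUPair (T v) (U v) (V v) := by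
  have := hT.tail
  have := hU.tail
  have := hV.tail
  unfold SetInterp.isUPair
  infer_instance

instance Definable.isOPair [hT : IsAtom T] [hU : IsAtom U] [hV : IsAtom V] :
    S.Definable fun v => S.isOPair (T v) (U v) (V v) := by
  have := hT.tail.tail
  have := hU.tail.tail
  have := hV.tail.tail
  unfold SetInterp.isOPair
  infer_instance

instance Definable.rel [hT : IsAtom T] [hU : IsAtom U] [hV : IsAtom V] :
    S.Definable fun v => S.rel (T v) (U v) (V v) := by
  have := hU.tail
  have := hV.tail
  unfold SetInterp.rel
  infer_instance

instance Definable.rel₂ {W : (ℕ → M) → M} [hT : IsAtom T] [hU : IsAtom U] [hV : IsAtom V]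
    [hW : IsAtom W] : S.Definable fun v => S.rel₂ (T v) (U v) (V v) (W v) := by
  have := hT.tail
  have := hU.tail
  have := hV.tail
  have := hW.tail
  unfold SetInterp.rel₂
  infer_instance

/-! ### Definable terms. -/

section

variable {s t : (ℕ → M) → M → H}

theorem DefinableTerm.comp (ρ : ℕ → ℕ) (i : ℕ) (hs : S.DefinableTerm s) :
    S.Definable fun v => s (fun n => v (ρ n)) (v i) :=
  Definable.comp (fun n => n.casesOn i ρ) hs.out

theorem DefinableTerm.apply (hs : S.DefinableTerm s) (T : (ℕ → M) → M) [hT : IsAtom T] :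
    S.Definable fun v => s v (T v) :=
  Definable.subst (fun n => n.casesOn T fun m v => v m)
    (fun n => by cases n; exacts [hT, .var _]) hs.out

theorem DefinableTerm.tail (hs : S.DefinableTerm s) :
    S.DefinableTerm fun v => s fun n => v (n + 1) :=
  ⟨hs.comp (fun n => n + 1 + 1) 0⟩

instance DefinableTerm.var [hT : IsAtom T] : S.DefinableTerm fun v => S.var (T v) := by
  have := hT.tail
  constructor
  unfold SetInterp.var
  infer_instance

instance DefinableTerm.app [hT : IsAtom T] [hs : S.DefinableTerm s] :
    S.DefinableTerm fun v => S.app (T v) (s v) := by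
  have := hT.tail.tail
  have := hs.comp (fun n => n + 1 + 1) 0
  constructor
  unfold SetInterp.app
  infer_instance

instance DefinableTerm.app₂ [hT : IsAtom T] [hs : S.DefinableTerm s] [ht : S.DefinableTerm t] :
    S.DefinableTerm fun v => S.app₂ (T v) (s v) (t v) := by
  have := hT.tail.tail.tail
  have := hs.comp (fun n => n + 1 + 1 + 1) 1
  have := ht.comp (fun n => n + 1 + 1 + 1) 0
  constructor
  unfold SetInterp.app₂
  infer_instance

instance Definable.app₂_apply [IsAtom T] [IsAtom U] [S.DefinableTerm s] [S.DefinableTerm t] :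
    S.Definable fun v => S.app₂ (T v) (s v) (t v) (U v) :=
  DefinableTerm.apply (s := fun v => S.app₂ (T v) (s v) (t v)) inferInstance U

instance DefinableTerm.dist {X : MetricData M} [hT : IsAtom T] [hU : IsAtom U] :
    S.DefinableTerm fun v => S.dist X (T v) (U v) := by
  unfold SetInterp.dist
  infer_instance

instance Definable.teq [hs : S.DefinableTerm s] [ht : S.DefinableTerm t] :
    S.Definable fun v => teq (s v) (t v) := by
  have := hs.comp (fun n => n + 1) 0
  have := ht.comp (fun n => n + 1) 0
  unfold SetInterp.teq
  infer_instance

instance Definable.lt {R : RealLineData M} [hs : S.DefinableTerm s] [ht : S.DefinableTerm t] :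
    S.Definable fun v => S.lt R (s v) (t v) := by
  have := hs.comp (fun n => n + 1 + 1) 1
  have := ht.comp (fun n => n + 1 + 1) 0
  unfold SetInterp.lt
  infer_instance

instance Definable.le {R : RealLineData M} [hs : S.DefinableTerm s] [ht : S.DefinableTerm t] :
    S.Definable fun v => S.le R (s v) (t v) := by
  have := hs.comp (fun n => n + 1 + 1) 1
  have := ht.comp (fun n => n + 1 + 1) 0
  unfold SetInterp.le
  infer_instance

end

instance Definable.exPos {R : RealLineData M} {G : (ℕ → M) → M → H}
    [S.Definable fun v => G (fun n => v (n + 1)) (v 0)] :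
    S.Definable fun v => S.exPos R (G v) := by
  unfold SetInterp.exPos
  infer_instance

/-- The Leibniz rule: formulas respect the model's equality, whereas an arbitrary map `M → H` need
not. -/
theorem Definable.congr (P : M → H) [hP : S.Definable fun v => P (v 0)] {a b : M}
    (h : Γ ≤ S.eq a b) (ha : Γ ≤ P a) : Γ ≤ P b := by
  obtain ⟨φ, τ, hφ⟩ := hP
  have h1 := hφ fun _ => a
  have h2 := hφ fun _ => b
  rw [← h1] at ha
  rw [← h2]
  refine S.eval_congr φ _ _ (fun n => ?_) ha
  rcases hn : τ n with i | c
  · simpa [env, hn] using h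
  · simpa [env, hn] using eq_rfl

theorem Definable.unary (P : M → H) [hP : S.Definable fun v => P (v 0)] (m : M) :
    ∃ (φ : SetFormula) (e : ℕ → M), ∀ x, S.eval φ (pushVar x e) = P x := by
  obtain ⟨φ, τ, h⟩ := quantifier (G := fun _ x => P x) hP
  exact ⟨φ, env τ fun _ => m, fun x => h _ x⟩

theorem Definable.binary (P : M → M → H) [hP : S.Definable fun v => P (v 0) (v 1)] (m : M) :
    ∃ (φ : SetFormula) (e : ℕ → M), ∀ x y, S.eval φ (pushVar x (pushVar y e)) = P x y := by
  obtain ⟨φ, τ, h⟩ := hP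
  refine ⟨φ.rename fun n => (τ n).elim
      (fun i => i.casesOn 0 fun j => j.casesOn 1 fun _ => n + 2) fun _ => n + 2,
    fun n => (τ n).elim (fun _ => m) id, fun x y => ?_⟩
  rw [eval_rename]
  have := h (pushVar x (pushVar y fun _ => m))
  change _ = P x y at this
  rw [← this]
  congr 1; funext n
  rcases hn : τ n with (_ | _ | i) | c <;> simp [env, pushVar, hn]

end SetInterp

/-! ### Elementary set theory -/

namespace SetInterp

variable {H : Type*} [Order.Frame H] {M : Type*} {S : SetInterp H M}
  {Γ Δ ψ : H} {a a' b b' c d p p' q x y z w g r s t n m N : M} {φ : M → H}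

theorem isUPair_left (h : Γ ≤ S.isUPair p a b) : Γ ≤ S.mem a p :=
  iff_mpr (iInf_elim h a) (inl eq_rfl)

theorem isUPair_right (h : Γ ≤ S.isUPair p a b) : Γ ≤ S.mem b p :=
  iff_mpr (iInf_elim h b) (inr eq_rfl)

theorem isUPair_mem (h : Γ ≤ S.isUPair p a b) (hx : Γ ≤ S.mem x p) :
    Γ ≤ S.eq x a ⊔ S.eq x b :=
  iff_mp (iInf_elim h x) hx

theorem isUPair_self (h : Γ ≤ S.isUPair p a a) (hx : Γ ≤ S.mem x p) : Γ ≤ S.eq x a := by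
  simpa using isUPair_mem h hx

theorem isOPair_elim (h : Γ ≤ S.isOPair p a b)
    (k : ∀ s t, ∀ Δ ≤ Γ, Δ ≤ S.isUPair s a a → Δ ≤ S.isUPair t a b → Δ ≤ S.isUPair p s t →
      Δ ≤ ψ) : Γ ≤ ψ :=
  iSup_elim h fun s _ hΔ h => iSup_elim h fun t Θ hΘ h =>
    k s t Θ (hΘ.trans hΔ) (and_left (and_left h)) (and_right (and_left h)) (and_right h)

theorem isOPair_fst (h : Γ ≤ S.isOPair p a b) (h' : Γ ≤ S.isOPair p c d) : Γ ≤ S.eq a c := by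
  refine isOPair_elim h fun s t Δ hΔ hs ht hp => ?_
  grw [← hΔ] at *
  refine isOPair_elim h' fun s' t' Δ hΔ hs' ht' hp' => ?_
  grw [← hΔ] at *
  have h1 := isUPair_mem hp' (isUPair_left hp)
  refine sup_elim h1 (fun Δ hΔ h => ?_) (fun Δ hΔ h => ?_) <;> grw [← hΔ] at *
  · exact eq_sym (isUPair_self hs (mem_right (eq_sym h) (isUPair_left hs')))
  · exact eq_sym (isUPair_self hs (mem_right (eq_sym h) (isUPair_left ht')))

/-- No decision of `a = b` is needed. The pairing axiom gives both `d ∈ {a, b}` and `b ∈ {c, d}` as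
disjunctions, and in each combination the known equality `a = c` closes the argument. -/
theorem isOPair_snd (h : Γ ≤ S.isOPair p a b) (h' : Γ ≤ S.isOPair p c d) : Γ ≤ S.eq b d := by
  have aux : ∀ {Γ : H} {a b c d : M}, Γ ≤ S.isOPair p a b → Γ ≤ S.isOPair p c d →
      Γ ≤ S.eq d a ⊔ S.eq d b := by
    intro Γ a b c d h h'
    refine isOPair_elim h fun s t Δ hΔ hs ht hp => ?_
    grw [← hΔ] at *
    refine isOPair_elim h' fun s' t' Δ hΔ hs' ht' hp' => ?_
    grw [← hΔ] at *
    have h1 := isUPair_mem hp (isUPair_right hp')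
    refine sup_elim h1 (fun Δ hΔ h => ?_) (fun Δ hΔ h => ?_) <;> grw [← hΔ] at *
    · exact inl (isUPair_self hs (mem_right h (isUPair_right ht')))
    · exact isUPair_mem ht (mem_right h (isUPair_right ht'))
  have h0 := isOPair_fst h h'
  refine sup_elim (aux h h') (fun Δ hΔ h1 => ?_) (fun Δ hΔ h1 => ?_) <;> grw [← hΔ] at *
  · refine sup_elim (aux h' h) (fun Δ hΔ h2 => ?_) (fun Δ hΔ h2 => ?_) <;> grw [← hΔ] at *
    · exact eq_tr h2 (eq_tr (eq_sym h0) (eq_sym h1))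
    · exact h2
  · exact eq_sym h1

theorem isOPair_congr (h1 : Γ ≤ S.eq a a') (h2 : Γ ≤ S.eq b b') (h : Γ ≤ S.isOPair p a b) :
    Γ ≤ S.isOPair p a' b' :=
  Definable.congr (fun b => S.isOPair p a' b) h2 (Definable.congr (fun a => S.isOPair p a b) h1 h)

theorem isOPair_congr_left (h1 : Γ ≤ S.eq p p') (h : Γ ≤ S.isOPair p a b) :
    Γ ≤ S.isOPair p' a b :=
  Definable.congr (fun p => S.isOPair p a b) h1 h

theorem rel_congr (h1 : Γ ≤ S.eq a a') (h2 : Γ ≤ S.eq b b') (h : Γ ≤ S.rel g a b) :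
    Γ ≤ S.rel g a' b' :=
  Definable.congr (fun b => S.rel g a' b) h2 (Definable.congr (fun a => S.rel g a b) h1 h)

theorem rel₂_congr {c' : M} (h1 : Γ ≤ S.eq a a') (h2 : Γ ≤ S.eq b b') (h3 : Γ ≤ S.eq c c')
    (h : Γ ≤ S.rel₂ g a b c) : Γ ≤ S.rel₂ g a' b' c' :=
  Definable.congr (fun c => S.rel₂ g a' b' c) h3 (Definable.congr (fun b => S.rel₂ g a' b c) h2
    (Definable.congr (fun a => S.rel₂ g a b c) h1 h))

theorem rel_intro (hp : Γ ≤ S.mem p g) (h : Γ ≤ S.isOPair p a b) : Γ ≤ S.rel g a b :=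
  ex_intro p hp h

theorem rel_elim (h : Γ ≤ S.rel g a b)
    (k : ∀ p, ∀ Δ ≤ Γ, Δ ≤ S.mem p g → Δ ≤ S.isOPair p a b → Δ ≤ ψ) : Γ ≤ ψ :=
  ex_elim h k

/-! ### Functions -/

theorem isRel_mem (h : Γ ≤ S.isRel g a b) (hr : Γ ≤ S.rel g x y) :
    Γ ≤ S.mem x a ⊓ S.mem y b := by
  refine rel_elim hr fun p Δ hΔ hp hxy => ?_
  grw [← hΔ] at *
  refine ex_elim (all_elim h hp :) fun x' Δ hΔ hx' h' => ?_
  grw [← hΔ] at *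
  refine ex_elim h' fun y' Δ hΔ hy' h' => ?_
  grw [← hΔ] at *
  exact le_inf (mem_left (isOPair_fst h' hxy) hx') (mem_left (isOPair_snd h' hxy) hy')

theorem isFun_dom (h : Γ ≤ S.isFun g a b) (hr : Γ ≤ S.rel g x y) : Γ ≤ S.mem x a :=
  and_left (isRel_mem (and_left (and_left h)) hr)

theorem isFun_cod (h : Γ ≤ S.isFun g a b) (hr : Γ ≤ S.rel g x y) : Γ ≤ S.mem y b :=
  and_right (isRel_mem (and_left (and_left h)) hr)

theorem isFun_total (h : Γ ≤ S.isFun g a b) (hx : Γ ≤ S.mem x a) :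
    Γ ≤ S.ex b fun y => S.rel g x y :=
  (all_elim (and_right (and_left h)) hx :)

theorem isFun_unique (h : Γ ≤ S.isFun g a b) (h1 : Γ ≤ S.rel g x y) (h2 : Γ ≤ S.rel g x z) :
    Γ ≤ S.eq y z :=
  himp_elim (iInf_elim (iInf_elim (iInf_elim (and_right h) x) y) z) (le_inf h1 h2)

theorem isFun₂_total (h : Γ ≤ S.isFun₂ g a b c) (hx : Γ ≤ S.mem x a) (hy : Γ ≤ S.mem y b) :
    Γ ≤ S.ex c fun z => S.rel₂ g x y z :=
  (all_elim (all_elim (and_right (and_left h)) hx :) hy :)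

theorem isFun₂_unique (h : Γ ≤ S.isFun₂ g a b c) (h1 : Γ ≤ S.rel₂ g x y z)
    (h2 : Γ ≤ S.rel₂ g x y w) : Γ ≤ S.eq z w :=
  himp_elim (iInf_elim (iInf_elim (iInf_elim (iInf_elim (and_right h) x) y) z) w) (le_inf h1 h2)

namespace IsBishopModel

variable (hS : S.IsBishopModel)
include hS

theorem ext (h : Γ ≤ ⨅ x, S.mem x a ⇔ S.mem x b) : Γ ≤ S.eq a b :=
  h.trans (hS.extensionality a b)

theorem exists_isUPair (a b : M) : Γ ≤ ⨆ p, S.isUPair p a b := by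
  rw [hS.pairing]; exact le_top

theorem exists_isOPair (a b : M) : Γ ≤ ⨆ p, S.isOPair p a b := by
  refine iSup_elim (hS.exists_isUPair a a) fun s Δ hΔ hs => ?_
  refine iSup_elim (hS.exists_isUPair a b) fun t Δ hΔ ht => ?_
  grw [← hΔ] at *
  refine iSup_elim (hS.exists_isUPair s t) fun p Δ hΔ hp => ?_
  grw [← hΔ] at *
  exact iSup_intro p (iSup_intro s (iSup_intro t (le_inf (le_inf hs ht) hp)))

theorem exists_insert (a b : M) : Γ ≤ ⨆ u, ⨅ x, S.mem x u ⇔ (S.mem x a ⊔ S.eq x b) := by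
  refine iSup_elim (hS.exists_isUPair b b) fun s Δ hΔ hs => ?_
  refine iSup_elim (hS.exists_isUPair a s) fun t Δ hΔ ht => ?_
  grw [← hΔ] at *
  have hu : Δ ≤ ⨆ u, ⨅ x, S.mem x u ⇔ S.ex t fun y => S.mem x y := by
    rw [hS.union]; exact le_top
  refine iSup_elim hu fun u Δ hΔ hu => ?_
  grw [← hΔ] at *
  refine iSup_intro u (le_iInf fun x => iff_intro (fun Δ hΔ h => ?_) fun Δ hΔ h => ?_) <;>
    grw [← hΔ] at *
  · refine ex_elim (iff_mp (iInf_elim hu x) h) fun y Δ hΔ hy hx => ?_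
    grw [← hΔ] at *
    refine sup_elim (isUPair_mem ht hy) (fun Δ hΔ h => ?_) (fun Δ hΔ h => ?_) <;>
      grw [← hΔ] at *
    · exact inl (mem_right h hx)
    · exact inr (isUPair_self hs (mem_right h hx))
  · refine iff_mpr (iInf_elim hu x) (sup_elim h (fun Δ hΔ h => ?_) (fun Δ hΔ h => ?_)) <;>
      grw [← hΔ] at *
    · exact ex_intro a (isUPair_left ht) h
    · exact ex_intro s (isUPair_right ht) (mem_left (eq_sym h) (isUPair_left hs))

theorem collection (P : M → M → H) [S.Definable fun v => P (v 0) (v 1)]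
    (h : Γ ≤ S.all a fun x => ⨆ y, P x y) :
    Γ ≤ ⨆ b, (S.all a fun x => S.ex b fun y => P x y) ⊓
      S.all b fun y => S.ex a fun x => P x y := by
  obtain ⟨φ, e, he⟩ := Definable.binary (S := S) P a
  have := hS.strong_collection φ e a
  simp only [he] at this
  exact h.trans this

/-- Collect the witnesses for each `x`, then collect these sets and take the union. The second half
of strong collection, used at both levels, keeps unrelated elements out of the union. -/
theorem collection₂ (P : M → M → M → H) [hP : S.Definable fun v => P (v 0) (v 1) (v 2)]
    (h : Γ ≤ S.all a fun x => S.all b fun y => ⨆ z, P x y z) :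
    Γ ≤ ⨆ c, (S.all a fun x => S.all b fun y => S.ex c fun z => P x y z) ⊓
      S.all c fun z => S.ex a fun x => S.ex b fun y => P x y z := by
  have := hP.ternary_subst
  refine iSup_elim (hS.collection (a := a) (fun x c => (S.all b fun y => S.ex c fun z => P x y z) ⊓
    S.all c fun z => S.ex b fun y => P x y z) (all_intro fun x Δ hΔ hx => ?_)) fun D Δ hΔ hD => ?_
  · exact hS.collection (fun y z => P x y z) (all_elim (hΔ.trans h) hx :)
  clear h hΔ
  have hu : Δ ≤ ⨆ u, ⨅ x, S.mem x u ⇔ S.ex D fun y => S.mem x y := by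
    rw [hS.union]; exact le_top
  refine iSup_elim hu fun c Δ hΔ hc => iSup_intro c (le_inf ?_ ?_) <;> grw [← hΔ] at *
  · refine all_intro fun x Δ hΔ hx => all_intro fun y Δ hΔ' hy => ?_
    grw [← hΔ', ← hΔ] at *
    refine ex_elim (all_elim (and_left hD) hx :) fun e Δ hΔ he h => ?_
    grw [← hΔ] at *
    refine ex_elim (all_elim (and_left h) hy :) fun z Δ hΔ hz h => ?_
    grw [← hΔ] at *
    exact ex_intro z (iff_mpr (iInf_elim hc z) (ex_intro e he hz)) h
  · refine all_intro fun z Δ hΔ hz => ?_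
    grw [← hΔ] at *
    refine ex_elim (iff_mp (iInf_elim hc z) hz) fun e Δ hΔ he hz => ?_
    grw [← hΔ] at *
    refine ex_elim (all_elim (and_right hD) he :) fun x Δ hΔ hx h => ?_
    grw [← hΔ] at *
    exact ex_intro x hx (all_elim (and_right h) hz :)

/-- A definable single-valued total relation is the graph of a function of two variables. -/
theorem exists_isFun₂ (G : M → M → M → H) [hG : S.Definable fun v => G (v 0) (v 1) (v 2)]
    (h : Γ ≤ S.all a fun x => S.all b fun y => S.ex c fun z => G x y z)
    (hu : ∀ x y z w, ∀ Δ ≤ Γ, Δ ≤ G x y z → Δ ≤ G x y w → Δ ≤ S.eq z w) :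
    Γ ≤ ⨆ g, S.isFun₂ g a b c ⊓ ⨅ x, ⨅ y, ⨅ z, S.rel₂ g x y z ⇨ G x y z := by
  have := hG.ternary_subst
  have hQ : Γ ≤ S.all a fun x => S.all b fun y => ⨆ q, ⨆ z, ⨆ p,
      S.mem z c ⊓ G x y z ⊓ S.isOPair p x y ⊓ S.isOPair q p z := by
    refine all_intro fun x Δ hΔ hx => all_intro fun y Δ hΔ' hy => ?_
    clear hu
    grw [← hΔ', ← hΔ] at *
    refine ex_elim (all_elim (all_elim h hx :) hy :) fun z Δ hΔ hz h => ?_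
    grw [← hΔ] at *
    refine iSup_elim (hS.exists_isOPair x y) fun p Δ hΔ hp => ?_
    grw [← hΔ] at *
    refine iSup_elim (hS.exists_isOPair p z) fun q Δ hΔ hq => ?_
    grw [← hΔ] at *
    exact iSup_intro q (iSup_intro z (iSup_intro p (le_inf (le_inf (le_inf hz h) hp) hq)))
  -- Strong collection delivers the graph itself: every element of `g` codes a triple satisfying
  -- `G`. Separation, which is restricted to bounded formulas, is not needed.
  refine iSup_elim (hS.collection₂ (fun x y q => ⨆ z, ⨆ p,
      S.mem z c ⊓ G x y z ⊓ S.isOPair p x y ⊓ S.isOPair q p z) hQ) fun g Δ hΔ hg => ?_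
  have hg1 := and_left hg
  have hg2 := and_right hg
  clear h hQ hg
  have key : ∀ Θ ≤ Δ, ∀ x y z, Θ ≤ S.rel₂ g x y z → Θ ≤ G x y z := by
    intro Θ hΘ x y z h
    grw [← hΘ] at hg2
    clear hu hΔ hg1 hΘ
    refine iSup_elim h fun p Δ hΔ h => ?_
    grw [← hΔ] at *
    refine rel_elim (and_right h) fun q Δ hΔ hq hqp => ?_
    grw [← hΔ] at *
    refine ex_elim (all_elim hg2 hq :) fun x' Δ hΔ hx' h' => ?_
    grw [← hΔ] at *
    refine ex_elim h' fun y' Δ hΔ hy' h' => ?_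
    grw [← hΔ] at *
    refine iSup_elim h' fun z' Δ hΔ h' => ?_
    grw [← hΔ] at *
    refine iSup_elim h' fun p' Δ hΔ h' => ?_
    grw [← hΔ] at *
    have e1 := isOPair_congr_left (isOPair_fst (and_right h') hqp) (and_right (and_left h'))
    exact Definable.congr (fun z => G x y z) (isOPair_snd (and_right h') hqp)
      (Definable.congr (fun y => G x y z') (isOPair_snd e1 (and_left h))
      (Definable.congr (fun x => G x y' z') (isOPair_fst e1 (and_left h))
        (and_right (and_left (and_left h')))))
  refine iSup_intro g (le_inf (le_inf (le_inf ?_ ?_) ?_) ?_)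
  · refine all_intro fun q Δ hΔ hq => ?_
    grw [← hΔ] at hg2
    refine ex_elim (all_elim hg2 hq :) fun x Δ hΔ hx h => ex_intro x hx ?_
    refine ex_elim h fun y Δ hΔ hy h => ex_intro y hy ?_
    refine iSup_elim h fun z Δ hΔ h => iSup_elim h fun p Δ hΔ h => ?_
    exact ex_intro z (and_left (and_left (and_left h)))
      (iSup_intro p (le_inf (and_right (and_left h)) (and_right h)))
  · refine all_intro fun x Δ hΔ hx => all_intro fun y Δ hΔ' hy => ?_
    have hx := hΔ'.trans hx
    have hg1 := hΔ'.trans (hΔ.trans hg1)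
    refine ex_elim (all_elim (all_elim hg1 hx :) hy :) fun q Δ hΔ hq h => ?_
    refine iSup_elim h fun z Δ hΔ' h => iSup_elim h fun p Δ hΔ'' h => ?_
    exact ex_intro z (and_left (and_left (and_left h))) (iSup_intro p (le_inf
      (and_right (and_left h)) (rel_intro (hΔ''.trans (hΔ'.trans hq)) (and_right h))))
  · exact le_iInf fun x => le_iInf fun y => le_iInf fun z => le_iInf fun w =>
      himp_intro fun Θ hΘ h => hu x y z w Θ (hΘ.trans hΔ) (key Θ hΘ x y z (and_left h))
        (key Θ hΘ x y w (and_right h))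
  · exact le_iInf fun x => le_iInf fun y => le_iInf fun z => himp_intro fun Θ hΘ h =>
      key Θ hΘ x y z h

theorem set_ind (P : M → H) [S.Definable fun v => P (v 0)]
    (h : ∀ x, ∀ Δ ≤ Γ, (Δ ≤ S.all x P) → Δ ≤ P x) (x : M) : Γ ≤ P x := by
  obtain ⟨φ, e, he⟩ := Definable.unary (S := S) P x
  have := hS.set_induction φ e
  simp only [he] at this
  exact iInf_elim ((le_iInf fun x => himp_intro (h x)).trans this) x

/-- Thanks to this, a set is a point outside itself; the space X will serve as the point added to X.
-/
theorem mem_irrefl (x : M) : Γ ≤ (S.mem x x)ᶜ :=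
  hS.set_ind (fun x => (S.mem x x)ᶜ) (fun x Δ _ h => compl_intro fun Δ hΔ hx => by
    grw [← hΔ] at *
    exact compl_elim (all_elim h hx :) hx) x

theorem exists_isEmpty (m : M) : Γ ≤ ⨆ z, S.isEmpty z := by
  have h : Γ ≤ _ := le_top.trans (hS.bounded_separation .bot .bot (fun _ => m) m).ge
  refine iSup_elim h fun z Δ hΔ hz => iSup_intro z (le_iInf fun x => compl_intro ?_)
  intro Δ hΔ hx
  grw [← hΔ] at *
  exact and_right (iff_mp (iInf_elim hz x) hx)

theorem isEmpty_unique (h : Γ ≤ S.isEmpty a) (h' : Γ ≤ S.isEmpty b) : Γ ≤ S.eq a b :=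
  hS.ext (le_iInf fun x => iff_intro
    (fun _ hΔ hx => compl_elim (iInf_elim (hΔ.trans h) x) hx)
    (fun _ hΔ hx => compl_elim (iInf_elim (hΔ.trans h') x) hx))

theorem isSucc_unique (h : Γ ≤ S.isSucc s n) (h' : Γ ≤ S.isSucc t n) : Γ ≤ S.eq s t :=
  hS.ext (le_iInf fun x => iff_intro
    (fun _ hΔ hx => iff_mpr (iInf_elim (hΔ.trans h') x) (iff_mp (iInf_elim (hΔ.trans h) x) hx))
    (fun _ hΔ hx => iff_mpr (iInf_elim (hΔ.trans h) x) (iff_mp (iInf_elim (hΔ.trans h') x) hx)))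

end IsBishopModel

/-! ### Natural numbers -/

theorem isSucc_mem (h : Γ ≤ S.isSucc s n) (hx : Γ ≤ S.mem x s) : Γ ≤ S.mem x n ⊔ S.eq x n :=
  iff_mp (iInf_elim h x) hx

theorem mem_isSucc (h : Γ ≤ S.isSucc s n) (hx : Γ ≤ S.mem x n ⊔ S.eq x n) : Γ ≤ S.mem x s :=
  iff_mpr (iInf_elim h x) hx

theorem isOmega_zero (hN : Γ ≤ S.isOmega N) (hz : Γ ≤ S.isEmpty z) : Γ ≤ S.mem z N :=
  himp_elim (iInf_elim (and_left (and_left hN)) z) hz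

theorem isOmega_succ (hN : Γ ≤ S.isOmega N) (hn : Γ ≤ S.mem n N) (hs : Γ ≤ S.isSucc s n) :
    Γ ≤ S.mem s N :=
  himp_elim (iInf_elim (all_elim (and_right (and_left hN)) hn :) s :) hs

namespace IsBishopModel

variable (hS : S.IsBishopModel)
include hS

/-- The set `A` of zero and all successors of elements of `N`, obtained by collection, is inductive,
so leastness of `N` puts `N` inside `A`. -/
theorem nat_cases (hN : Γ ≤ S.isOmega N) (hn : Γ ≤ S.mem n N) :
    Γ ≤ S.isEmpty n ⊔ S.ex N fun m => S.isSucc n m := by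
  have h : Γ ≤ S.all N fun m => ⨆ s, S.isSucc s m :=
    all_intro fun m Δ _ _ => hS.exists_insert m m
  refine iSup_elim (hS.collection (fun m s => S.isSucc s m) h) fun b Δ hΔ hb => ?_
  grw [← hΔ] at *
  refine iSup_elim (hS.exists_isEmpty N) fun z Δ hΔ hz => ?_
  grw [← hΔ] at *
  refine iSup_elim (hS.exists_insert b z) fun A Δ hΔ hA => ?_
  grw [← hΔ] at *
  have key : ∀ Θ ≤ Δ, ∀ x, Θ ≤ S.mem x A → Θ ≤ S.isEmpty x ⊔ S.ex N fun m => S.isSucc x m := by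
    intro Θ hΘ x hx
    grw [← hΘ] at *
    refine sup_elim (iff_mp (iInf_elim hA x) hx) (fun Δ hΔ h => ?_) (fun Δ hΔ h => ?_) <;>
      grw [← hΔ] at *
    · exact inr (all_elim (and_right hb) h :)
    · exact inl (Definable.congr (fun z => S.isEmpty z) (eq_sym h) hz)
  have hind : Δ ≤ S.isInductive A := le_inf ?_ ?_
  · exact key _ le_rfl n (all_elim (himp_elim (iInf_elim (and_right hN) A :) hind :) hn :)
  · refine le_iInf fun z' => himp_intro fun Δ hΔ hz' => ?_
    grw [← hΔ] at *
    exact iff_mpr (iInf_elim hA z') (inr (hS.isEmpty_unique hz' hz))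
  · refine all_intro fun m Δ hΔ hm => le_iInf fun s => himp_intro fun Δ hΔ' hs => ?_
    have key' := key Δ (hΔ'.trans hΔ) m (hΔ'.trans hm)
    clear key
    grw [← hΔ', ← hΔ] at *
    have hmN : Δ ≤ S.mem m N := by
      refine sup_elim key' (fun Δ hΔ h => ?_) (fun Δ hΔ h => ?_) <;>
        grw [← hΔ] at *
      · exact isOmega_zero hN h
      · refine ex_elim h fun m' Δ hΔ hm' h => ?_
        grw [← hΔ] at *
        exact isOmega_succ hN hm' h
    refine ex_elim (all_elim (and_left hb) hmN :) fun s' Δ hΔ hs' h => ?_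
    grw [← hΔ] at *
    exact iff_mpr (iInf_elim hA s) (inl (mem_left (hS.isSucc_unique h hs) hs'))

/-- Leastness of `N` gives induction only for sets, and `P` need not cut out a set. Set induction
works for every formula; with `nat_cases` the predecessor `m` of `n` is an element of `n`, so the
hypothesis applies to it. -/
theorem nat_ind (P : M → H) [S.Definable fun v => P (v 0)] (hN : Γ ≤ S.isOmega N)
    (h0 : ∀ z, ∀ Δ ≤ Γ, Δ ≤ S.isEmpty z → Δ ≤ P z)
    (h1 : ∀ n s, ∀ Δ ≤ Γ, Δ ≤ S.mem n N → Δ ≤ S.isSucc s n → Δ ≤ P n → Δ ≤ P s)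
    (hn : Γ ≤ S.mem n N) : Γ ≤ P n := by
  refine himp_elim (hS.set_ind (fun n => S.mem n N ⇨ P n) (fun n Δ hΔ ih => ?_) n) hn
  refine himp_intro fun Θ hΘ hn => ?_
  have hΘΓ := hΘ.trans hΔ
  refine sup_elim (hS.nat_cases (hΘΓ.trans hN) hn) (fun Δ hΔ h => ?_) (fun Δ hΔ h => ?_)
  · exact h0 n Δ (hΔ.trans hΘΓ) h
  · refine ex_elim h fun m E hE hm h => ?_
    have hE' := hE.trans hΔ
    exact h1 m n E (hE'.trans hΘΓ) hm h (himp_elim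
      (all_elim (hE'.trans (hΘ.trans ih)) (mem_isSucc h (inr eq_rfl)) :) hm)

/-- Finitely many decisions can be made simultaneously. -/
theorem finite_decision (A B : M → H) [S.Definable fun v => A (v 0)]
    [S.Definable fun v => B (v 0)] (hN : Γ ≤ S.isOmega N) (hn : Γ ≤ S.mem n N)
    (h : Γ ≤ S.all n fun i => A i ⊔ B i) : Γ ≤ S.ex n A ⊔ S.all n B := by
  refine himp_elim (hS.nat_ind (fun n => (S.all n fun i => A i ⊔ B i) ⇨ (S.ex n A ⊔ S.all n B))
    hN (fun z Δ hΔ hz => ?_) (fun n s Δ hΔ hn hs ih => ?_) hn) h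
  · exact himp_intro fun Δ hΔ _ => inr (all_intro fun x Θ hΘ hx =>
      compl_elim (iInf_elim (hΘ.trans (hΔ.trans hz)) x) hx)
  · refine himp_intro fun Δ hΔ h => ?_
    clear * - hs h hΔ ih
    grw [← hΔ] at *
    have h' : Δ ≤ S.all n fun i => A i ⊔ B i := all_intro fun x Θ hΘ hx =>
      (all_elim (hΘ.trans h) (mem_isSucc (hΘ.trans hs) (inl hx)) :)
    refine sup_elim (himp_elim ih h') (fun Δ hΔ hA => ?_) (fun Δ hΔ hB => ?_) <;>
      grw [← hΔ] at *
    · refine ex_elim hA fun x Δ hΔ hx hA => inl (ex_intro x ?_ hA)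
      grw [← hΔ] at *
      exact mem_isSucc hs (inl hx)
    · have hn := mem_isSucc (x := n) hs (inr eq_rfl)
      refine sup_elim (all_elim h hn :) (fun Δ hΔ h => ?_) (fun Δ hΔ h => ?_) <;>
        grw [← hΔ] at *
      · exact inl (ex_intro n hn h)
      · refine inr (all_intro fun x Δ hΔ hx => ?_)
        grw [← hΔ] at *
        refine sup_elim (isSucc_mem hs hx) (fun Δ hΔ h => ?_) (fun Δ hΔ h => ?_) <;>
          grw [← hΔ] at *
        · exact (all_elim hB h :)
        · exact Definable.congr (fun x => B x) (eq_sym h) ‹_›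

/-- Countable choice. -/
theorem countable_choice (T : M → M → H) {E : M} [hT : S.Definable fun v => T (v 0) (v 1)]
    (hN : Γ ≤ S.isOmega N) (h : Γ ≤ S.all N fun n => S.ex E fun x => T n x) :
    Γ ≤ ⨆ s, S.isFun s N E ⊓ S.all N fun n => ⨅ x, S.rel s n x ⇨ T n x := by
  have := hT.binary_subst
  have h1 : Γ ≤ S.all N fun n => ⨆ p, ⨆ x, S.mem x E ⊓ T n x ⊓ S.isOPair p n x := by
    refine all_intro fun n Δ hΔ hn => ?_
    grw [← hΔ] at *
    refine ex_elim (all_elim h hn :) fun x Δ hΔ hx hT => ?_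
    refine iSup_elim (hS.exists_isOPair n x) fun p Δ hΔ' hp => ?_
    grw [← hΔ', ← hΔ] at *
    exact iSup_intro p (iSup_intro x (le_inf (le_inf hx hT) hp))
  -- `a` consists of pairs ⟨n, x⟩ with `T n x`, at least one for each `n`. Dependent choice will run
  -- on this set.
  refine iSup_elim (hS.collection
    (fun n p => ⨆ x, S.mem x E ⊓ T n x ⊓ S.isOPair p n x) h1) fun a Δ hΔ ha => ?_
  grw [← hΔ] at *
  clear h h1
  have ha1 := and_left ha
  have ha2 := and_right ha
  clear ha
  -- `Q p q` says that the first coordinate of `q` is the successor of that of `p`, so a chain along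
  -- `Q` started at a pair over zero visits every natural number once.
  let Q : M → M → H := fun p q =>
    ⨆ n, ⨆ m, ⨆ x, ⨆ y, S.isOPair p n x ⊓ S.isOPair q m y ⊓ S.isSucc m n
  have h1 : Δ ≤ S.all a fun p => ⨆ t, ⨆ q, S.mem q a ⊓ Q p q ⊓ S.isOPair t p q := by
    refine all_intro fun p Δ hΔ hp => ?_
    grw [← hΔ] at *
    refine ex_elim (all_elim ha2 hp :) fun n Δ hΔ hn h => ?_
    grw [← hΔ] at *
    refine iSup_elim h fun x Δ hΔ h => ?_
    grw [← hΔ] at *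
    refine iSup_elim (hS.exists_insert n n) fun m Δ hΔ hm => ?_
    grw [← hΔ] at *
    refine ex_elim (all_elim ha1 (isOmega_succ hN hn hm) :) fun q Δ hΔ hq h' => ?_
    grw [← hΔ] at *
    refine iSup_elim h' fun y Δ hΔ h' => ?_
    refine iSup_elim (hS.exists_isOPair p q) fun t Δ hΔ' ht => ?_
    grw [← hΔ', ← hΔ] at *
    exact iSup_intro t (iSup_intro q (le_inf (le_inf hq (iSup_intro n (iSup_intro m
      (iSup_intro x (iSup_intro y (le_inf (le_inf (and_right h) (and_right h')) hm)))))) ht))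
  refine iSup_elim (hS.collection
    (fun p t => ⨆ q, S.mem q a ⊓ Q p q ⊓ S.isOPair t p q) h1) fun r Δ hΔ hr => ?_
  grw [← hΔ] at *
  clear h1
  have hr1 : Δ ≤ S.all a fun p => S.ex a fun q => S.rel r p q := by
    refine all_intro fun p Δ hΔ hp => ?_
    grw [← hΔ] at *
    refine ex_elim (all_elim (and_left hr) hp :) fun t Δ hΔ ht h => ?_
    grw [← hΔ] at *
    refine iSup_elim h fun q Δ hΔ h => ?_
    grw [← hΔ] at *
    exact ex_intro q (and_left (and_left h)) (rel_intro ht (and_right h))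
  have hr2 : ∀ Θ ≤ Δ, ∀ p q, Θ ≤ S.rel r p q → Θ ≤ Q p q := by
    intro Θ hΘ p q h
    grw [← hΘ] at *
    refine rel_elim h fun t Δ hΔ ht h => ?_
    grw [← hΔ] at *
    refine ex_elim (all_elim (and_right hr) ht :) fun p' Δ hΔ hp h' => ?_
    grw [← hΔ] at *
    refine iSup_elim h' fun q' Δ hΔ h' => ?_
    grw [← hΔ] at *
    exact Definable.congr (fun p => Q p q) (isOPair_fst (and_right h') h)
      (Definable.congr (fun q => Q p' q) (isOPair_snd (and_right h') h)
        (and_right (and_left h')))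
  clear hr
  refine iSup_elim (hS.exists_isEmpty N) fun z Δ hΔ hz => ?_
  -- A hypothesis quantified over lower stages is restricted by hand when the stage shrinks.
  have hr2 := fun Θ hΘ => hr2 Θ (le_trans hΘ hΔ)
  grw [← hΔ] at *
  refine ex_elim (all_elim ha1 (isOmega_zero hN hz) :) fun b Δ hΔ hb hbz => ?_
  have hr2 := fun Θ hΘ => hr2 Θ (le_trans hΘ hΔ)
  grw [← hΔ] at *
  refine iSup_elim ((le_inf (le_inf hN hb) hr1).trans (hS.dependent_choice N a r b))
    fun g Δ hΔ hg => ?_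
  have hr2 := fun Θ hΘ => hr2 Θ (le_trans hΘ hΔ)
  grw [← hΔ] at *
  have hg1 := and_left (and_left hg)
  have hg2 := and_right (and_left hg)
  have hg3 := and_right hg
  clear hg
  -- By induction, `g(n)` is a pair with first coordinate `n`.
  have hfst : ∀ Θ ≤ Δ, ∀ n p, Θ ≤ S.rel g n p → Θ ≤ ⨆ x, S.isOPair p n x := by
    intro Θ hΘ n p h
    have hr2 := fun Θ' hΘ' => hr2 Θ' (le_trans hΘ' hΘ)
    grw [← hΘ] at *
    refine himp_elim (iInf_elim (hS.nat_ind (fun n => ⨅ p, S.rel g n p ⇨ ⨆ x, S.isOPair p n x)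
      hN ?_ ?_ (isFun_dom hg1 h)) p) h
    · refine fun z' Δ hΔ hz' => le_iInf fun p => himp_intro fun Δ hΔ' hp => ?_
      grw [← hΔ', ← hΔ] at *
      refine iSup_elim hbz fun x Δ hΔ h => ?_
      grw [← hΔ] at *
      exact iSup_intro x (isOPair_congr_left
        (isFun_unique hg1 (himp_elim (iInf_elim hg2 z' :) hz') hp)
        (isOPair_congr (hS.isEmpty_unique hz hz') eq_rfl (and_right h)))
    · refine fun n m Δ hΔ hn hm ih => le_iInf fun p => himp_intro fun Δ hΔ' hp => ?_
      have hr2 := fun Θ' hΘ' => hr2 Θ' (le_trans hΘ' (hΔ'.trans hΔ))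
      grw [← hΔ', ← hΔ] at *
      refine iSup_elim (himp_elim (iInf_elim (all_elim hg3 hn :) m :) hm) fun x Δ hΔ h => ?_
      refine iSup_elim h fun y Δ hΔ' h => ?_
      have hr2 := fun Θ' hΘ' => hr2 Θ' (le_trans hΘ' (hΔ'.trans hΔ))
      grw [← hΔ', ← hΔ] at *
      refine iSup_elim (himp_elim (iInf_elim ih x :) (and_left (and_left h))) fun u Δ hΔ hu => ?_
      have hQ := hr2 _ hΔ x y (hΔ.trans (and_right h))
      grw [← hΔ] at *
      refine iSup_elim hQ fun n' Δ hΔ hQ => ?_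
      grw [← hΔ] at *
      refine iSup_elim hQ fun m' Δ hΔ hQ => ?_
      grw [← hΔ] at *
      refine iSup_elim hQ fun x' Δ hΔ hQ => ?_
      grw [← hΔ] at *
      refine iSup_elim hQ fun y' Δ hΔ hQ => ?_
      grw [← hΔ] at *
      refine iSup_intro y' (isOPair_congr_left
        (isFun_unique hg1 (and_right (and_left h)) hp)
        (isOPair_congr (hS.isSucc_unique (n := n) ?_ hm) eq_rfl (and_right (and_left hQ))))
      exact Definable.congr (fun n => S.isSucc m' n)
        (isOPair_fst (and_left (and_left hQ)) hu) (and_right hQ)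
  have h1 : Δ ≤ S.all N fun n => ⨆ p, S.rel g n p := by
    refine all_intro fun n Δ hΔ hn => ?_
    grw [← hΔ] at *
    exact ex_elim (isFun_total hg1 hn) fun p Δ hΔ _ h => iSup_intro p h
  -- The range `s` of `g` contains exactly one pair over each `n`, so it is already the graph of the
  -- choice function.
  refine iSup_elim (hS.collection (fun n p => S.rel g n p) h1) fun s Δ hΔ hs => ?_
  have hfst := fun Θ hΘ => hfst Θ (le_trans hΘ hΔ)
  clear hr2 h1 hr1 hg2 hg3
  grw [← hΔ] at *
  have key : ∀ Θ ≤ Δ, ∀ p, Θ ≤ S.mem p s → Θ ≤ ⨆ n, ⨆ x,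
      S.rel g n p ⊓ S.isOPair p n x ⊓ S.mem n N ⊓ S.mem x E ⊓ T n x := by
    intro Θ hΘ p hp
    have hfst := fun Θ' hΘ' => hfst Θ' (le_trans hΘ' hΘ)
    grw [← hΘ] at *
    refine ex_elim (all_elim (and_right hs) hp :) fun m Δ hΔ hm hmp => ?_
    have hu := hfst Δ hΔ m p hmp
    grw [← hΔ] at *
    refine iSup_elim hu fun u Δ hΔ hu => ?_
    grw [← hΔ] at *
    refine ex_elim (all_elim ha2 (isFun_cod hg1 hmp) :) fun n Δ hΔ hn h => ?_
    grw [← hΔ] at *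
    refine iSup_elim h fun x Δ hΔ h => ?_
    grw [← hΔ] at *
    exact iSup_intro n (iSup_intro x (le_inf (le_inf (le_inf (le_inf
      (rel_congr (isOPair_fst hu (and_right h)) eq_rfl hmp) (and_right h)) hn)
      (and_left (and_left h))) (and_right (and_left h))))
  have key' : ∀ Θ ≤ Δ, ∀ n x, Θ ≤ S.rel s n x →
      Θ ≤ (⨆ p, S.rel g n p ⊓ S.isOPair p n x) ⊓ T n x := by
    intro Θ hΘ n x h
    refine rel_elim h fun p Δ hΔ hp hpx => ?_
    refine iSup_elim (key Δ (hΔ.trans hΘ) p hp) fun n' Δ hΔ h => ?_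
    grw [← hΔ] at *
    refine iSup_elim h fun x' Δ hΔ h => ?_
    grw [← hΔ] at *
    have e1 := isOPair_fst (and_right (and_left (and_left (and_left h)))) hpx
    have e2 := isOPair_snd (and_right (and_left (and_left (and_left h)))) hpx
    refine le_inf (iSup_intro p (le_inf
      (rel_congr e1 eq_rfl (and_left (and_left (and_left (and_left h))))) hpx)) ?_
    exact Definable.congr (fun x => T n x) e2
      (Definable.congr (fun n => T n x') e1 (and_right h))
  refine iSup_intro s (le_inf (le_inf (le_inf ?_ ?_) ?_) ?_)
  · refine all_intro fun p Δ hΔ hp => ?_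
    refine iSup_elim (key Δ hΔ p hp) fun n Δ hΔ h => iSup_elim h fun x Δ hΔ h => ?_
    exact ex_intro n (and_right (and_left (and_left h))) (ex_intro x (and_right (and_left h))
      (and_right (and_left (and_left (and_left h)))))
  · refine all_intro fun n Δ hΔ hn => ?_
    refine ex_elim (all_elim (and_left (hΔ.trans hs)) hn :) fun p Θ hΘ hp hnp => ?_
    have hΘΔ := hΘ.trans hΔ
    refine iSup_elim (hfst Θ hΘΔ n p hnp) fun u Θ' hΘ' hu => ?_
    refine iSup_elim (key Θ' (hΘ'.trans hΘΔ) p (hΘ'.trans hp)) fun n' Δ hΔ h => ?_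
    refine iSup_elim h fun x Δ' hΔ' h => ?_
    have hp' := and_right (and_left (and_left (and_left h)))
    have hu := hΔ'.trans (hΔ.trans hu)
    exact ex_intro x (and_right (and_left h)) (rel_intro (hΔ'.trans (hΔ.trans (hΘ'.trans hp)))
      (isOPair_congr (isOPair_fst hp' hu) eq_rfl hp'))
  · refine le_iInf fun n => le_iInf fun x => le_iInf fun y => himp_intro fun Θ hΘ h => ?_
    have hx := and_left (key' Θ hΘ n x (and_left h))
    have hy := and_left (key' Θ hΘ n y (and_right h))
    clear hfst key key'
    grw [← hΘ] at *
    refine iSup_elim hx fun p Δ hΔ hp => ?_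
    grw [← hΔ] at *
    refine iSup_elim hy fun q Δ hΔ hq => ?_
    grw [← hΔ] at *
    exact isOPair_snd (isOPair_congr_left (isFun_unique hg1 (and_left hp) (and_left hq))
      (and_right hp)) (and_right hq)
  · exact all_intro fun n Δ hΔ _ => le_iInf fun x => himp_intro fun Θ hΘ h =>
      and_right (key' Θ (hΘ.trans hΔ) n x h)

end IsBishopModel

end SetInterp

/-! ### Prime filters -/

/-- A prime filter of a bounded distributive lattice, as a two-valued truth predicate. -/
structure PrimeTruth (H : Type*) [Order.Frame H] where
  /-- the truth predicate -/
  holds : H → Prop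
  mono : ∀ {a b}, a ≤ b → holds a → holds b
  inf : ∀ {a b}, holds a → holds b → holds (a ⊓ b)
  sup : ∀ {a b}, holds (a ⊔ b) → holds a ∨ holds b
  bot : ¬ holds ⊥

/-- If `a ≤ b` fails, the filter above `a` misses the ideal below `b`, and the prime ideal theorem
separates them. The complement of the prime ideal is the truth predicate. -/
theorem PrimeTruth.exists_of_not_le {H : Type*} [Order.Frame H] {a b : H} (h : ¬ a ≤ b) :
    ∃ V : PrimeTruth H, V.holds a ∧ ¬ V.holds b := by
  have hd : Disjoint (Order.PFilter.principal a : Set H) (Order.Ideal.principal b : Set H) := by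
    rw [Set.disjoint_left]
    intro x hx hx'
    exact h (le_trans (Order.PFilter.mem_principal.1 hx) (Order.Ideal.mem_principal.1 hx'))
  obtain ⟨J, hJ, hb, ha⟩ := DistribLattice.prime_ideal_of_disjoint_filter_ideal hd
  rw [Set.disjoint_left] at ha
  refine ⟨⟨fun x => x ∉ J, fun {x y} hxy hx hy => hx (J.lower hxy hy), fun {x y} hx hy hxy => ?_,
    fun {x y} hxy => ?_, fun h => h J.bot_mem⟩, ha (Order.PFilter.mem_principal.2 le_rfl),
    fun h => h (hb (Order.Ideal.mem_principal.2 le_rfl))⟩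
  · exact (hJ.mem_or_mem hxy).elim hx hy
  · by_contra hc
    push Not at hc
    exact hxy (J.sup_mem hc.1 hc.2)

theorem le_of_forall_primeTruth {H : Type*} [Order.Frame H] {a b : H}
    (h : ∀ V : PrimeTruth H, V.holds a → V.holds b) : a ≤ b := by
  by_contra hab
  obtain ⟨V, ha, hb⟩ := PrimeTruth.exists_of_not_le hab
  exact hb (h V ha)

namespace PrimeTruth

variable {H : Type*} [Order.Frame H] (V : PrimeTruth H) {Γ a b c d : H}

/-- A prime filter respects finite meets and joins but in general neither implications nor infinite
joins, so it is entailments at stages that are transported, not implications. -/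
theorem map₁ (hΓ : V.holds Γ) (h : ∀ Δ ≤ Γ, Δ ≤ a → Δ ≤ b) (ha : V.holds a) : V.holds b :=
  V.mono (h _ inf_le_left inf_le_right) (V.inf hΓ ha)

theorem map₂ (hΓ : V.holds Γ) (h : ∀ Δ ≤ Γ, Δ ≤ a → Δ ≤ b → Δ ≤ c) (ha : V.holds a)
    (hb : V.holds b) : V.holds c :=
  V.map₁ (V.inf hΓ ha) (fun _ hΔ h' => h _ (and_left hΔ) (and_right hΔ) h') hb

theorem map₃ (hΓ : V.holds Γ) (h : ∀ Δ ≤ Γ, Δ ≤ a → Δ ≤ b → Δ ≤ c → Δ ≤ d) (ha : V.holds a)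
    (hb : V.holds b) (hc : V.holds c) : V.holds d :=
  V.map₂ (V.inf hΓ ha) (fun _ hΔ h' => h _ (and_left hΔ) (and_right hΔ) h') hb hc

end PrimeTruth

/-! ### Constructively ordered rings in a classical metatheory -/

/-- An asymmetric and cotransitive strict order on a commutative ring which is compatible with
the operations. -/
structure IsCotransitiveOrder {B : Type*} [CommRing B] (lt : B → B → Prop) : Prop where
  asymm : ∀ x y, lt x y → ¬ lt y x
  cotrans : ∀ x y z, lt x y → lt x z ∨ lt z y
  add_right : ∀ x y z, lt x y → lt (x + z) (y + z)
  mul_pos : ∀ x y, lt 0 x → lt 0 y → lt 0 (x * y)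
  zero_lt_one : lt 0 1

namespace IsCotransitiveOrder

universe u

variable {B : Type u} [CommRing B] {lt : B → B → Prop} (h : IsCotransitiveOrder lt)
include h

theorem lt_iff {x y : B} : lt x y ↔ lt 0 (y - x) := by
  constructor
  · intro hl
    have := h.add_right _ _ (-x) hl
    rwa [add_neg_cancel, ← sub_eq_add_neg] at this
  · intro hl
    have := h.add_right _ _ x hl
    rwa [zero_add, sub_add_cancel] at this

theorem not_pos_neg {x : B} (hx : lt 0 x) : ¬ lt 0 (-x) := by
  intro h'
  refine h.asymm _ _ hx (h.lt_iff.2 ?_)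
  rwa [zero_sub]

theorem irrefl : ¬ lt 0 0 := fun h' => h.asymm _ _ h' h'

/-- Cotransitivity of `0 < x + y` at the point `x`. Together with asymmetry it replaces
transitivity, which is not among the axioms. -/
theorem pos_or {x y : B} (hxy : lt 0 (x + y)) : lt 0 x ∨ lt 0 y := by
  refine (h.cotrans _ _ x hxy).imp id fun h' => ?_
  rw [h.lt_iff] at h'
  rwa [add_sub_cancel_left] at h'

theorem pos_add {x y : B} (hx : lt 0 x) (hy : lt 0 y) : lt 0 (x + y) := by
  have : lt 0 ((x + y) + -y) := by rwa [add_neg_cancel_right]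
  exact (h.pos_or this).resolve_right (h.not_pos_neg hy)

section

variable (hinv : ∀ x, lt 0 x → ∃ y, x * y = 1 ∧ lt 0 y)
include hinv

/-- If `x` is neither positive nor negative, it cannot be told from 0 by the order, so `k ± x` is
positive for every positive `k`. Taking `k = 1/K` with `K ± v` positive, the sum (k - x)(K + v) + (k
+ x)(K - v) = 2kK - 2xv is positive and also equals 2 - 2 = 0. -/
theorem apart_of_mul_eq_one {x v : B} (hxv : x * v = 1) : lt 0 x ∨ lt 0 (-x) := by
  by_contra hc
  push Not at hc
  -- `K` is 1 + |v|, or 1 when `v` is neither positive nor negative; the sign of `v` is decided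
  -- classically.
  obtain ⟨K, hK, h1, h2⟩ : ∃ K, lt 0 K ∧ lt 0 (K + v) ∧ lt 0 (K - v) := by
    by_cases hv : lt 0 v
    · refine ⟨1 + v, h.pos_add h.zero_lt_one hv,
        h.pos_add (h.pos_add h.zero_lt_one hv) hv, ?_⟩
      rw [add_sub_cancel_right]; exact h.zero_lt_one
    by_cases hv' : lt 0 (-v)
    · refine ⟨1 + -v, h.pos_add h.zero_lt_one hv', ?_, ?_⟩
      · rw [neg_add_cancel_right]; exact h.zero_lt_one
      · rw [sub_eq_add_neg]; exact h.pos_add (h.pos_add h.zero_lt_one hv') hv'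
    · refine ⟨1, h.zero_lt_one, ?_, ?_⟩
      · have : lt 0 ((1 + v) + -v) := by rw [add_neg_cancel_right]; exact h.zero_lt_one
        exact (h.pos_or this).resolve_right hv'
      · have : lt 0 ((1 - v) + v) := by rw [sub_add_cancel]; exact h.zero_lt_one
        exact (h.pos_or this).resolve_right hv
  obtain ⟨k, hk, hk0⟩ := hinv K hK
  have h3 : lt 0 (k - x) := by
    have : lt 0 ((k - x) + x) := by rwa [sub_add_cancel]
    exact (h.pos_or this).resolve_right hc.1
  have h4 : lt 0 (k + x) := by
    have : lt 0 ((k + x) + -x) := by rwa [add_neg_cancel_right]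
    exact (h.pos_or this).resolve_right hc.2
  have h5 := h.pos_add (h.mul_pos _ _ h3 h1) (h.mul_pos _ _ h4 h2)
  have h6 : (k - x) * (K + v) + (k + x) * (K - v) = 0 := by
    linear_combination 2 * hk - 2 * hxv
  rw [h6] at h5
  exact h.irrefl h5

/-- An inverse of `x * y` makes `x` invertible. This is what makes the elements not apart from 0 an
ideal. -/
theorem apart_of_mul_pos {x y : B} (hxy : lt 0 (x * y)) : lt 0 x ∨ lt 0 (-x) := by
  obtain ⟨w, hw, -⟩ := hinv _ hxy
  rw [mul_assoc] at hw
  exact h.apart_of_mul_eq_one hinv hw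

/-- A cotransitively ordered ring maps onto a linearly ordered ring, strict order being
preserved and reflected. -/
theorem exists_linearOrder : ∃ (K : Type u) (_ : CommRing K) (_ : LinearOrder K)
    (_ : IsStrictOrderedRing K) (π : B →+* K), ∀ x y, lt x y ↔ π x < π y := by
  classical
  -- The elements not apart from 0. Dividing by them makes the order total, since classically every
  -- other element is positive or negative.
  let I : Ideal B :=
    { carrier := {x | ¬ lt 0 x ∧ ¬ lt 0 (-x)}
      zero_mem' := by simpa using h.irrefl
      add_mem' := fun {x y} hx hy => ⟨fun h' => (h.pos_or h').elim hx.1 hy.1, fun h' => by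
        rw [neg_add] at h'
        exact (h.pos_or h').elim hx.2 hy.2⟩
      smul_mem' := fun c x hx => ⟨fun h' => by
          rw [smul_eq_mul, mul_comm] at h'
          exact (h.apart_of_mul_pos hinv h').elim hx.1 hx.2, fun h' => by
          rw [smul_eq_mul, mul_comm, ← mul_neg] at h'
          exact (h.apart_of_mul_pos hinv h').elim hx.1 hx.2⟩ }
  have hI : ∀ x, x ∈ I ↔ ¬ lt 0 x ∧ ¬ lt 0 (-x) := fun x => Iff.rfl
  let π := Ideal.Quotient.mk I
  -- Positivity depends only on the class modulo `I`, because a difference in `I` is not positive.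
  have key : ∀ x y, π x = π y → lt 0 x → lt 0 y := by
    intro x y hxy hx
    have h1 := (hI _).1 ((Ideal.Quotient.mk_eq_mk_iff_sub_mem x y).1 hxy)
    have : lt 0 ((x - y) + y) := by rwa [sub_add_cancel]
    exact (h.pos_or this).resolve_left h1.1
  let C : RingCone (B ⧸ I) :=
    { carrier := {k | ∀ x, π x = k → ¬ lt 0 (-x)}
      mul_mem' := by
        intro a b ha hb x hx hneg
        obtain ⟨y, rfl⟩ := Ideal.Quotient.mk_surjective a
        obtain ⟨z, rfl⟩ := Ideal.Quotient.mk_surjective b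
        have h1 : lt 0 (-(y * z)) := key (-x) _ (by rw [map_neg, hx, map_neg, map_mul]) hneg
        have hy := ha y rfl
        have hz := hb z rfl
        have hy' := (h.apart_of_mul_pos hinv (x := y) (y := -z) (by rwa [mul_neg])).resolve_right hy
        have hz' := (h.apart_of_mul_pos hinv (x := z) (y := -y)
          (by rwa [mul_neg, mul_comm])).resolve_right hz
        exact h.not_pos_neg (h.mul_pos _ _ hy' hz') h1
      one_mem' := fun x hx hneg => h.not_pos_neg h.zero_lt_one
        (key (-x) (-1) (by rw [map_neg, hx, map_neg, map_one]) hneg)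
      add_mem' := by
        intro a b ha hb x hx hneg
        obtain ⟨y, rfl⟩ := Ideal.Quotient.mk_surjective a
        obtain ⟨z, rfl⟩ := Ideal.Quotient.mk_surjective b
        have h1 : lt 0 (-y + -z) :=
          key (-x) _ (by rw [map_neg, hx, map_add, map_neg, map_neg, neg_add]) hneg
        exact (h.pos_or h1).elim (ha y rfl) (hb z rfl)
      zero_mem' := fun x hx hneg => h.irrefl
        (key (-x) 0 (by rw [map_neg, hx, map_zero, neg_zero]) hneg)
      eq_zero_of_mem_of_neg_mem' := by
        intro a ha hb
        obtain ⟨y, rfl⟩ := Ideal.Quotient.mk_surjective a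
        refine Ideal.Quotient.eq_zero_iff_mem.2 ((hI y).2 ⟨?_, ha y rfl⟩)
        have := hb (-y) (map_neg _ _)
        rwa [neg_neg] at this }
  have hC : ∀ x, π x ∈ C ↔ ¬ lt 0 (-x) := fun x =>
    ⟨fun h' => h' x rfl, fun h' y hy hneg => h' (key _ _ (by rw [map_neg, hy, map_neg]) hneg)⟩
  have : HasMemOrNegMem C := ⟨fun a => by
    obtain ⟨y, rfl⟩ := Ideal.Quotient.mk_surjective a
    by_cases hy : lt 0 y
    · exact Or.inl ((hC y).2 (h.not_pos_neg hy))
    · right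
      change -π y ∈ C
      rw [← map_neg]
      exact (hC (-y)).2 (by rwa [neg_neg])⟩
  let : LinearOrder (B ⧸ I) := LinearOrder.mkOfAddGroupCone C
  have : IsOrderedRing (B ⧸ I) := IsOrderedRing.mkOfCone C
  have hlt : ∀ x y, lt x y ↔ π x < π y := by
    intro x y
    rw [h.lt_iff, ← not_le]
    have : π y ≤ π x ↔ π x - π y ∈ C := Iff.rfl
    rw [this, ← map_sub, hC, not_not, neg_sub]
  have : Nontrivial (B ⧸ I) := ⟨π 0, π 1, ((hlt 0 1).1 h.zero_lt_one).ne⟩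
  refine ⟨B ⧸ I, inferInstance, inferInstance, IsStrictOrderedRing.of_mul_pos ?_, π, hlt⟩
  intro a b ha hb
  obtain ⟨y, rfl⟩ := Ideal.Quotient.mk_surjective a
  obtain ⟨z, rfl⟩ := Ideal.Quotient.mk_surjective b
  have h1 := (hlt 0 y).2 (by rwa [map_zero])
  have h2 := (hlt 0 z).2 (by rwa [map_zero])
  have := (hlt 0 (y * z)).1 (h.mul_pos _ _ h1 h2)
  rwa [map_zero, map_mul] at this

end

end IsCotransitiveOrder

/-! ### Denotation of terms -/

namespace SetInterp

variable {H : Type*} [Order.Frame H] {M : Type*} (S : SetInterp H M)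

/-- The terms `s` and `t` have the same denotations. -/
def steq {H : Type*} [Order.Frame H] {M : Type*} (s t : M → H) : H := ⨅ r, s r ⇔ t r

/-- The term `s` denotes an element of `A`. -/
def isIn (A : M) (s : M → H) : H := ⨆ a, S.mem a A ⊓ steq s (S.var a)

variable {S} {Γ Δ ψ : H} {a b c g x y z A B C : M} {s s' t t' u u' : M → H}

theorem steq_refl (s : M → H) : Γ ≤ steq s s := le_iInf fun _ => by simp

theorem steq_symm (h : Γ ≤ steq s t) : Γ ≤ steq t s :=
  le_iInf fun r => by rw [bihimp_comm]; exact iInf_elim h r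

theorem steq_app (h : Γ ≤ steq s t) {r : M} (hs : Γ ≤ s r) : Γ ≤ t r := iff_mp (iInf_elim h r) hs

theorem steq_app' (h : Γ ≤ steq s t) {r : M} (hs : Γ ≤ t r) : Γ ≤ s r :=
  iff_mpr (iInf_elim h r) hs

theorem steq_intro (h : ∀ r, ∀ Δ ≤ Γ, Δ ≤ s r → Δ ≤ t r) (h' : ∀ r, ∀ Δ ≤ Γ, Δ ≤ t r → Δ ≤ s r) :
    Γ ≤ steq s t :=
  le_iInf fun r => iff_intro (h r) (h' r)

theorem steq_trans (h : Γ ≤ steq s t) (h' : Γ ≤ steq t u) : Γ ≤ steq s u :=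
  steq_intro (fun _ _ hΔ hs => steq_app (hΔ.trans h') (steq_app (hΔ.trans h) hs))
    fun _ _ hΔ hs => steq_app' (hΔ.trans h) (steq_app' (hΔ.trans h') hs)

theorem isIn_elim (h : Γ ≤ S.isIn A s)
    (k : ∀ a, ∀ Δ ≤ Γ, Δ ≤ S.mem a A → Δ ≤ steq s (S.var a) → Δ ≤ ψ) : Γ ≤ ψ :=
  iSup_elim h fun a Δ hΔ h => k a Δ hΔ (and_left h) (and_right h)

theorem isIn_intro (ha : Γ ≤ S.mem a A) (h : Γ ≤ steq s (S.var a)) : Γ ≤ S.isIn A s :=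
  iSup_intro a (le_inf ha h)

theorem isIn_var (ha : Γ ≤ S.mem a A) : Γ ≤ S.isIn A (S.var a) := isIn_intro ha (steq_refl _)

theorem isIn_congr (h : Γ ≤ steq s t) (hs : Γ ≤ S.isIn A s) : Γ ≤ S.isIn A t :=
  isIn_elim hs fun _ _ hΔ ha hs => isIn_intro ha (steq_trans (steq_symm (hΔ.trans h)) hs)

theorem steq_var (h : Γ ≤ S.eq a b) : Γ ≤ steq (S.var a) (S.var b) :=
  steq_intro (fun _ _ hΔ hr => eq_tr hr (hΔ.trans h))
    fun _ _ hΔ hr => eq_tr hr (eq_sym (hΔ.trans h))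

theorem eq_of_steq_var (h : Γ ≤ steq (S.var a) (S.var b)) : Γ ≤ S.eq a b :=
  steq_app h (r := a) eq_rfl

theorem app_congr (h : Γ ≤ steq s t) : Γ ≤ steq (S.app g s) (S.app g t) := by
  have aux : ∀ {s t : M → H} {Γ : H}, Γ ≤ steq s t → ∀ r, ∀ Δ ≤ Γ, Δ ≤ S.app g s r →
      Δ ≤ S.app g t r := by
    intro s t Γ h r Δ hΔ hr
    refine iSup_elim hr fun a Δ hΔ' ha => iSup_intro a ?_
    exact le_inf (steq_app (hΔ'.trans (hΔ.trans h)) (and_left ha)) (and_right ha)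
  exact steq_intro (aux h) (aux (steq_symm h))

theorem app₂_congr (h : Γ ≤ steq s s') (h' : Γ ≤ steq t t') :
    Γ ≤ steq (S.app₂ g s t) (S.app₂ g s' t') := by
  have aux : ∀ {s t s' t' : M → H} {Γ : H}, Γ ≤ steq s s' → Γ ≤ steq t t' →
      ∀ r, ∀ Δ ≤ Γ, Δ ≤ S.app₂ g s t r → Δ ≤ S.app₂ g s' t' r := by
    intro s t s' t' Γ h h' r Δ hΔ hr
    refine iSup_elim hr fun a Δ hΔ₁ hr => iSup_elim hr fun b Δ hΔ₂ ha =>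
      iSup_intro a (iSup_intro b ?_)
    have hΔ := hΔ₂.trans (hΔ₁.trans hΔ)
    exact le_inf (le_inf (steq_app (hΔ.trans h) (and_left (and_left ha)))
      (steq_app (hΔ.trans h') (and_right (and_left ha)))) (and_right ha)
  exact steq_intro (aux h h') (aux (steq_symm h) (steq_symm h'))

theorem teq_congr (h : Γ ≤ steq s s') (h' : Γ ≤ steq t t') (hst : Γ ≤ teq s t) :
    Γ ≤ teq s' t' :=
  iSup_elim hst fun r _ hΔ hr => iSup_intro r
    (le_inf (steq_app (hΔ.trans h) (and_left hr)) (steq_app (hΔ.trans h') (and_right hr)))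

theorem lt_congr {R : RealLineData M} (h : Γ ≤ steq s s') (h' : Γ ≤ steq t t')
    (hst : Γ ≤ S.lt R s t) : Γ ≤ S.lt R s' t' :=
  iSup_elim hst fun a _ hΔ₁ hst => iSup_elim hst fun b _ hΔ₂ hst => by
    have hΔ := hΔ₂.trans hΔ₁
    exact iSup_intro a (iSup_intro b (le_inf (le_inf (steq_app (hΔ.trans h)
      (and_left (and_left hst))) (steq_app (hΔ.trans h') (and_right (and_left hst))))
      (and_right hst)))

theorem le_congr {R : RealLineData M} (h : Γ ≤ steq s s') (h' : Γ ≤ steq t t')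
    (hst : Γ ≤ S.le R s t) : Γ ≤ S.le R s' t' :=
  iSup_elim hst fun a _ hΔ₁ hst => iSup_elim hst fun b _ hΔ₂ hst => by
    have hΔ := hΔ₂.trans hΔ₁
    exact iSup_intro a (iSup_intro b (le_inf (le_inf (steq_app (hΔ.trans h)
      (and_left (and_left hst))) (steq_app (hΔ.trans h') (and_right (and_left hst))))
      (and_right hst)))

theorem lt_var_iff {R : RealLineData M} : Γ ≤ S.lt R (S.var a) (S.var b) ↔ Γ ≤ S.rel R.lt a b :=
  ⟨fun h => iSup_elim h fun _ _ _ h => iSup_elim h fun _ _ _ h =>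
    rel_congr (and_left (and_left h)) (and_right (and_left h)) (and_right h),
  fun h => iSup_intro a (iSup_intro b (le_inf (le_inf eq_rfl eq_rfl) h))⟩

theorem eq_of_teq_var (h : Γ ≤ teq (S.var a) (S.var b)) : Γ ≤ S.eq a b :=
  iSup_elim h fun _ _ _ h => eq_tr (eq_sym (and_left h)) (and_right h)

/-- `teq` only asserts a common denotation. A term that denotes an element has no other denotation
up to equality, so the two notions then agree. -/
theorem steq_of_teq (hs : Γ ≤ S.isIn A s) (ht : Γ ≤ S.isIn B t) (h : Γ ≤ teq s t) :
    Γ ≤ steq s t := by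
  refine isIn_elim hs fun a Δ hΔ _ ha => ?_
  grw [← hΔ] at *
  refine isIn_elim ht fun b Δ hΔ _ hb => ?_
  grw [← hΔ] at *
  exact steq_trans ha (steq_trans (steq_var (eq_of_teq_var (teq_congr ha hb h))) (steq_symm hb))

theorem teq_of_steq (hs : Γ ≤ S.isIn A s) (h : Γ ≤ steq s t) : Γ ≤ teq s t :=
  isIn_elim hs fun a _ hΔ _ ha => by
    have := steq_app' ha (r := a) eq_rfl
    exact iSup_intro a (le_inf this (steq_app (hΔ.trans h) this))

theorem app_var_eq (g x : M) : S.app g (S.var x) = fun r => S.rel g x r := by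
  funext r
  refine le_antisymm (iSup_elim le_rfl fun a Δ _ h => ?_) (iSup_intro x (le_inf eq_rfl le_rfl))
  exact rel_congr (and_left h) eq_rfl (and_right h)

theorem app₂_var_eq (g x y : M) : S.app₂ g (S.var x) (S.var y) = fun r => S.rel₂ g x y r := by
  funext r
  refine le_antisymm (iSup_elim le_rfl fun a Δ _ h => iSup_elim h fun b Δ _ h => ?_)
    (iSup_intro x (iSup_intro y (le_inf (le_inf eq_rfl eq_rfl) le_rfl)))
  exact rel₂_congr (and_left (and_left h)) (and_right (and_left h)) eq_rfl (and_right h)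

theorem steq_app_var (hg : Γ ≤ S.isFun g A B) (h : Γ ≤ S.rel g x y) :
    Γ ≤ steq (S.app g (S.var x)) (S.var y) := by
  rw [app_var_eq]
  exact steq_intro (fun _ _ hΔ hr => isFun_unique (hΔ.trans hg) hr (hΔ.trans h))
    fun _ _ hΔ hr => rel_congr eq_rfl (eq_sym hr) (hΔ.trans h)

theorem steq_app₂_var (hg : Γ ≤ S.isFun₂ g A B C) (h : Γ ≤ S.rel₂ g x y z) :
    Γ ≤ steq (S.app₂ g (S.var x) (S.var y)) (S.var z) := by
  rw [app₂_var_eq]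
  exact steq_intro (fun _ _ hΔ hr => isFun₂_unique (hΔ.trans hg) hr (hΔ.trans h))
    fun _ _ hΔ hr => rel₂_congr eq_rfl eq_rfl (eq_sym hr) (hΔ.trans h)

theorem isIn_unique (hs : Γ ≤ S.isIn A s) (ha : Γ ≤ s a) (hb : Γ ≤ s b) : Γ ≤ S.eq a b :=
  isIn_elim hs fun _ _ hΔ _ hs =>
    eq_tr (steq_app hs (hΔ.trans ha)) (eq_sym (steq_app hs (hΔ.trans hb)))

theorem steq_of_app (hs : Γ ≤ S.isIn A s) (ha : Γ ≤ s a) : Γ ≤ steq s (S.var a) :=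
  isIn_elim hs fun _ _ hΔ _ hs => steq_trans hs (steq_var (eq_sym (steq_app hs (hΔ.trans ha))))

theorem isIn_app (hg : Γ ≤ S.isFun g A B) (hs : Γ ≤ S.isIn A s) : Γ ≤ S.isIn B (S.app g s) := by
  refine isIn_elim hs fun a Δ hΔ ha hs => ?_
  grw [← hΔ] at *
  refine ex_elim (isFun_total hg ha) fun y Δ hΔ hy h => ?_
  grw [← hΔ] at *
  exact isIn_intro hy (steq_trans (app_congr hs) (steq_app_var hg h))

theorem isIn_app₂ (hg : Γ ≤ S.isFun₂ g A B C) (hs : Γ ≤ S.isIn A s) (ht : Γ ≤ S.isIn B t) :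
    Γ ≤ S.isIn C (S.app₂ g s t) := by
  refine isIn_elim hs fun a Δ hΔ ha hs => ?_
  grw [← hΔ] at *
  refine isIn_elim ht fun b Δ hΔ hb ht => ?_
  grw [← hΔ] at *
  refine ex_elim (isFun₂_total hg ha hb) fun y Δ hΔ hy h => ?_
  grw [← hΔ] at *
  exact isIn_intro hy (steq_trans (app₂_congr hs ht) (steq_app₂_var hg h))

/-! ### The commutative ring of germs of real terms at a prime filter -/

section Ring

variable {R : RealLineData M}

/-- The term `s` denotes a real number. -/
abbrev isReal (S : SetInterp H M) (R : RealLineData M) (s : M → H) : H := S.isIn R.carrier s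

variable (S R) in
/-- The term `-s`. -/
def neg (s : M → H) : M → H := fun r =>
  S.mem r R.carrier ⊓ teq (S.app₂ R.add s (S.var r)) (S.var R.zero)

instance DefinableTerm.neg {s : (ℕ → M) → M → H} [hs : S.DefinableTerm s] :
    S.DefinableTerm fun v => S.neg R (s v) := by
  have := hs.tail
  constructor
  unfold SetInterp.neg
  infer_instance

variable (hF : Γ ≤ S.isField R)
include hF

theorem isReal_add (hs : Γ ≤ S.isReal R s) (ht : Γ ≤ S.isReal R t) :
    Γ ≤ S.isReal R (S.app₂ R.add s t) := by
  simp only [isField, le_inf_iff] at hF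
  exact isIn_app₂ hF.1.1.1.1.1.1.1.1.1.1.1.1.1 hs ht

theorem isReal_mul (hs : Γ ≤ S.isReal R s) (ht : Γ ≤ S.isReal R t) :
    Γ ≤ S.isReal R (S.app₂ R.mul s t) := by
  simp only [isField, le_inf_iff] at hF
  exact isIn_app₂ hF.1.1.1.1.1.1.1.1.1.1.1.1.2 hs ht

theorem zero_mem : Γ ≤ S.mem R.zero R.carrier := by
  simp only [isField, le_inf_iff] at hF
  exact hF.1.1.1.1.1.1.1.1.1.1.2

theorem one_mem : Γ ≤ S.mem R.one R.carrier := by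
  simp only [isField, le_inf_iff] at hF
  exact hF.1.1.1.1.1.1.1.1.1.2

theorem steq_add_assoc (hs : Γ ≤ S.isReal R s) (ht : Γ ≤ S.isReal R t) (hu : Γ ≤ S.isReal R u) :
    Γ ≤ steq (S.app₂ R.add (S.app₂ R.add s t) u) (S.app₂ R.add s (S.app₂ R.add t u)) := by
  refine steq_of_teq (isReal_add hF (isReal_add hF hs ht) hu)
    (isReal_add hF hs (isReal_add hF ht hu)) ?_
  simp only [isField, le_inf_iff] at hF
  have hax := hF.1.1.1.1.1.1.1.1.2
  clear hF
  refine isIn_elim hs fun a Δ hΔ ha hs => ?_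
  grw [← hΔ] at *
  refine isIn_elim ht fun b Δ hΔ hb ht => ?_
  grw [← hΔ] at *
  refine isIn_elim hu fun c Δ hΔ hc hu => ?_
  grw [← hΔ] at *
  exact teq_congr (steq_symm (app₂_congr (app₂_congr hs ht) hu))
    (steq_symm (app₂_congr hs (app₂_congr ht hu)))
    (all_elim (all_elim (all_elim hax ha :) hb :) hc :)

theorem steq_add_comm (hs : Γ ≤ S.isReal R s) (ht : Γ ≤ S.isReal R t) :
    Γ ≤ steq (S.app₂ R.add s t) (S.app₂ R.add t s) := by
  refine steq_of_teq (isReal_add hF hs ht) (isReal_add hF ht hs) ?_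
  simp only [isField, le_inf_iff] at hF
  have hax := hF.1.1.1.1.1.1.1.2
  clear hF
  refine isIn_elim hs fun a Δ hΔ ha hs => ?_
  grw [← hΔ] at *
  refine isIn_elim ht fun b Δ hΔ hb ht => ?_
  grw [← hΔ] at *
  exact teq_congr (steq_symm (app₂_congr hs ht)) (steq_symm (app₂_congr ht hs))
    (all_elim (all_elim hax ha :) hb :)

theorem steq_add_zero (hs : Γ ≤ S.isReal R s) :
    Γ ≤ steq (S.app₂ R.add s (S.var R.zero)) s := by
  refine steq_of_teq (isReal_add hF hs (isIn_var (zero_mem hF))) hs ?_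
  simp only [isField, le_inf_iff] at hF
  have hax := hF.1.1.1.1.1.1.2
  clear hF
  refine isIn_elim hs fun a Δ hΔ ha hs => ?_
  grw [← hΔ] at *
  exact teq_congr (steq_symm (app₂_congr hs (steq_refl _))) (steq_symm hs) (all_elim hax ha :)

theorem steq_mul_assoc (hs : Γ ≤ S.isReal R s) (ht : Γ ≤ S.isReal R t) (hu : Γ ≤ S.isReal R u) :
    Γ ≤ steq (S.app₂ R.mul (S.app₂ R.mul s t) u) (S.app₂ R.mul s (S.app₂ R.mul t u)) := by
  refine steq_of_teq (isReal_mul hF (isReal_mul hF hs ht) hu)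
    (isReal_mul hF hs (isReal_mul hF ht hu)) ?_
  simp only [isField, le_inf_iff] at hF
  have hax := hF.1.1.1.1.2
  clear hF
  refine isIn_elim hs fun a Δ hΔ ha hs => ?_
  grw [← hΔ] at *
  refine isIn_elim ht fun b Δ hΔ hb ht => ?_
  grw [← hΔ] at *
  refine isIn_elim hu fun c Δ hΔ hc hu => ?_
  grw [← hΔ] at *
  exact teq_congr (steq_symm (app₂_congr (app₂_congr hs ht) hu))
    (steq_symm (app₂_congr hs (app₂_congr ht hu)))
    (all_elim (all_elim (all_elim hax ha :) hb :) hc :)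

theorem steq_mul_comm (hs : Γ ≤ S.isReal R s) (ht : Γ ≤ S.isReal R t) :
    Γ ≤ steq (S.app₂ R.mul s t) (S.app₂ R.mul t s) := by
  refine steq_of_teq (isReal_mul hF hs ht) (isReal_mul hF ht hs) ?_
  simp only [isField, le_inf_iff] at hF
  have hax := hF.1.1.1.2
  clear hF
  refine isIn_elim hs fun a Δ hΔ ha hs => ?_
  grw [← hΔ] at *
  refine isIn_elim ht fun b Δ hΔ hb ht => ?_
  grw [← hΔ] at *
  exact teq_congr (steq_symm (app₂_congr hs ht)) (steq_symm (app₂_congr ht hs))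
    (all_elim (all_elim hax ha :) hb :)

theorem steq_mul_one (hs : Γ ≤ S.isReal R s) :
    Γ ≤ steq (S.app₂ R.mul s (S.var R.one)) s := by
  refine steq_of_teq (isReal_mul hF hs (isIn_var (one_mem hF))) hs ?_
  simp only [isField, le_inf_iff] at hF
  have hax := hF.1.1.2
  clear hF
  refine isIn_elim hs fun a Δ hΔ ha hs => ?_
  grw [← hΔ] at *
  exact teq_congr (steq_symm (app₂_congr hs (steq_refl _))) (steq_symm hs) (all_elim hax ha :)

theorem steq_mul_add (hs : Γ ≤ S.isReal R s) (ht : Γ ≤ S.isReal R t) (hu : Γ ≤ S.isReal R u) :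
    Γ ≤ steq (S.app₂ R.mul s (S.app₂ R.add t u))
      (S.app₂ R.add (S.app₂ R.mul s t) (S.app₂ R.mul s u)) := by
  refine steq_of_teq (isReal_mul hF hs (isReal_add hF ht hu))
    (isReal_add hF (isReal_mul hF hs ht) (isReal_mul hF hs hu)) ?_
  simp only [isField, le_inf_iff] at hF
  have hax := hF.1.2
  clear hF
  refine isIn_elim hs fun a Δ hΔ ha hs => ?_
  grw [← hΔ] at *
  refine isIn_elim ht fun b Δ hΔ hb ht => ?_
  grw [← hΔ] at *
  refine isIn_elim hu fun c Δ hΔ hc hu => ?_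
  grw [← hΔ] at *
  exact teq_congr (steq_symm (app₂_congr hs (app₂_congr ht hu)))
    (steq_symm (app₂_congr (app₂_congr hs ht) (app₂_congr hs hu)))
    (all_elim (all_elim (all_elim hax ha :) hb :) hc :)

theorem exists_inv (hx : Γ ≤ S.mem x R.carrier) (h : Γ ≤ S.lt R (S.var R.zero) (S.var x)) :
    Γ ≤ S.ex R.carrier fun y => teq (S.app₂ R.mul (S.var x) (S.var y)) (S.var R.one) := by
  simp only [isField, le_inf_iff] at hF
  exact (himp_elim (all_elim hF.2 hx :) h :)

/-- Uniqueness of additive inverses, which makes the description `neg` denote a single element. -/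
theorem add_left_cancel (hs : Γ ≤ S.isReal R s) (ht : Γ ≤ S.isReal R t) (hu : Γ ≤ S.isReal R u)
    (h : Γ ≤ steq (S.app₂ R.add s t) (S.var R.zero))
    (h' : Γ ≤ steq (S.app₂ R.add s u) (S.var R.zero)) : Γ ≤ steq t u := by
  have h0 := isIn_var (zero_mem hF)
  refine steq_trans (steq_symm (steq_add_zero hF ht)) ?_
  refine steq_trans (app₂_congr (steq_refl _) (steq_symm h')) ?_
  refine steq_trans (steq_symm (steq_add_assoc hF ht hs hu)) ?_
  refine steq_trans (app₂_congr (steq_trans (steq_add_comm hF ht hs) h) (steq_refl _)) ?_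
  exact steq_trans (steq_add_comm hF h0 hu) (steq_add_zero hF hu)

/-- Prime filters do not preserve existence statements, so the axiom that some inverse exists is
converted into one definite term. -/
theorem isReal_neg (hs : Γ ≤ S.isReal R s) :
    Γ ≤ S.isReal R (S.neg R s) ⊓ steq (S.app₂ R.add s (S.neg R s)) (S.var R.zero) := by
  have hax : Γ ≤ S.all R.carrier fun x => S.ex R.carrier fun y =>
      teq (S.app₂ R.add (S.var x) (S.var y)) (S.var R.zero) := by
    simp only [isField, le_inf_iff] at hF
    exact hF.1.1.1.1.1.2
  have hs' := hs
  refine isIn_elim hs fun a Δ hΔ ha hsa => ?_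
  grw [← hΔ] at *
  refine ex_elim (all_elim hax ha :) fun b Δ hΔ hb h => ?_
  grw [← hΔ] at *
  have h0 := isIn_var (zero_mem hF)
  have hsb : Δ ≤ steq (S.app₂ R.add s (S.var b)) (S.var R.zero) :=
    steq_of_teq (isReal_add hF hs' (isIn_var hb)) h0
      (teq_congr (steq_symm (app₂_congr hsa (steq_refl _))) (steq_refl _) h)
  have key : Δ ≤ steq (S.neg R s) (S.var b) := by
    refine steq_intro (fun r Δ hΔ hr => ?_) fun r Δ hΔ hr => ?_ <;> grw [← hΔ] at *
    · exact eq_of_steq_var (add_left_cancel hF hs' (isIn_var (and_left hr)) (isIn_var hb)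
        (steq_of_teq (isReal_add hF hs' (isIn_var (and_left hr))) h0 (and_right hr)) hsb)
    · refine le_inf (mem_left (eq_sym hr) hb) (teq_of_steq (S := S) (A := R.carrier) ?_
        (steq_trans (app₂_congr (steq_refl _) (steq_var hr)) hsb))
      exact isReal_add hF hs' (isIn_var (mem_left (eq_sym hr) hb))
  exact le_inf (isIn_intro hb key) (steq_trans (app₂_congr (steq_refl _) key) hsb)

theorem neg_congr (hs : Γ ≤ S.isReal R s) (ht : Γ ≤ S.isReal R t) (h : Γ ≤ steq s t) :
    Γ ≤ steq (S.neg R s) (S.neg R t) :=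
  add_left_cancel hF hs (and_left (isReal_neg hF hs)) (and_left (isReal_neg hF ht))
    (and_right (isReal_neg hF hs))
    (steq_trans (app₂_congr h (steq_refl _)) (and_right (isReal_neg hF ht)))

end Ring

end SetInterp

universe u v

/-! ### Order axioms for real terms, germs at a prime filter, positivity of inverses. -/

namespace SetInterp

variable {H : Type u} [Order.Frame H] {M : Type v} {S : SetInterp H M}
  {Γ Δ ψ : H} {a b c g x y z A B C N : M} {s s' t t' w w' : M → H} {R : RealLineData M}

section Ordered

variable (hO : Γ ≤ S.isOrdered R)
include hO

theorem lt_asymm (hs : Γ ≤ S.isReal R s) (ht : Γ ≤ S.isReal R t) (h : Γ ≤ S.lt R s t)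
    (h' : Γ ≤ S.lt R t s) : Γ ≤ ψ := by
  simp only [isOrdered, le_inf_iff] at hO
  have hax := hO.1.1.1.1.2
  clear hO
  refine isIn_elim hs fun a Δ hΔ ha hs => ?_
  grw [← hΔ] at *
  refine isIn_elim ht fun b Δ hΔ hb ht => ?_
  grw [← hΔ] at *
  exact compl_elim (all_elim (all_elim hax ha :) hb :)
    (le_inf (lt_congr hs ht h) (lt_congr ht hs h'))

theorem lt_cotrans (hs : Γ ≤ S.isReal R s) (ht : Γ ≤ S.isReal R t) (hw : Γ ≤ S.isReal R w)
    (h : Γ ≤ S.lt R s t) : Γ ≤ S.lt R s w ⊔ S.lt R w t := by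
  simp only [isOrdered, le_inf_iff] at hO
  have hax := hO.1.1.1.2
  clear hO
  refine isIn_elim hs fun a Δ hΔ ha hs => ?_
  grw [← hΔ] at *
  refine isIn_elim ht fun b Δ hΔ hb ht => ?_
  grw [← hΔ] at *
  refine isIn_elim hw fun c Δ hΔ hc hw => ?_
  grw [← hΔ] at *
  refine sup_elim (himp_elim (all_elim (all_elim (all_elim hax ha :) hb :) hc :)
    (lt_congr hs ht h)) (fun Δ hΔ h => inl ?_) (fun Δ hΔ h => inr ?_) <;> grw [← hΔ] at *
  · exact lt_congr (steq_symm hs) (steq_symm hw) h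
  · exact lt_congr (steq_symm hw) (steq_symm ht) h

theorem lt_tight (hs : Γ ≤ S.isReal R s) (ht : Γ ≤ S.isReal R t) (h : Γ ≤ (S.lt R s t)ᶜ)
    (h' : Γ ≤ (S.lt R t s)ᶜ) : Γ ≤ steq s t := by
  simp only [isOrdered, le_inf_iff] at hO
  have hax := hO.1.1.2
  clear hO
  refine isIn_elim hs fun a Δ hΔ ha hs => ?_
  grw [← hΔ] at *
  refine isIn_elim ht fun b Δ hΔ hb ht => ?_
  grw [← hΔ] at *
  refine steq_trans hs (steq_trans (steq_var (himp_elim (all_elim (all_elim hax ha :) hb :)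
    (le_inf (compl_intro fun Δ hΔ hl => ?_) (compl_intro fun Δ hΔ hl => ?_)))) (steq_symm ht)) <;>
    grw [← hΔ] at *
  · exact compl_elim h (lt_congr (steq_symm hs) (steq_symm ht) hl)
  · exact compl_elim h' (lt_congr (steq_symm ht) (steq_symm hs) hl)

theorem lt_add_right (hs : Γ ≤ S.isReal R s) (ht : Γ ≤ S.isReal R t) (hw : Γ ≤ S.isReal R w)
    (h : Γ ≤ S.lt R s t) : Γ ≤ S.lt R (S.app₂ R.add s w) (S.app₂ R.add t w) := by
  simp only [isOrdered, le_inf_iff] at hO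
  have hax := hO.1.2
  clear hO
  refine isIn_elim hs fun a Δ hΔ ha hs => ?_
  grw [← hΔ] at *
  refine isIn_elim ht fun b Δ hΔ hb ht => ?_
  grw [← hΔ] at *
  refine isIn_elim hw fun c Δ hΔ hc hw => ?_
  grw [← hΔ] at *
  exact lt_congr (steq_symm (app₂_congr hs hw)) (steq_symm (app₂_congr ht hw))
    (himp_elim (all_elim (all_elim (all_elim hax ha :) hb :) hc :) (lt_congr hs ht h))

theorem lt_mul_pos (hs : Γ ≤ S.isReal R s) (ht : Γ ≤ S.isReal R t)
    (h : Γ ≤ S.lt R (S.var R.zero) s) (h' : Γ ≤ S.lt R (S.var R.zero) t) :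
    Γ ≤ S.lt R (S.var R.zero) (S.app₂ R.mul s t) := by
  simp only [isOrdered, le_inf_iff] at hO
  have hax := hO.2
  clear hO
  refine isIn_elim hs fun a Δ hΔ ha hs => ?_
  grw [← hΔ] at *
  refine isIn_elim ht fun b Δ hΔ hb ht => ?_
  grw [← hΔ] at *
  exact lt_congr (steq_refl _) (steq_symm (app₂_congr hs ht))
    (himp_elim (all_elim (himp_elim (all_elim hax ha :) (lt_congr (steq_refl _) hs h) :) hb :)
      (lt_congr (steq_refl _) ht h'))

theorem zero_lt_one : Γ ≤ S.lt R (S.var R.zero) (S.var R.one) := by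
  simp only [isOrdered, le_inf_iff] at hO
  exact hO.1.1.1.1.1

end Ordered

theorem le_iff_compl (hs : Γ ≤ S.isReal R s) (ht : Γ ≤ S.isReal R t) :
    Γ ≤ S.le R s t ↔ Γ ≤ (S.lt R t s)ᶜ := by
  refine ⟨fun h => compl_intro fun Δ hΔ hl => ?_, fun h => ?_⟩
  · grw [← hΔ] at *
    refine isIn_elim hs fun a Δ hΔ ha hs => ?_
    grw [← hΔ] at *
    refine isIn_elim ht fun b Δ hΔ hb ht => ?_
    grw [← hΔ] at *
    have h1 := lt_var_iff.1 (lt_congr ht hs hl)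
    refine iSup_elim (le_congr hs ht h) fun c Δ hΔ h => ?_
    grw [← hΔ] at *
    refine iSup_elim h fun d Δ hΔ h => ?_
    grw [← hΔ] at *
    exact compl_elim (and_right h)
      (rel_congr (eq_sym (and_right (and_left h))) (eq_sym (and_left (and_left h))) h1)
  · refine isIn_elim hs fun a Δ hΔ ha hs => ?_
    grw [← hΔ] at *
    refine isIn_elim ht fun b Δ hΔ hb ht => ?_
    grw [← hΔ] at *
    refine le_congr (steq_symm hs) (steq_symm ht) (iSup_intro a (iSup_intro b
      (le_inf (le_inf eq_rfl eq_rfl) (compl_intro fun Δ hΔ hl => ?_))))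
    grw [← hΔ] at *
    exact compl_elim h (lt_congr (steq_symm ht) (steq_symm hs) (lt_var_iff.2 hl))

/-- Germs of real terms at a prime filter. -/
def germSetoid (S : SetInterp H M) (R : RealLineData M) (V : PrimeTruth H) :
    Setoid {s : M → H // V.holds (S.isReal R s)} where
  r s t := V.holds (steq s.1 t.1)
  iseqv := ⟨fun s => V.mono (steq_refl _) s.2, fun h => V.mono (steq_symm le_rfl) h,
    fun h h' => V.map₁ h (fun _ => steq_trans) h'⟩

/-- Germs of real terms at a prime filter. -/
def Germ (S : SetInterp H M) (R : RealLineData M) (V : PrimeTruth H) : Type (max u v) :=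
  Quotient (germSetoid S R V)

/-- The germ of a real term. -/
def toGerm (V : PrimeTruth H) (s : M → H) (hs : V.holds (S.isReal R s)) : Germ S R V :=
  Quotient.mk (germSetoid S R V) ⟨s, hs⟩

/-- The commutative ring of germs of real terms. -/
abbrev germRing (V : PrimeTruth H) (hF : V.holds (S.isField R)) : CommRing (Germ S R V) :=
  letI : Add (Germ S R V) := ⟨Quotient.map₂ (fun s t => ⟨S.app₂ R.add s.1 t.1,
    V.map₂ hF (fun _ h => isReal_add h) s.2 t.2⟩)
    fun _ _ h _ _ h' => V.map₂ hF (fun _ _ => app₂_congr) h h'⟩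
  letI : Mul (Germ S R V) := ⟨Quotient.map₂ (fun s t => ⟨S.app₂ R.mul s.1 t.1,
    V.map₂ hF (fun _ h => isReal_mul h) s.2 t.2⟩)
    fun _ _ h _ _ h' => V.map₂ hF (fun _ _ => app₂_congr) h h'⟩
  letI : Neg (Germ S R V) := ⟨Quotient.map (fun s => ⟨S.neg R s.1,
    V.map₁ hF (fun _ h hs => and_left (isReal_neg h hs)) s.2⟩)
    fun s t h => V.map₃ hF (fun _ h => neg_congr h) s.2 t.2 h⟩
  letI : Zero (Germ S R V) := ⟨toGerm V (S.var R.zero) (V.mono (isIn_var (zero_mem le_rfl)) hF)⟩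
  letI : One (Germ S R V) := ⟨toGerm V (S.var R.one) (V.mono (isIn_var (one_mem le_rfl)) hF)⟩
  CommRing.ofMinimalAxioms
  (by
    rintro ⟨s⟩ ⟨t⟩ ⟨w⟩
    exact Quotient.sound (V.map₃ hF (fun _ h => steq_add_assoc h) s.2 t.2 w.2))
  (by
    rintro ⟨s⟩
    exact Quotient.sound (V.map₁ hF (fun _ h hs => steq_trans
      (steq_add_comm h (isIn_var (zero_mem h)) hs) (steq_add_zero h hs)) s.2))
  (by
    rintro ⟨s⟩
    exact Quotient.sound (V.map₁ hF (fun _ h hs => steq_trans (steq_add_comm h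
      (and_left (isReal_neg h hs)) hs) (and_right (isReal_neg h hs))) s.2))
  (by
    rintro ⟨s⟩ ⟨t⟩ ⟨w⟩
    exact Quotient.sound (V.map₃ hF (fun _ h => steq_mul_assoc h) s.2 t.2 w.2))
  (by
    rintro ⟨s⟩ ⟨t⟩
    exact Quotient.sound (V.map₂ hF (fun _ h => steq_mul_comm h) s.2 t.2))
  (by
    rintro ⟨s⟩
    exact Quotient.sound (V.map₁ hF (fun _ h hs => steq_trans
      (steq_mul_comm h (isIn_var (one_mem h)) hs) (steq_mul_one h hs)) s.2))
  (by
    rintro ⟨s⟩ ⟨t⟩ ⟨w⟩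
    exact Quotient.sound (V.map₃ hF (fun _ h => steq_mul_add h) s.2 t.2 w.2))

/-- Real terms, evaluated in a ring with a strict order at a prime filter containing `Γ`. -/
structure Valuation (S : SetInterp H M) (R : RealLineData M) (Γ : H) (K : Type*) [CommRing K]
    (ltK : K → K → Prop) extends PrimeTruth H where
  base : holds Γ
  toFun : (M → H) → K
  congr' : ∀ {s t}, holds (S.isReal R s) → holds (S.isReal R t) → holds (steq s t) →
    toFun s = toFun t
  add' : ∀ {s t}, holds (S.isReal R s) → holds (S.isReal R t) →
    toFun (S.app₂ R.add s t) = toFun s + toFun t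
  mul' : ∀ {s t}, holds (S.isReal R s) → holds (S.isReal R t) →
    toFun (S.app₂ R.mul s t) = toFun s * toFun t
  neg' : ∀ {s}, holds (S.isReal R s) → toFun (S.neg R s) = -toFun s
  zero : toFun (S.var R.zero) = 0
  one : toFun (S.var R.one) = 1
  lt_iff' : ∀ {s t}, holds (S.isReal R s) → holds (S.isReal R t) →
    (holds (S.lt R s t) ↔ ltK (toFun s) (toFun t))

-- The germs inherit the ring and order axioms by transport along entailments. Primeness of the
-- filter gives cotransitivity, and properness gives asymmetry. The surjectivity clause is recorded
-- because positive germs must later be inverted through terms representing them.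
open Classical in
theorem exists_valuation_cotransitive (V : PrimeTruth H) (hΓ : V.holds Γ)
    (hF : Γ ≤ S.isField R) (hO : Γ ≤ S.isOrdered R) :
    ∃ (B : Type (max u v)) (_ : CommRing B) (lt : B → B → Prop) (_ : IsCotransitiveOrder lt)
      (W : Valuation S R Γ B lt), W.toPrimeTruth = V ∧
        ∀ k, ∃ s, V.holds (S.isReal R s) ∧ W.toFun s = k := by
  have hF' := V.mono hF hΓ
  let B := Germ S R V
  let _ : CommRing B := germRing V hF'
  let lt : B → B → Prop := Quotient.lift₂ (fun s t => V.holds (S.lt R s.1 t.1))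
    fun s t s' t' h h' => propext
      ⟨fun hl => V.map₁ (V.inf h h')
        (fun _ hΔ => lt_congr (and_left hΔ) (and_right hΔ)) hl,
      fun hl => V.map₁ (V.inf h h')
        (fun _ hΔ => lt_congr (steq_symm (and_left hΔ)) (steq_symm (and_right hΔ))) hl⟩
  have h0 := V.mono (isIn_var (zero_mem hF)) hΓ
  have h1 := V.mono (isIn_var (one_mem hF)) hΓ
  have hlt : IsCotransitiveOrder lt :=
    { asymm := by
        rintro ⟨s⟩ ⟨t⟩ h h'
        exact V.bot (V.map₂ (V.inf hΓ (V.inf s.2 t.2)) (fun Δ hΔ => lt_asymm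
          ((and_left hΔ).trans hO) (and_left (and_right hΔ)) (and_right (and_right hΔ))) h h')
      cotrans := by
        rintro ⟨s⟩ ⟨t⟩ ⟨w⟩ h
        exact V.sup (V.map₁ (V.inf hΓ (V.inf s.2 (V.inf t.2 w.2))) (fun Δ hΔ => lt_cotrans
          ((and_left hΔ).trans hO) (and_left (and_right hΔ)) (and_left (and_right (and_right hΔ)))
          (and_right (and_right (and_right hΔ)))) h)
      add_right := by
        rintro ⟨s⟩ ⟨t⟩ ⟨w⟩ h
        exact V.map₁ (V.inf hΓ (V.inf s.2 (V.inf t.2 w.2))) (fun Δ hΔ => lt_add_right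
          ((and_left hΔ).trans hO) (and_left (and_right hΔ)) (and_left (and_right (and_right hΔ)))
          (and_right (and_right (and_right hΔ)))) h
      mul_pos := by
        rintro ⟨s⟩ ⟨t⟩ h h'
        exact V.map₂ (V.inf hΓ (V.inf s.2 t.2)) (fun Δ hΔ => lt_mul_pos
          ((and_left hΔ).trans hO) (and_left (and_right hΔ)) (and_right (and_right hΔ))) h h'
      zero_lt_one := V.mono (zero_lt_one hO) hΓ }
  -- Terms that are not real at `V` receive the junk value 0; every law of the valuation assumes
  -- realness.
  let g : (M → H) → B := fun s => if hs : V.holds (S.isReal R s) then toGerm V s hs else 0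
  have hg : ∀ s (hs : V.holds (S.isReal R s)), g s = toGerm V s hs := fun s hs => dif_pos hs
  refine ⟨B, inferInstance, lt, hlt, ⟨V, hΓ, g, ?_, ?_, ?_, ?_, ?_, ?_, ?_⟩, rfl, ?_⟩
  · intro s t hs ht h
    rw [hg s hs, hg t ht]
    exact Quotient.sound h
  · intro s t hs ht
    rw [hg s hs, hg t ht, hg _ (V.map₂ hΓ (fun _ h => isReal_add (h.trans hF)) hs ht)]
    rfl
  · intro s t hs ht
    rw [hg s hs, hg t ht, hg _ (V.map₂ hΓ (fun _ h => isReal_mul (h.trans hF)) hs ht)]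
    rfl
  · intro s hs
    rw [hg s hs, hg _ (V.map₁ hΓ (fun _ h hs => and_left (isReal_neg (h.trans hF) hs)) hs)]
    rfl
  · rw [hg _ h0]; rfl
  · rw [hg _ h1]; rfl
  · intro s t hs ht
    rw [hg s hs, hg t ht]
    exact Iff.rfl
  · rintro ⟨s⟩
    exact ⟨s.1, s.2, hg _ s.2⟩

namespace Valuation

section

variable {K : Type*} [CommRing K] {ltK : K → K → Prop} (V : Valuation S R Γ K ltK)

instance : CoeFun (Valuation S R Γ K ltK) fun _ => (M → H) → K := ⟨fun V => V.toFun⟩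

include V in
theorem of_le {a : H} (h : Γ ≤ a) : V.holds a := V.mono h V.base

theorem congr (hs : Γ ≤ S.isReal R s) (ht : Γ ≤ S.isReal R t) (h : Γ ≤ steq s t) : V s = V t :=
  V.congr' (V.of_le hs) (V.of_le ht) (V.of_le h)

theorem teq (hs : Γ ≤ S.isReal R s) (ht : Γ ≤ S.isReal R t) (h : Γ ≤ teq s t) : V s = V t :=
  V.congr hs ht (steq_of_teq hs ht h)

theorem add (hs : Γ ≤ S.isReal R s) (ht : Γ ≤ S.isReal R t) :
    V (S.app₂ R.add s t) = V s + V t :=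
  V.add' (V.of_le hs) (V.of_le ht)

theorem mul (hs : Γ ≤ S.isReal R s) (ht : Γ ≤ S.isReal R t) :
    V (S.app₂ R.mul s t) = V s * V t :=
  V.mul' (V.of_le hs) (V.of_le ht)

theorem neg (hs : Γ ≤ S.isReal R s) : V (S.neg R s) = -V s := V.neg' (V.of_le hs)

theorem lt_iff (hs : Γ ≤ S.isReal R s) (ht : Γ ≤ S.isReal R t) :
    V.holds (S.lt R s t) ↔ ltK (V s) (V t) :=
  V.lt_iff' (V.of_le hs) (V.of_le ht)

theorem lt (hs : Γ ≤ S.isReal R s) (ht : Γ ≤ S.isReal R t) (h : Γ ≤ S.lt R s t) :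
    ltK (V s) (V t) :=
  (V.lt_iff hs ht).1 (V.of_le h)

/-- Restriction to a larger truth value. -/
def restrict {Δ : H} (h : Γ ≤ Δ) : Valuation S R Δ K ltK := { V with base := V.of_le h }

end

end Valuation

/-- This weaker transfer is needed to show that inverses of positive reals are positive, a fact on
which the passage to linear orders depends. -/
theorem le_of_cotransitive {a : H} (hF : Γ ≤ S.isField R) (hO : Γ ≤ S.isOrdered R)
    (h : ∀ (B : Type (max u v)) [CommRing B] (ltB : B → B → Prop), IsCotransitiveOrder ltB →
      ∀ V : Valuation S R Γ B ltB, V.holds a) : Γ ≤ a := by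
  refine le_of_forall_primeTruth fun V hV => ?_
  obtain ⟨B, _, ltB, hlt, W, rfl, -⟩ := exists_valuation_cotransitive V hV hF hO
  exact h B ltB hlt W

variable (S) in
/-- `i` is an unbounded map from the natural numbers to the reals preserving `0` and `+ 1`. -/
def isNatCast (N : M) (R : RealLineData M) (i : M) : H :=
  S.isFun i N R.carrier ⊓
    (⨅ z, S.isEmpty z ⇨ S.rel i z R.zero) ⊓
    (S.all N fun n => ⨅ m, S.isSucc m n ⇨
      SetInterp.teq (S.app i (S.var m)) (S.app₂ R.add (S.app i (S.var n)) (S.var R.one))) ⊓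
    S.all R.carrier fun x => S.ex N fun n => S.lt R (S.var x) (S.app i (S.var n))

variable (S) in
/-- Inverses of positive reals are positive. -/
def invPos (R : RealLineData M) : H :=
  ⨅ x, ⨅ y, S.mem x R.carrier ⊓ S.mem y R.carrier ⊓ S.lt R (S.var R.zero) (S.var x) ⊓
    SetInterp.teq (S.app₂ R.mul (S.var x) (S.var y)) (S.var R.one) ⇨ S.lt R (S.var R.zero) (S.var y)

/-- Let x > 0 and xy = 1, and argue by induction on a natural bound n of x. Either y > 0, or y < 1.
In the latter case x - 1 = x(1 - y) is positive and bounded by n - 1, so its inverse y' is positive,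
and y = y'(1 - y) is positive too. -/
theorem invPos_of_isNatCast (hS : S.IsBishopModel) {i : M} (hN : Γ ≤ S.isOmega N)
    (hF : Γ ≤ S.isField R) (hO : Γ ≤ S.isOrdered R) (hi : Γ ≤ S.isNatCast N R i) :
    Γ ≤ S.invPos R := by
  have hfun := and_left (and_left (and_left hi))
  have hzero := and_right (and_left (and_left hi))
  have hsucc := and_right (and_left hi)
  have harch := and_right hi
  clear hi
  refine le_iInf fun x => le_iInf fun y => himp_intro fun Δ hΔ h => ?_
  grw [← hΔ] at *
  refine ex_elim (all_elim harch (and_left (and_left (and_left h))) :) fun n Δ hΔ hn hxn => ?_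
  grw [← hΔ] at *
  -- The predicate quantifies over all `x` below the bound and all their inverses, since the
  -- induction step passes from `x` to `x - 1`.
  have key := hS.nat_ind (fun n => ⨅ x, ⨅ y, S.mem x R.carrier ⊓ S.mem y R.carrier ⊓
    S.lt R (S.var R.zero) (S.var x) ⊓
    SetInterp.teq (S.app₂ R.mul (S.var x) (S.var y)) (S.var R.one) ⊓
    S.lt R (S.var x) (S.app i (S.var n)) ⇨ S.lt R (S.var R.zero) (S.var y)) hN ?_ ?_ hn
  · exact himp_elim (iInf_elim (iInf_elim key x :) y) (le_inf h hxn)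
  · clear * - hzero hfun hO hF
    refine fun z Δ hΔ hz => le_iInf fun x => le_iInf fun y => himp_intro fun Δ hΔ' h => ?_
    grw [← hΔ', ← hΔ] at *
    have hx := isIn_var (and_left (and_left (and_left (and_left h))))
    have h0 := isIn_var (zero_mem hF)
    exact lt_asymm hO hx h0 (lt_congr (steq_refl _)
      (steq_app_var hfun (himp_elim (iInf_elim hzero z :) hz)) (and_right h))
      (and_right (and_left (and_left h)))
  · clear * - hsucc hfun hO hF hN
    refine fun n m Δ hΔ hn hm ih => le_iInf fun x => le_iInf fun y => himp_intro fun Δ hΔ' h => ?_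
    grw [← hΔ', ← hΔ] at *
    have hx := isIn_var (and_left (and_left (and_left (and_left h))))
    have hy := isIn_var (and_right (and_left (and_left (and_left h))))
    have hx0 := and_right (and_left (and_left h))
    have hxy := and_right (and_left h)
    have hxm := and_right h
    have h0 := isIn_var (zero_mem hF)
    have h1 := isIn_var (one_mem hF)
    clear h
    refine sup_elim (lt_cotrans hO h0 h1 hy (zero_lt_one hO)) (fun Δ hΔ h => h)
      fun Δ hΔ hy1 => ?_
    grw [← hΔ] at *
    have hn1 := and_left (isReal_neg hF h1)
    refine isIn_elim (isReal_add hF hx hn1) fun x' Δ hΔ hx' hxx' => ?_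
    grw [← hΔ] at *
    have hrx' := isIn_var (S := S) hx'
    have hin := isIn_app hfun (isIn_var hn)
    have him := isIn_app hfun (isIn_var (isOmega_succ hN hn hm))
    have him' := himp_elim (iInf_elim (all_elim hsucc hn :) m :) hm
    have hVx : ∀ {Θ : H} (hΘ : Θ ≤ Δ) (B : Type (max u v)) [CommRing B] (ltB : B → B → Prop)
        (V : Valuation S R Θ B ltB), V (S.var x') = V (S.var x) - 1 := by
      intro Θ hΘ B _ ltB V
      grw [← hΘ] at *
      rw [← V.congr (isReal_add hF hx hn1) hrx' hxx', V.add hx hn1, V.neg h1, V.one,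
        sub_eq_add_neg]
    -- x' = x - 1 equals x(1 - y), because xy = 1.
    have hx'0 : Δ ≤ S.lt R (S.var R.zero) (S.var x') := by
      refine le_of_cotransitive hF hO fun B _ ltB hB V => ?_
      rw [V.lt_iff h0 hrx', hVx le_rfl, V.zero]
      have e1 := hB.lt_iff.1 (V.lt hy h1 hy1)
      have e2 := V.lt h0 hx hx0
      have e3 := V.teq (isReal_mul hF hx hy) h1 hxy
      rw [V.mul hx hy] at e3
      rw [V.zero] at e2
      rw [V.one] at e1 e3
      convert hB.mul_pos _ _ e2 e1 using 1
      linear_combination e3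
    refine ex_elim (exists_inv hF hx' hx'0) fun y' Δ hΔ hy' hxy' => ?_
    have hVx := fun {Θ : H} (hΘ : Θ ≤ Δ) => hVx (hΘ.trans hΔ)
    grw [← hΔ] at *
    have hry' := isIn_var (S := S) hy'
    have hx'n : Δ ≤ S.lt R (S.var x') (S.app i (S.var n)) := by
      refine le_of_cotransitive hF hO fun B _ ltB hB V => ?_
      rw [V.lt_iff hrx' hin, hVx le_rfl]
      have e1 := V.lt hx him hxm
      have e2 := V.teq him (isReal_add hF hin h1) him'
      rw [V.add hin h1, V.one] at e2
      rw [e2, hB.lt_iff] at e1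
      rw [hB.lt_iff]
      convert e1 using 1
      ring
    have hy'0 : Δ ≤ S.lt R (S.var R.zero) (S.var y') :=
      himp_elim (iInf_elim (iInf_elim ih x' :) y' :) (le_inf (le_inf (le_inf (le_inf hx' hy')
        hx'0) hxy') hx'n)
    -- Multiplying (x - 1)y' = 1 by y and using xy = 1 gives y = y'(1 - y), a product of positive
    -- factors.
    refine le_of_cotransitive hF hO fun B _ ltB hB V => ?_
    rw [V.lt_iff h0 hy, V.zero]
    have e1 := hB.lt_iff.1 (V.lt hy h1 hy1)
    have e2 := V.lt h0 hry' hy'0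
    have e3 := V.teq (isReal_mul hF hx hy) h1 hxy
    have e4 := V.teq (isReal_mul hF hrx' hry') h1 hxy'
    rw [V.mul hx hy] at e3
    rw [V.mul hrx' hry', hVx le_rfl] at e4
    rw [V.zero] at e2
    rw [V.one] at e1 e3 e4
    convert hB.mul_pos _ _ e2 e1 using 1
    linear_combination (V.toFun (S.var y')) * e3 - V.toFun (S.var y) * e4

end SetInterp

/-! ### Transfer to linearly ordered rings. -/

namespace SetInterp

variable {H : Type u} [Order.Frame H] {M : Type v} {S : SetInterp H M}
  {Γ Δ ψ : H} {a b c g x y z A B C N : M} {s s' t t' w w' : M → H} {R : RealLineData M}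

variable (S) in
/-- `N` is the set of natural numbers and `R` the real line. -/
def hasReals (N : M) (R : RealLineData M) : H := S.isOmega N ⊓ S.isRealLine N R

theorem hasReals.omega (h : Γ ≤ S.hasReals N R) : Γ ≤ S.isOmega N := and_left h

theorem hasReals.field (h : Γ ≤ S.hasReals N R) : Γ ≤ S.isField R :=
  and_left (and_left (and_left (and_right h)))

theorem hasReals.ordered (h : Γ ≤ S.hasReals N R) : Γ ≤ S.isOrdered R :=
  and_right (and_left (and_left (and_right h)))

theorem hasReals.exists_isNatCast (h : Γ ≤ S.hasReals N R) : Γ ≤ ⨆ i, S.isNatCast N R i :=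
  and_right (and_left (and_right h))

/-- A truth value lies above `Γ` if it holds at all prime filters containing `Γ`, the real terms
being evaluated in linearly ordered rings. -/
theorem le_of_linear (hS : S.IsBishopModel) (hR : Γ ≤ S.hasReals N R) {a : H}
    (h : ∀ (K : Type (max u v)) [CommRing K] [LinearOrder K] [IsStrictOrderedRing K]
      (V : Valuation S R Γ K (· < ·)), V.holds a) : Γ ≤ a := by
  refine le_of_forall_primeTruth fun V hV => ?_
  have hF := hasReals.field hR
  have hO := hasReals.ordered hR
  have hI : Γ ≤ S.invPos R := iSup_elim (hasReals.exists_isNatCast hR) fun i Δ hΔ hi =>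
    invPos_of_isNatCast hS (hΔ.trans (hasReals.omega hR)) (hΔ.trans hF) (hΔ.trans hO) hi
  obtain ⟨B, _, ltB, hB, W, rfl, hsurj⟩ := exists_valuation_cotransitive V hV hF hO
  have inv : ∀ x, ltB 0 x → ∃ y, x * y = 1 ∧ ltB 0 y := by
    intro x hx
    obtain ⟨s, hs, rfl⟩ := hsurj x
    have h0 := isIn_var (zero_mem hF)
    have h1 := isIn_var (one_mem hF)
    rw [← W.zero, ← W.lt_iff' (W.of_le h0) hs] at hx
    -- The reciprocal as a definite description. Its germ inverts the given one, even though the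
    -- filter need not preserve the existential quantifier in the field axiom.
    let inv : M → H := fun r => S.mem r R.carrier ⊓
      steq (S.app₂ R.mul s (S.var r)) (S.var R.one)
    have key : ∀ Δ ≤ Γ, Δ ≤ S.isReal R s → Δ ≤ S.lt R (S.var R.zero) s →
        Δ ≤ S.isReal R inv ⊓ steq (S.app₂ R.mul s inv) (S.var R.one) ⊓
          S.lt R (S.var R.zero) inv := by
      intro Δ hΔ hs hx
      grw [← hΔ] at *
      refine isIn_elim hs fun a Δ hΔ ha hsa => ?_
      grw [← hΔ] at *
      have hx' := lt_congr (steq_refl _) hsa hx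
      refine ex_elim (exists_inv hF ha hx') fun b Δ hΔ hb hab => ?_
      grw [← hΔ] at *
      have hrb := isIn_var (S := S) hb
      have hsb : Δ ≤ steq (S.app₂ R.mul s (S.var b)) (S.var R.one) :=
        steq_trans (app₂_congr hsa (steq_refl _))
          (steq_of_teq (isReal_mul hF (isIn_var ha) hrb) h1 hab)
      have e : Δ ≤ steq inv (S.var b) := by
        refine steq_intro (fun r Δ hΔ hr => ?_) fun r Δ hΔ hr => ?_ <;> grw [← hΔ] at *
        · have hr1 := and_right hr
          have hrr := isIn_var (S := S) (and_left hr)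
          refine eq_of_steq_var ?_
          refine steq_trans (steq_symm (steq_mul_one hF hrr)) ?_
          refine steq_trans (app₂_congr (steq_refl _) (steq_symm hsb)) ?_
          refine steq_trans (steq_symm (steq_mul_assoc hF hrr hs hrb)) ?_
          refine steq_trans (app₂_congr (steq_trans (steq_mul_comm hF hrr hs) hr1)
            (steq_refl _)) ?_
          exact steq_trans (steq_mul_comm hF h1 hrb) (steq_mul_one hF hrb)
        · exact le_inf (mem_left (eq_sym hr) hb)
            (steq_trans (app₂_congr (steq_refl _) (steq_var hr)) hsb)
      refine le_inf (le_inf (isIn_intro hb e)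
        (steq_trans (app₂_congr (steq_refl _) e) hsb)) (lt_congr (steq_refl _) (steq_symm e) ?_)
      exact himp_elim (iInf_elim (iInf_elim hI a :) b :)
        (le_inf (le_inf (le_inf ha hb) hx') hab)
    have hk := W.map₂ W.base key hs hx
    have hk1 := W.mono (inf_le_left.trans inf_le_left) hk
    refine ⟨W inv, ?_, ?_⟩
    · rw [← W.mul' hs hk1, ← W.one]
      exact W.congr' (W.map₂ W.base (fun _ h => isReal_mul (h.trans hF)) hs hk1)
        (W.of_le h1) (W.mono (inf_le_left.trans inf_le_right) hk)
    · rw [← W.zero]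
      exact (W.lt_iff' (W.of_le h0) hk1).1 (W.mono inf_le_right hk)
  obtain ⟨K, _, _, _, π, hπ⟩ := hB.exists_linearOrder inv
  exact h K
    { W.toPrimeTruth with
      base := W.base
      toFun := fun s => π (W s)
      congr' := fun hs ht h => by rw [W.congr' hs ht h]
      add' := fun hs ht => by rw [W.add' hs ht, map_add]
      mul' := fun hs ht => by rw [W.mul' hs ht, map_mul]
      neg' := fun hs => by rw [W.neg' hs, map_neg]
      zero := by rw [W.zero, map_zero]
      one := by rw [W.one, map_one]
      lt_iff' := fun hs ht => (W.lt_iff' hs ht).trans (hπ _ _) }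

section

variable (hS : S.IsBishopModel) (hR : Γ ≤ S.hasReals N R) (hs : Γ ≤ S.isReal R s)
  (ht : Γ ≤ S.isReal R t)
include hS hR hs ht

theorem lt_of_linear (h : ∀ (K : Type (max u v)) [CommRing K] [LinearOrder K]
    [IsStrictOrderedRing K] (V : Valuation S R Γ K (· < ·)), V s < V t) : Γ ≤ S.lt R s t :=
  le_of_linear hS hR fun K _ _ _ V => (V.lt_iff hs ht).2 (h K V)

/-- `≤` is a negation, which prime filters do not reflect. So `t < s` is assumed at a stage `Δ ≤ Γ`
and refuted there; a valuation over `Δ` is also one over `Γ`. -/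
theorem le_of_linear_le (h : ∀ (K : Type (max u v)) [CommRing K] [LinearOrder K]
    [IsStrictOrderedRing K] (V : Valuation S R Γ K (· < ·)), V s ≤ V t) : Γ ≤ S.le R s t := by
  refine (le_iff_compl hs ht).2 (compl_intro fun Δ hΔ hlt => ?_)
  refine le_of_linear hS (hΔ.trans hR) fun K _ _ _ V => ?_
  exact absurd (V.lt (hΔ.trans ht) (hΔ.trans hs) hlt) (h K (V.restrict hΔ)).not_gt

/-- Tightness of the order turns the two inequalities into an equality of terms. -/
theorem steq_of_linear (h : ∀ (K : Type (max u v)) [CommRing K] [LinearOrder K]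
    [IsStrictOrderedRing K] (V : Valuation S R Γ K (· < ·)), V s = V t) : Γ ≤ steq s t := by
  have h1 := (le_iff_compl hs ht).1 (le_of_linear_le hS hR hs ht fun K _ _ _ V => (h K V).le)
  have h2 := (le_iff_compl ht hs).1 (le_of_linear_le hS hR ht hs fun K _ _ _ V => (h K V).ge)
  exact lt_tight (hasReals.ordered hR) hs ht h2 h1

end

/-- A proper filter cannot contain both `t < s` and its negation, and the order of `K` is total. -/
theorem Valuation.le {K : Type*} [CommRing K] [LinearOrder K] (V : Valuation S R Γ K (· < ·))
    (hs : Γ ≤ S.isReal R s) (ht : Γ ≤ S.isReal R t) (h : Γ ≤ S.le R s t) : V s ≤ V t := by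
  by_contra hc
  have h1 := (V.lt_iff ht hs).2 (not_le.1 hc)
  exact V.bot (V.map₁ V.base (fun Δ hΔ hl => compl_elim (hΔ.trans ((le_iff_compl hs ht).1 h)) hl)
    h1)

/-! ### Elementary facts about the reals -/

section

variable (hS : S.IsBishopModel) (hR : Γ ≤ S.hasReals N R)
include hR

theorem isReal_zero : Γ ≤ S.isReal R (S.var R.zero) := isIn_var (zero_mem (hasReals.field hR))

theorem isReal_one : Γ ≤ S.isReal R (S.var R.one) := isIn_var (one_mem (hasReals.field hR))

include hS

/-- Inverses of positive reals. -/
theorem exists_pos_inv (hs : Γ ≤ S.isReal R s) (h : Γ ≤ S.lt R (S.var R.zero) s)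
    (k : ∀ y, ∀ Δ ≤ Γ, Δ ≤ S.mem y R.carrier → Δ ≤ S.lt R (S.var R.zero) (S.var y) →
      Δ ≤ steq (S.app₂ R.mul s (S.var y)) (S.var R.one) → Δ ≤ ψ) : Γ ≤ ψ := by
  refine isIn_elim hs fun a Δ hΔ₁ ha hsa => ?_
  refine ex_elim (exists_inv (hΔ₁.trans (hasReals.field hR)) ha
    (lt_congr (steq_refl _) hsa (hΔ₁.trans h))) fun b Δ hΔ₂ hb hab => ?_
  have hΔ := hΔ₂.trans hΔ₁
  refine k b Δ hΔ hb ?_ ?_ <;> clear k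
  all_goals
    grw [← hΔ₂] at ha hsa
    grw [← hΔ] at *
    have hF := hasReals.field hR
    have hra := isIn_var (S := S) ha
    have hrb := isIn_var (S := S) hb
    have hsb : Δ ≤ steq (S.app₂ R.mul s (S.var b)) (S.var R.one) :=
        steq_trans (app₂_congr hsa (steq_refl _))
          (steq_of_teq (isReal_mul hF hra hrb) (isReal_one hR) hab)
  · refine lt_of_linear hS hR (isReal_zero hR) hrb fun K _ _ _ V => ?_
    have e1 := V.lt (isReal_zero hR) hs h
    have e2 := V.congr (isReal_mul hF hs hrb) (isReal_one hR) hsb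
    rw [V.mul hs hrb, V.one] at e2
    rw [V.zero] at e1 ⊢
    by_contra hc
    have := mul_nonpos_of_nonneg_of_nonpos e1.le (not_lt.1 hc)
    rw [e2] at this
    exact absurd this one_pos.not_ge
  · exact hsb

/-- Halves of positive reals. -/
theorem exists_half (hs : Γ ≤ S.isReal R s) (h : Γ ≤ S.lt R (S.var R.zero) s)
    (k : ∀ y, ∀ Δ ≤ Γ, Δ ≤ S.mem y R.carrier → Δ ≤ S.lt R (S.var R.zero) (S.var y) →
      Δ ≤ steq (S.app₂ R.add (S.var y) (S.var y)) s → Δ ≤ ψ) : Γ ≤ ψ := by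
  have h0 := isReal_zero hR (S := S)
  have h1 := isReal_one hR (S := S)
  have h2 := isReal_add (hasReals.field hR) h1 h1
  refine exists_pos_inv hS hR h2 (lt_of_linear hS hR h0 h2 fun K _ _ _ V => ?_)
    fun z Δ hΔ₁ hz hz0 hz1 => ?_
  · rw [V.add h1 h1, V.zero, V.one]; exact add_pos one_pos one_pos
  have hm := isReal_mul (hΔ₁.trans (hasReals.field hR)) (hΔ₁.trans hs) (isIn_var hz)
  refine isIn_elim hm fun y Δ hΔ₂ hy hmy => ?_
  have hΔ := hΔ₂.trans hΔ₁
  have key : Δ ≤ S.lt R (S.var R.zero) (S.var y) ⊓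
      steq (S.app₂ R.add (S.var y) (S.var y)) s := by
    clear k
    grw [← hΔ₂] at hz hz0 hz1 hm
    grw [← hΔ] at *
    have hrz := isIn_var (S := S) hz
    have hry := isIn_var (S := S) hy
    have e : ∀ (K : Type (max u v)) [CommRing K] [LinearOrder K] [IsStrictOrderedRing K]
        (V : Valuation S R Δ K (· < ·)), V (S.var y) = V s * V (S.var z) ∧
          (1 + 1) * V (S.var z) = 1 := by
      intro K _ _ _ V
      have e := V.congr (isReal_mul (hasReals.field hR) h2 hrz) h1 hz1
      rw [V.mul h2 hrz, V.add h1 h1, V.one] at e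
      rw [← V.mul hs hrz]
      exact ⟨(V.congr hm hry hmy).symm, e⟩
    refine le_inf (lt_of_linear hS hR h0 hry fun K _ _ _ V => ?_)
      (steq_of_linear hS hR (isReal_add (hasReals.field hR) hry hry) hs fun K _ _ _ V => ?_)
    · have e1 := V.lt h0 hs h
      have e2 := V.lt h0 hrz hz0
      rw [V.zero] at e1 e2 ⊢
      rw [(e K V).1]
      exact mul_pos e1 e2
    · rw [V.add hry hry, (e K V).1]
      linear_combination V.toFun s * (e K V).2
  exact k y Δ hΔ hy (and_left key) (and_right key)

/-- Below two positive reals there is a third one. -/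
theorem exists_lt_both (hs : Γ ≤ S.isReal R s) (ht : Γ ≤ S.isReal R t)
    (h : Γ ≤ S.lt R (S.var R.zero) s) (h' : Γ ≤ S.lt R (S.var R.zero) t)
    (k : ∀ y, ∀ Δ ≤ Γ, Δ ≤ S.mem y R.carrier → Δ ≤ S.lt R (S.var R.zero) (S.var y) →
      Δ ≤ S.lt R (S.var y) s → Δ ≤ S.lt R (S.var y) t → Δ ≤ ψ) : Γ ≤ ψ := by
  have lt_self : ∀ {Θ : H} {s : M → H} {y : M}, Θ ≤ S.hasReals N R → Θ ≤ S.isReal R s →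
      Θ ≤ S.mem y R.carrier → Θ ≤ S.lt R (S.var R.zero) (S.var y) →
      Θ ≤ steq (S.app₂ R.add (S.var y) (S.var y)) s → Θ ≤ S.lt R (S.var y) s := by
    intro Θ s y hR hs hy hy0 e
    have hry := isIn_var (S := S) hy
    refine lt_of_linear hS hR hry hs fun K _ _ _ V => ?_
    have e1 := V.lt (isReal_zero hR) hry hy0
    rw [← V.congr (isReal_add (hasReals.field hR) hry hry) hs e, V.add hry hry]
    rw [V.zero] at e1
    linarith
  refine exists_half hS hR hs h fun y Δ hΔ₁ hy hy0 e => ?_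
  have l1 := lt_self (hΔ₁.trans hR) (hΔ₁.trans hs) hy hy0 e
  -- With y = s/2 < s, cotransitivity gives y < t, or t < s; in the latter case t/2 is below both.
  -- No minimum has to be decided.
  refine sup_elim (lt_cotrans (hΔ₁.trans (hasReals.ordered hR)) (isIn_var hy) (hΔ₁.trans hs)
    (hΔ₁.trans ht) l1) (fun Δ hΔ₂ hl => ?_) fun Δ hΔ₂ hl => ?_
  · exact k y Δ (hΔ₂.trans hΔ₁) (hΔ₂.trans hy) (hΔ₂.trans hy0) (hΔ₂.trans l1) hl
  · have hΔ := hΔ₂.trans hΔ₁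
    refine exists_half hS (hΔ.trans hR) (hΔ.trans ht) (hΔ.trans h') fun z Δ hΔ₃ hz hz0 e => ?_
    have hΔ' := hΔ₃.trans hΔ
    have l2 := lt_self (hΔ'.trans hR) (hΔ'.trans ht) hz hz0 e
    refine k z Δ hΔ' hz hz0 ?_ l2
    clear k lt_self
    grw [← hΔ₃] at hl
    grw [← hΔ'] at hR hs ht
    exact lt_of_linear hS hR (isIn_var hz) hs fun K _ _ _ V =>
      (V.lt (isIn_var hz) ht l2).trans (V.lt ht hs hl)

end

section

variable {φ : M → H}

theorem exPos_intro (ha : Γ ≤ S.mem a R.carrier) (h : Γ ≤ S.lt R (S.var R.zero) (S.var a))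
    (h' : Γ ≤ φ a) : Γ ≤ S.exPos R φ := ex_intro a ha (le_inf h h')

theorem exPos_elim (h : Γ ≤ S.exPos R φ) (k : ∀ a, ∀ Δ ≤ Γ, Δ ≤ S.mem a R.carrier →
    Δ ≤ S.lt R (S.var R.zero) (S.var a) → Δ ≤ φ a → Δ ≤ ψ) : Γ ≤ ψ :=
  ex_elim h fun a Δ hΔ ha h => k a Δ hΔ ha (and_left h) (and_right h)

theorem allPos_intro (k : ∀ a, ∀ Δ ≤ Γ, Δ ≤ S.mem a R.carrier →
    Δ ≤ S.lt R (S.var R.zero) (S.var a) → Δ ≤ φ a) : Γ ≤ S.allPos R φ :=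
  all_intro fun a _ hΔ ha => himp_intro fun Θ hΘ h => k a Θ (hΘ.trans hΔ) (hΘ.trans ha) h

theorem allPos_elim (h : Γ ≤ S.allPos R φ) (ha : Γ ≤ S.mem a R.carrier)
    (h' : Γ ≤ S.lt R (S.var R.zero) (S.var a)) : Γ ≤ φ a :=
  himp_elim (all_elim h ha :) h'

end

end SetInterp

namespace SetInterp

variable {H : Type u} [Order.Frame H] {M : Type v} {S : SetInterp H M}
  {Γ Δ ψ : H} {a b c g x y z w N c' t t' x₀ E d : M} {R : RealLineData M} {X : MetricData M}

/-! ### Metric spaces -/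

section

theorem isReal_dist (hX : Γ ≤ S.isMetricSpace R X) (hx : Γ ≤ S.mem x X.carrier)
    (hy : Γ ≤ S.mem y X.carrier) : Γ ≤ S.isReal R (S.dist X x y) :=
  isIn_app₂ (and_left (and_left (and_left (and_left hX)))) (isIn_var hx) (isIn_var hy)

theorem zero_le_dist (hX : Γ ≤ S.isMetricSpace R X) (hx : Γ ≤ S.mem x X.carrier)
    (hy : Γ ≤ S.mem y X.carrier) : Γ ≤ S.le R (S.var R.zero) (S.dist X x y) :=
  (all_elim (all_elim (and_right (and_left (and_left (and_left hX)))) hx :) hy :)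

theorem dist_eq_zero_iff (hX : Γ ≤ S.isMetricSpace R X) (hx : Γ ≤ S.mem x X.carrier)
    (hy : Γ ≤ S.mem y X.carrier) : Γ ≤ teq (S.dist X x y) (S.var R.zero) ⇔ S.eq x y :=
  (all_elim (all_elim (and_right (and_left (and_left hX))) hx :) hy :)

theorem dist_comm (hX : Γ ≤ S.isMetricSpace R X) (hx : Γ ≤ S.mem x X.carrier)
    (hy : Γ ≤ S.mem y X.carrier) : Γ ≤ teq (S.dist X x y) (S.dist X y x) :=
  (all_elim (all_elim (and_right (and_left hX)) hx :) hy :)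

theorem dist_triangle (hX : Γ ≤ S.isMetricSpace R X) (hx : Γ ≤ S.mem x X.carrier)
    (hy : Γ ≤ S.mem y X.carrier) (hz : Γ ≤ S.mem z X.carrier) :
    Γ ≤ S.le R (S.dist X x z) (S.app₂ R.add (S.dist X x y) (S.dist X y z)) :=
  (all_elim (all_elim (all_elim (and_right hX) hx :) hy :) hz :)

theorem dist_congr (h : Γ ≤ S.eq x a) (h' : Γ ≤ S.eq y b) :
    Γ ≤ steq (S.dist X x y) (S.dist X a b) :=
  app₂_congr (steq_var h) (steq_var h')

namespace Valuation

variable {K : Type*} [CommRing K] [LinearOrder K] (V : Valuation S R Γ K (· < ·))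

theorem dist_nonneg (hR : Γ ≤ S.hasReals N R) (hX : Γ ≤ S.isMetricSpace R X)
    (hx : Γ ≤ S.mem x X.carrier) (hy : Γ ≤ S.mem y X.carrier) : 0 ≤ V (S.dist X x y) := by
  rw [← V.zero]
  exact V.le (isReal_zero hR) (isReal_dist hX hx hy) (zero_le_dist hX hx hy)

theorem dist_self (hR : Γ ≤ S.hasReals N R) (hX : Γ ≤ S.isMetricSpace R X)
    (hx : Γ ≤ S.mem x X.carrier) : V (S.dist X x x) = 0 := by
  rw [← V.zero]
  exact V.teq (isReal_dist hX hx hx) (isReal_zero hR) (iff_mpr (dist_eq_zero_iff hX hx hx) eq_rfl)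

theorem dist_comm (hX : Γ ≤ S.isMetricSpace R X)
    (hx : Γ ≤ S.mem x X.carrier) (hy : Γ ≤ S.mem y X.carrier) :
    V (S.dist X x y) = V (S.dist X y x) :=
  V.teq (isReal_dist hX hx hy) (isReal_dist hX hy hx) (SetInterp.dist_comm hX hx hy)

theorem dist_triangle (hR : Γ ≤ S.hasReals N R) (hX : Γ ≤ S.isMetricSpace R X)
    (hx : Γ ≤ S.mem x X.carrier) (hy : Γ ≤ S.mem y X.carrier) (hz : Γ ≤ S.mem z X.carrier) :
    V (S.dist X x z) ≤ V (S.dist X x y) + V (S.dist X y z) := by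
  rw [← V.add (isReal_dist hX hx hy) (isReal_dist hX hy hz)]
  exact V.le (isReal_dist hX hx hz) (isReal_add (hasReals.field hR) (isReal_dist hX hx hy)
    (isReal_dist hX hy hz)) (SetInterp.dist_triangle hX hx hy hz)

end Valuation

end

/-! ### One-point extensions -/

variable (S) in
/-- The point `x` of `X ∪ {w}` has coordinates `(c, t)` in `X × {0, 1}`; the new point `w` has
coordinates `(x₀, 1)`. -/
def isCoord (R : RealLineData M) (X : MetricData M) (w x₀ x c t : M) : H :=
  (S.mem x X.carrier ⊓ S.eq x c ⊓ S.eq t R.zero) ⊔ (S.eq x w ⊓ S.eq c x₀ ⊓ S.eq t R.one)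

variable (S) in
/-- The distance between points with coordinates `(c, t)` and `(c', t')`. -/
def coordDist (R : RealLineData M) (X : MetricData M) (c t c' t' : M) : M → H :=
  S.app₂ R.add (S.dist X c c') (S.app₂ R.add (S.app₂ R.add (S.var t) (S.var t'))
    (S.neg R (S.app₂ R.mul (S.app₂ R.add (S.var t) (S.var t)) (S.var t'))))

variable (S) in
/-- The distance of the points `x` and `y` of `X ∪ {w}` is `r`. -/
def extDist (R : RealLineData M) (X : MetricData M) (w x₀ x y r : M) : H :=
  ⨆ c, ⨆ t, ⨆ c', ⨆ t', S.isCoord R X w x₀ x c t ⊓ S.isCoord R X w x₀ y c' t' ⊓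
    S.coordDist R X c t c' t' r

section

theorem isCoord_mem (hR : Γ ≤ S.hasReals N R) (h₀ : Γ ≤ S.mem x₀ X.carrier)
    (h : Γ ≤ S.isCoord R X w x₀ x c t) : Γ ≤ S.mem c X.carrier ⊓ S.mem t R.carrier := by
  refine sup_elim h (fun Δ hΔ h => ?_) fun Δ hΔ h => ?_ <;> grw [← hΔ] at *
  · exact le_inf (mem_left (and_right (and_left h)) (and_left (and_left h)))
      (mem_left (eq_sym (and_right h)) (zero_mem (hasReals.field hR)))
  · exact le_inf (mem_left (eq_sym (and_right (and_left h))) h₀)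
      (mem_left (eq_sym (and_right h)) (one_mem (hasReals.field hR)))

/-- The two kinds of coordinates exclude each other because `w` is not in `X`. -/
theorem isCoord_unique (hw : Γ ≤ (S.mem w X.carrier)ᶜ) (h : Γ ≤ S.isCoord R X w x₀ x c t)
    (h' : Γ ≤ S.isCoord R X w x₀ x c' t') : Γ ≤ S.eq c c' ⊓ S.eq t t' := by
  refine sup_elim h (fun Δ hΔ h => ?_) fun Δ hΔ h => ?_ <;> grw [← hΔ] at * <;>
    refine sup_elim h' (fun Δ hΔ h' => ?_) fun Δ hΔ h' => ?_ <;> grw [← hΔ] at *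
  · exact le_inf (eq_tr (eq_sym (and_right (and_left h))) (and_right (and_left h')))
      (eq_tr (and_right h) (eq_sym (and_right h')))
  · exact compl_elim hw (mem_left (and_left (and_left h')) (and_left (and_left h)))
  · exact compl_elim hw (mem_left (and_left (and_left h)) (and_left (and_left h')))
  · exact le_inf (eq_tr (and_right (and_left h)) (eq_sym (and_right (and_left h'))))
      (eq_tr (and_right h) (eq_sym (and_right h')))

theorem exists_isCoord (hE : Γ ≤ ⨅ x, S.mem x E ⇔ (S.mem x X.carrier ⊔ S.eq x w))
    (hx : Γ ≤ S.mem x E) : Γ ≤ ⨆ c, ⨆ t, S.isCoord R X w x₀ x c t := by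
  refine sup_elim (iff_mp (iInf_elim hE x) hx) (fun Δ hΔ h => ?_) fun Δ hΔ h => ?_
  · exact iSup_intro x (iSup_intro R.zero (inl (le_inf (le_inf h eq_rfl) eq_rfl)))
  · exact iSup_intro x₀ (iSup_intro R.one (inr (le_inf (le_inf h eq_rfl) eq_rfl)))

theorem isReal_coordDist (hR : Γ ≤ S.hasReals N R) (hX : Γ ≤ S.isMetricSpace R X)
    (hc : Γ ≤ S.mem c X.carrier) (ht : Γ ≤ S.mem t R.carrier) (hc' : Γ ≤ S.mem c' X.carrier)
    (ht' : Γ ≤ S.mem t' R.carrier) : Γ ≤ S.isReal R (S.coordDist R X c t c' t') := by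
  have hF := hasReals.field hR
  exact isReal_add hF (isReal_dist hX hc hc') (isReal_add hF (isReal_add hF (isIn_var ht)
    (isIn_var ht')) (and_left (isReal_neg hF (isReal_mul hF (isReal_add hF (isIn_var ht)
    (isIn_var ht)) (isIn_var ht')))))

/-- For t and t' in {0, 1} the polynomial t + t' - 2tt' equals |t - t'|, so the distance is that of
a sum metric on X × {0, 1}, written without an absolute value. -/
theorem Valuation.coordDist {K : Type*} [CommRing K] [LinearOrder K]
    (V : Valuation S R Γ K (· < ·)) (hR : Γ ≤ S.hasReals N R) (hX : Γ ≤ S.isMetricSpace R X)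
    (hc : Γ ≤ S.mem c X.carrier) (ht : Γ ≤ S.mem t R.carrier) (hc' : Γ ≤ S.mem c' X.carrier)
    (ht' : Γ ≤ S.mem t' R.carrier) : V (S.coordDist R X c t c' t') =
      V (S.dist X c c') + V (S.var t) + V (S.var t') - 2 * V (S.var t) * V (S.var t') := by
  have hF := hasReals.field hR
  have h1 := isReal_mul hF (isReal_add hF (isIn_var ht) (isIn_var ht)) (isIn_var ht')
  unfold SetInterp.coordDist
  rw [V.add (isReal_dist hX hc hc') (isReal_add hF (isReal_add hF (isIn_var ht)
    (isIn_var ht')) (and_left (isReal_neg hF h1))), V.add (isReal_add hF (isIn_var ht)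
    (isIn_var ht')) (and_left (isReal_neg hF h1)), V.neg h1,
    V.mul (isReal_add hF (isIn_var ht) (isIn_var ht)) (isIn_var ht'),
    V.add (isIn_var ht) (isIn_var ht), V.add (isIn_var ht) (isIn_var ht')]
  ring

/-- Prime filters respect disjunction. Each metric axiom of the extension therefore reduces to
finitely many linear inequalities about the metric of X. -/
theorem Valuation.coord_zero_or_one {K : Type*} [CommRing K] [LinearOrder K]
    (V : Valuation S R Γ K (· < ·)) (hR : Γ ≤ S.hasReals N R) (h₀ : Γ ≤ S.mem x₀ X.carrier)
    (h : Γ ≤ S.isCoord R X w x₀ x c t) : V (S.var t) = 0 ∨ V (S.var t) = 1 := by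
  have ht := V.of_le (isIn_var (S := S) (and_right (isCoord_mem hR h₀ h)))
  rw [← V.zero, ← V.one]
  refine (V.sup (V.of_le h)).imp (fun h => ?_) fun h => ?_
  · exact V.congr' ht (V.of_le (isReal_zero hR))
      (V.mono (inf_le_right.trans (steq_var le_rfl)) h)
  · exact V.congr' ht (V.of_le (isReal_one hR))
      (V.mono (inf_le_right.trans (steq_var le_rfl)) h)

instance {C T C' T' r : (ℕ → M) → M} [IsAtom C] [IsAtom T] [IsAtom C'] [IsAtom T'] [IsAtom r] :
    S.Definable fun v => S.coordDist R X (C v) (T v) (C' v) (T' v) (r v) := by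
  unfold coordDist
  infer_instance

instance : S.Definable fun v => S.extDist R X w x₀ (v 0) (v 1) (v 2) := by
  unfold extDist isCoord
  infer_instance

theorem coordDist_congr {r s s' : M} (h₁ : Γ ≤ S.eq c a) (h₂ : Γ ≤ S.eq t s) (h₃ : Γ ≤ S.eq c' b)
    (h₄ : Γ ≤ S.eq t' s') (h : Γ ≤ S.coordDist R X c t c' t' r) :
    Γ ≤ S.coordDist R X a s b s' r :=
  Definable.congr (fun c => S.coordDist R X c s b s' r) h₁
    (Definable.congr (fun t => S.coordDist R X c t b s' r) h₂
    (Definable.congr (fun c' => S.coordDist R X c t c' s' r) h₃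
    (Definable.congr (fun t' => S.coordDist R X c t c' t' r) h₄ h)))

theorem dist_eq_coordDist (hR : Γ ≤ S.hasReals N R) (hX : Γ ≤ S.isMetricSpace R X)
    (hw : Γ ≤ (S.mem w X.carrier)ᶜ) (h₀ : Γ ≤ S.mem x₀ X.carrier)
    (hd : Γ ≤ S.isFun₂ d E E R.carrier)
    (hG : Γ ≤ ⨅ x, ⨅ y, ⨅ z, S.rel₂ d x y z ⇨ S.extDist R X w x₀ x y z)
    (hx : Γ ≤ S.mem x E) (hy : Γ ≤ S.mem y E) (h : Γ ≤ S.isCoord R X w x₀ x c t)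
    (h' : Γ ≤ S.isCoord R X w x₀ y c' t') :
    Γ ≤ steq (S.dist ⟨E, d⟩ x y) (S.coordDist R X c t c' t') := by
  refine ex_elim (isFun₂_total hd hx hy) fun r Δ hΔ _ hr => ?_
  grw [← hΔ] at *
  refine iSup_elim (himp_elim (iInf_elim (iInf_elim (iInf_elim hG x :) y :) r :) hr)
    fun a Δ hΔ hr' => ?_
  grw [← hΔ] at *
  refine iSup_elim hr' fun s Δ hΔ hr' => ?_
  grw [← hΔ] at *
  refine iSup_elim hr' fun b Δ hΔ hr' => ?_
  grw [← hΔ] at *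
  refine iSup_elim hr' fun s' Δ hΔ hr' => ?_
  grw [← hΔ] at *
  have e1 := isCoord_unique hw (and_left (and_left hr')) h
  have e2 := isCoord_unique hw (and_right (and_left hr')) h'
  have m1 := isCoord_mem hR h₀ h
  have m2 := isCoord_mem hR h₀ h'
  exact steq_trans (steq_app₂_var hd hr) (steq_symm (steq_of_app (isReal_coordDist hR hX
    (and_left m1) (and_right m1) (and_left m2) (and_right m2))
    (coordDist_congr (and_left e1) (and_right e1) (and_left e2) (and_right e2) (and_right hr'))))

theorem exists_extDist (hS : S.IsBishopModel) (hR : Γ ≤ S.hasReals N R)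
    (hX : Γ ≤ S.isMetricSpace R X) (hw : Γ ≤ (S.mem w X.carrier)ᶜ)
    (h₀ : Γ ≤ S.mem x₀ X.carrier) (hE : Γ ≤ ⨅ x, S.mem x E ⇔ (S.mem x X.carrier ⊔ S.eq x w)) :
    Γ ≤ ⨆ d, S.isFun₂ d E E R.carrier ⊓
      ⨅ x, ⨅ y, ⨅ z, S.rel₂ d x y z ⇨ S.extDist R X w x₀ x y z := by
  refine hS.exists_isFun₂ (fun x y z => S.extDist R X w x₀ x y z) ?_ ?_
  · refine all_intro fun x Δ hΔ hx => all_intro fun y Δ hΔ' hy => ?_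
    grw [← hΔ', ← hΔ] at *
    refine iSup_elim (exists_isCoord (R := R) (x₀ := x₀) hE hx) fun c Δ hΔ h => ?_
    grw [← hΔ] at *
    refine iSup_elim h fun t Δ hΔ h => ?_
    grw [← hΔ] at *
    refine iSup_elim (exists_isCoord (R := R) (x₀ := x₀) hE hy) fun c' Δ hΔ h' => ?_
    grw [← hΔ] at *
    refine iSup_elim h' fun t' Δ hΔ h' => ?_
    grw [← hΔ] at *
    have m1 := isCoord_mem hR h₀ h
    have m2 := isCoord_mem hR h₀ h'
    refine isIn_elim (isReal_coordDist hR hX (and_left m1) (and_right m1) (and_left m2)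
      (and_right m2)) fun r Δ hΔ hr e => ?_
    grw [← hΔ] at *
    exact ex_intro r hr (iSup_intro c (iSup_intro t (iSup_intro c' (iSup_intro t'
      (le_inf (le_inf h h') (steq_app' e eq_rfl))))))
  · intro x y r r' Δ hΔ hr hr'
    grw [← hΔ] at *
    refine iSup_elim hr fun a Δ hΔ h => ?_
    grw [← hΔ] at *
    refine iSup_elim h fun s Δ hΔ h => ?_
    grw [← hΔ] at *
    refine iSup_elim h fun b Δ hΔ h => ?_
    grw [← hΔ] at *
    refine iSup_elim h fun s' Δ hΔ h => ?_
    grw [← hΔ] at *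
    refine iSup_elim hr' fun c Δ hΔ h' => ?_
    grw [← hΔ] at *
    refine iSup_elim h' fun t Δ hΔ h' => ?_
    grw [← hΔ] at *
    refine iSup_elim h' fun c' Δ hΔ h' => ?_
    grw [← hΔ] at *
    refine iSup_elim h' fun t' Δ hΔ h' => ?_
    grw [← hΔ] at *
    have e1 := isCoord_unique hw (and_left (and_left h)) (and_left (and_left h'))
    have e2 := isCoord_unique hw (and_right (and_left h)) (and_right (and_left h'))
    have m1 := isCoord_mem hR h₀ (and_left (and_left h'))
    have m2 := isCoord_mem hR h₀ (and_right (and_left h'))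
    exact isIn_unique (isReal_coordDist hR hX (and_left m1) (and_right m1) (and_left m2)
      (and_right m2)) (coordDist_congr (and_left e1) (and_right e1) (and_left e2) (and_right e2)
      (and_right h)) (and_right h')

variable (S) in
/-- `E = X ∪ {w}` carries the metric obtained from the coordinates. -/
def isCoordExtension (N : M) (R : RealLineData M) (X : MetricData M) (w x₀ E d : M) : H :=
  S.hasReals N R ⊓ S.isMetricSpace R X ⊓ (S.mem w X.carrier)ᶜ ⊓ S.mem x₀ X.carrier ⊓
    (⨅ x, S.mem x E ⇔ (S.mem x X.carrier ⊔ S.eq x w)) ⊓ S.isFun₂ d E E R.carrier ⊓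
    ⨅ x, ⨅ y, ⨅ z, S.rel₂ d x y z ⇨ S.extDist R X w x₀ x y z

theorem isCoord_congr (h : Γ ≤ S.eq x y) (hx : Γ ≤ S.isCoord R X w x₀ x c t) :
    Γ ≤ S.isCoord R X w x₀ y c t := by
  unfold isCoord at *
  exact Definable.congr (fun x => (S.mem x X.carrier ⊓ S.eq x c ⊓ S.eq t R.zero) ⊔
    (S.eq x w ⊓ S.eq c x₀ ⊓ S.eq t R.one)) h hx

/-- Mixed coordinates would force 0 = 1, contrary to 0 < 1. This gives the implication from distance
zero to equality. -/
theorem isCoord_inj (hR : Γ ≤ S.hasReals N R) (h : Γ ≤ S.isCoord R X w x₀ x c t)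
    (h' : Γ ≤ S.isCoord R X w x₀ y c' t') (hc : Γ ≤ S.eq c c') (ht : Γ ≤ S.eq t t') :
    Γ ≤ S.eq x y := by
  have h01 : ∀ {Δ : H}, Δ ≤ S.hasReals N R → Δ ≤ S.eq R.zero R.one → Δ ≤ S.eq x y := by
    intro Δ hR h
    have hl := zero_lt_one (hasReals.ordered hR)
    have hl' := lt_congr (steq_refl _) (steq_var (eq_sym h)) hl
    exact lt_asymm (hasReals.ordered hR) (isReal_zero hR) (isReal_zero hR) hl' hl'
  refine sup_elim h (fun Δ hΔ h => ?_) fun Δ hΔ h => ?_ <;>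
    refine sup_elim (hΔ.trans h') (fun Δ hΔ' h' => ?_) fun Δ hΔ' h' => ?_ <;>
    grw [← hΔ', ← hΔ] at *
  · exact eq_tr (and_right (and_left h)) (eq_tr hc (eq_sym (and_right (and_left h'))))
  · exact h01 hR (eq_tr (eq_sym (and_right h)) (eq_tr ht (and_right h')))
  · exact h01 hR (eq_sym (eq_tr (eq_sym (and_right h)) (eq_tr ht (and_right h'))))
  · exact eq_tr (and_left (and_left h)) (eq_sym (and_left (and_left h')))

namespace isCoordExtension

variable (h : Γ ≤ S.isCoordExtension N R X w x₀ E d)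
include h

theorem reals : Γ ≤ S.hasReals N R :=
  and_left (and_left (and_left (and_left (and_left (and_left h)))))

theorem metric : Γ ≤ S.isMetricSpace R X :=
  and_right (and_left (and_left (and_left (and_left (and_left h)))))

theorem not_mem : Γ ≤ (S.mem w X.carrier)ᶜ := and_right (and_left (and_left (and_left (and_left h))))

theorem base_mem : Γ ≤ S.mem x₀ X.carrier := and_right (and_left (and_left (and_left h)))

theorem mem_iff : Γ ≤ ⨅ x, S.mem x E ⇔ (S.mem x X.carrier ⊔ S.eq x w) :=
  and_right (and_left (and_left h))

theorem dist_isFun₂ : Γ ≤ S.isFun₂ d E E R.carrier := and_right (and_left h)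

theorem isReal_dist (hx : Γ ≤ S.mem x E) (hy : Γ ≤ S.mem y E) :
    Γ ≤ S.isReal R (S.dist ⟨E, d⟩ x y) :=
  isIn_app₂ (dist_isFun₂ h) (isIn_var hx) (isIn_var hy)

theorem coord_elim (hx : Γ ≤ S.mem x E)
    (k : ∀ c t, ∀ Δ ≤ Γ, Δ ≤ S.isCoord R X w x₀ x c t → Δ ≤ ψ) : Γ ≤ ψ :=
  iSup_elim (exists_isCoord (mem_iff h) hx) fun c _ hΔ h => iSup_elim h fun t Θ hΘ h =>
    k c t Θ (hΘ.trans hΔ) h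

theorem fst_mem (hc : Γ ≤ S.isCoord R X w x₀ x c t) : Γ ≤ S.mem c X.carrier :=
  and_left (isCoord_mem (reals h) (base_mem h) hc)

theorem snd_mem (hc : Γ ≤ S.isCoord R X w x₀ x c t) : Γ ≤ S.mem t R.carrier :=
  and_right (isCoord_mem (reals h) (base_mem h) hc)

theorem val_dist {K : Type*} [CommRing K] [LinearOrder K]
    (V : Valuation S R Γ K (· < ·)) (hx : Γ ≤ S.mem x E) (hy : Γ ≤ S.mem y E)
    (hc : Γ ≤ S.isCoord R X w x₀ x c t) (hc' : Γ ≤ S.isCoord R X w x₀ y c' t') :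
    V (S.dist ⟨E, d⟩ x y) =
      V (S.dist X c c') + V (S.var t) + V (S.var t') - 2 * V (S.var t) * V (S.var t') := by
  have hm := isReal_coordDist (reals h) (metric h) (fst_mem h hc) (snd_mem h hc) (fst_mem h hc')
    (snd_mem h hc')
  rw [← V.coordDist (reals h) (metric h) (fst_mem h hc) (snd_mem h hc) (fst_mem h hc')
    (snd_mem h hc')]
  exact V.congr (isReal_dist h hx hy) hm (dist_eq_coordDist (reals h) (metric h) (not_mem h)
    (base_mem h) (dist_isFun₂ h) (and_right h) hx hy hc hc')

theorem val_snd {K : Type*} [CommRing K] [LinearOrder K] (V : Valuation S R Γ K (· < ·))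
    (hc : Γ ≤ S.isCoord R X w x₀ x c t) : V (S.var t) = 0 ∨ V (S.var t) = 1 :=
  V.coord_zero_or_one (reals h) (base_mem h) hc

variable (hS : S.IsBishopModel)
include hS

theorem dist_nonneg (hx : Γ ≤ S.mem x E) (hy : Γ ≤ S.mem y E) :
    Γ ≤ S.le R (S.var R.zero) (S.dist ⟨E, d⟩ x y) := by
  refine coord_elim h hx fun c t Δ hΔ hc => ?_
  grw [← hΔ] at *
  refine coord_elim h hy fun c' t' Δ hΔ hc' => ?_
  grw [← hΔ] at *
  refine le_of_linear_le hS (reals h) (isReal_zero (reals h)) (isReal_dist h hx hy)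
    fun K _ _ _ V => ?_
  have := V.dist_nonneg (reals h) (metric h) (fst_mem h hc) (fst_mem h hc')
  rw [V.zero, val_dist h V hx hy hc hc']
  rcases val_snd h V hc with e | e <;> rcases val_snd h V hc' with e' | e' <;> rw [e, e'] <;>
    linarith

theorem dist_eq_zero_iff (hx : Γ ≤ S.mem x E) (hy : Γ ≤ S.mem y E) :
    Γ ≤ teq (S.dist ⟨E, d⟩ x y) (S.var R.zero) ⇔ S.eq x y := by
  refine coord_elim h hx fun c t Δ hΔ hc => ?_
  grw [← hΔ] at *
  refine coord_elim h hy fun c' t' Δ hΔ hc' => ?_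
  grw [← hΔ] at *
  refine iff_intro (fun Δ hΔ he => ?_) fun Δ hΔ he => ?_ <;> grw [← hΔ] at *
  · have key : ∀ (K : Type (max u v)) [CommRing K] [LinearOrder K] [IsStrictOrderedRing K]
        (V : Valuation S R Δ K (· < ·)),
        V (S.dist X c c') = V (S.var R.zero) ∧ V (S.var t) = V (S.var t') := by
      intro K _ _ _ V
      have e := V.teq (isReal_dist h hx hy) (isReal_zero (reals h)) he
      have h0 := V.dist_nonneg (reals h) (metric h) (fst_mem h hc) (fst_mem h hc')
      rw [V.zero, val_dist h V hx hy hc hc'] at e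
      rw [V.zero]
      rcases val_snd h V hc with e1 | e1 <;> rcases val_snd h V hc' with e2 | e2 <;>
        rw [e1, e2] at e ⊢ <;> refine ⟨?_, ?_⟩ <;> linarith
    have hr := SetInterp.isReal_dist (metric h) (fst_mem h hc) (fst_mem h hc')
    have e1 := steq_of_linear hS (reals h) hr (isReal_zero (reals h)) fun K _ _ _ V => (key K V).1
    have e2 := steq_of_linear hS (reals h) (isIn_var (snd_mem h hc)) (isIn_var (snd_mem h hc'))
      fun K _ _ _ V => (key K V).2
    exact isCoord_inj (reals h) hc hc' (iff_mp (SetInterp.dist_eq_zero_iff (metric h)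
      (fst_mem h hc) (fst_mem h hc')) (teq_of_steq hr e1)) (eq_of_steq_var e2)
  · have e := isCoord_unique (not_mem h) (isCoord_congr he hc) hc'
    refine teq_of_steq (isReal_dist h hx hy) (steq_of_linear hS (reals h) (isReal_dist h hx hy)
      (isReal_zero (reals h)) fun K _ _ _ V => ?_)
    rw [V.zero, val_dist h V hx hy hc hc', ← V.congr (isIn_var (snd_mem h hc))
      (isIn_var (snd_mem h hc')) (steq_var (and_right e)), V.teq (SetInterp.isReal_dist (metric h)
      (fst_mem h hc) (fst_mem h hc')) (isReal_zero (reals h)) (iff_mpr (SetInterp.dist_eq_zero_iff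
      (metric h) (fst_mem h hc) (fst_mem h hc')) (and_left e)), V.zero]
    rcases val_snd h V hc with e1 | e1 <;> rw [e1] <;> ring

theorem dist_comm (hx : Γ ≤ S.mem x E) (hy : Γ ≤ S.mem y E) :
    Γ ≤ teq (S.dist ⟨E, d⟩ x y) (S.dist ⟨E, d⟩ y x) := by
  refine coord_elim h hx fun c t Δ hΔ hc => ?_
  grw [← hΔ] at *
  refine coord_elim h hy fun c' t' Δ hΔ hc' => ?_
  grw [← hΔ] at *
  refine teq_of_steq (isReal_dist h hx hy) (steq_of_linear hS (reals h) (isReal_dist h hx hy)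
    (isReal_dist h hy hx) fun K _ _ _ V => ?_)
  rw [val_dist h V hx hy hc hc', val_dist h V hy hx hc' hc,
    V.dist_comm (metric h) (fst_mem h hc) (fst_mem h hc')]
  ring

theorem dist_triangle (hx : Γ ≤ S.mem x E) (hy : Γ ≤ S.mem y E) (hz : Γ ≤ S.mem z E) :
    Γ ≤ S.le R (S.dist ⟨E, d⟩ x z)
      (S.app₂ R.add (S.dist ⟨E, d⟩ x y) (S.dist ⟨E, d⟩ y z)) := by
  refine coord_elim h hx fun c t Δ hΔ hc => ?_
  grw [← hΔ] at *
  refine coord_elim h hy fun c' t' Δ hΔ hc' => ?_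
  grw [← hΔ] at *
  refine coord_elim h hz fun b s Δ hΔ hb => ?_
  grw [← hΔ] at *
  refine le_of_linear_le hS (reals h) (isReal_dist h hx hz) (isReal_add (hasReals.field (reals h))
    (isReal_dist h hx hy) (isReal_dist h hy hz)) fun K _ _ _ V => ?_
  have := V.dist_triangle (reals h) (metric h) (fst_mem h hc) (fst_mem h hc') (fst_mem h hb)
  rw [V.add (isReal_dist h hx hy) (isReal_dist h hy hz), val_dist h V hx hy hc hc',
    val_dist h V hy hz hc' hb, val_dist h V hx hz hc hb]
  rcases val_snd h V hc with e | e <;> rcases val_snd h V hc' with e' | e' <;>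
    rcases val_snd h V hb with e'' | e'' <;> rw [e, e', e''] <;> linarith

theorem isOnePointExtension : Γ ≤ S.isOnePointExtension R X ⟨E, d⟩ w := by
  have hA : ∀ {Δ : H} {x : M}, Δ ≤ S.isCoordExtension N R X w x₀ E d → Δ ≤ S.mem x X.carrier →
      Δ ≤ S.mem x E := fun h hx => iff_mpr (iInf_elim (mem_iff h) _) (inl hx)
  have hC : ∀ {Δ : H} {x : M}, Δ ≤ S.mem x X.carrier →
      Δ ≤ S.isCoord R X w x₀ x x R.zero := fun hx => inl (le_inf (le_inf hx eq_rfl) eq_rfl)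
  refine le_inf (le_inf (le_inf (le_inf (le_inf (le_inf (le_inf (dist_isFun₂ h) ?_) ?_) ?_) ?_)
    (mem_iff h)) ?_) ?_
  · exact all_intro fun x Δ hΔ hx => all_intro fun y Δ' hΔ' hy =>
      dist_nonneg (hΔ'.trans (hΔ.trans h)) hS (hΔ'.trans hx) hy
  · exact all_intro fun x Δ hΔ hx => all_intro fun y Δ' hΔ' hy =>
      dist_eq_zero_iff (hΔ'.trans (hΔ.trans h)) hS (hΔ'.trans hx) hy
  · exact all_intro fun x Δ hΔ hx => all_intro fun y Δ' hΔ' hy =>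
      dist_comm (hΔ'.trans (hΔ.trans h)) hS (hΔ'.trans hx) hy
  · exact all_intro fun x Δ hΔ hx => all_intro fun y Δ' hΔ' hy => all_intro fun z Δ'' hΔ'' hz =>
      dist_triangle (hΔ''.trans (hΔ'.trans (hΔ.trans h))) hS (hΔ''.trans (hΔ'.trans hx))
        (hΔ''.trans hy) hz
  · refine all_intro fun x Δ hΔ hx => all_intro fun y Δ hΔ' hy => ?_
    grw [← hΔ', ← hΔ] at *
    have hr := isReal_dist h (hA h hx) (hA h hy)
    refine teq_of_steq hr (steq_of_linear hS (reals h) hr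
      (SetInterp.isReal_dist (metric h) hx hy) fun K _ _ _ V => ?_)
    rw [val_dist h V (hA h hx) (hA h hy) (hC hx) (hC hy), V.zero]
    ring
  -- The distance from `w` to `x` is ρ(x₀, x) + 1, so 1 is a lower bound.
  · refine exPos_intro (one_mem (hasReals.field (reals h)))
      (zero_lt_one (hasReals.ordered (reals h))) (all_intro fun x Δ hΔ hx => ?_)
    grw [← hΔ] at *
    have hw := iff_mpr (iInf_elim (mem_iff h) w) (inr eq_rfl)
    have hr := isReal_dist h hw (hA h hx)
    refine le_of_linear_le hS (reals h) (isReal_one (reals h)) hr fun K _ _ _ V => ?_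
    have := V.dist_nonneg (reals h) (metric h) (base_mem h) hx
    rw [val_dist h V hw (hA h hx) (inr (le_inf (le_inf eq_rfl eq_rfl) eq_rfl)) (hC hx), V.zero,
      V.one]
    linarith

end isCoordExtension

/-- An inhabited metric space has a one-point extension. -/
theorem exists_onePointExtension (hS : S.IsBishopModel) (hR : Γ ≤ S.hasReals N R)
    (hX : Γ ≤ S.isMetricSpace R X) (h₀ : Γ ≤ S.mem x₀ X.carrier) :
    Γ ≤ ⨆ E, ⨆ d, ⨆ w, S.isOnePointExtension R X ⟨E, d⟩ w := by
  -- The added point is the set X itself.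
  have hw : Γ ≤ (S.mem X.carrier X.carrier)ᶜ := hS.mem_irrefl _
  refine iSup_elim (hS.exists_insert X.carrier X.carrier) fun E Δ hΔ hE => ?_
  grw [← hΔ] at *
  refine iSup_elim (exists_extDist hS hR hX hw h₀ hE) fun d Δ hΔ hd => ?_
  grw [← hΔ] at *
  exact iSup_intro E (iSup_intro d (iSup_intro X.carrier (isCoordExtension.isOnePointExtension
    (le_inf (le_inf (le_inf (le_inf (le_inf (le_inf hR hX) hw) h₀) hE) (and_left hd))
      (and_right hd)) hS)))

end

end SetInterp

namespace SetInterp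

variable {H : Type u} [Order.Frame H] {M : Type v} {S : SetInterp H M}
  {Γ Δ ψ : H} {N : M} {R : RealLineData M} {X : MetricData M} {Y : NormedData M} {f : M}

/-! ### Natural numbers as reals -/

theorem mem_omega_of_mem (hS : S.IsBishopModel) {n m : M} (hN : Γ ≤ S.isOmega N)
    (hn : Γ ≤ S.mem n N) (hm : Γ ≤ S.mem m n) : Γ ≤ S.mem m N := by
  have key := hS.nat_ind (fun n => S.all n fun m => S.mem m N) hN ?_ ?_ hn
  · exact (all_elim key hm :)
  · exact fun z Δ hΔ hz => all_intro fun x Δ' hΔ' hx => compl_elim (iInf_elim (hΔ'.trans hz) x) hx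
  · refine fun n s Δ hΔ hn hs ih => all_intro fun x Δ hΔ hx => ?_
    grw [← hΔ] at *
    refine sup_elim (isSucc_mem hs hx) (fun Δ hΔ h => ?_) fun Δ hΔ h => ?_ <;> grw [← hΔ] at *
    · exact (all_elim ih h :)
    · exact mem_left (eq_sym h) hn

section

variable {i n m : M}

theorem isReal_natCast (hi : Γ ≤ S.isNatCast N R i) (hn : Γ ≤ S.mem n N) :
    Γ ≤ S.isReal R (S.app i (S.var n)) :=
  isIn_app (and_left (and_left (and_left hi))) (isIn_var hn)

theorem natCast_nonneg_mono (hS : S.IsBishopModel) (hR : Γ ≤ S.hasReals N R)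
    (hi : Γ ≤ S.isNatCast N R i) (hn : Γ ≤ S.mem n N) :
    Γ ≤ S.le R (S.var R.zero) (S.app i (S.var n)) ⊓
      S.all n fun m => S.le R (S.app i (S.var m)) (S.app i (S.var n)) := by
  refine hS.nat_ind (fun n => S.le R (S.var R.zero) (S.app i (S.var n)) ⊓
    S.all n fun m => S.le R (S.app i (S.var m)) (S.app i (S.var n))) (hasReals.omega hR) ?_ ?_ hn
  · refine fun z Δ hΔ hz => le_inf ?_ (all_intro fun x Δ' hΔ' hx =>
      compl_elim (iInf_elim (hΔ'.trans hz) x) hx)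
    grw [← hΔ] at *
    have hz0 := steq_app_var (and_left (and_left (and_left hi)))
      (himp_elim (iInf_elim (and_right (and_left (and_left hi))) z :) hz)
    have hr := isIn_congr (steq_symm hz0) (isReal_zero hR)
    exact le_of_linear_le hS hR (isReal_zero hR) hr fun K _ _ _ V =>
      (V.congr hr (isReal_zero hR) hz0).ge
  · refine fun n s Δ hΔ hn hs ih => ?_
    grw [← hΔ] at *
    have hrn := isReal_natCast hi hn
    have hrs := isReal_natCast hi (isOmega_succ (hasReals.omega hR) hn hs)
    have e := himp_elim (iInf_elim (all_elim (and_right (and_left hi)) hn :) s :) hs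
    have e' : ∀ {Θ : H} (_ : Θ ≤ Δ) (K : Type (max u v)) [CommRing K] [LinearOrder K]
        [IsStrictOrderedRing K] (V : Valuation S R Θ K (· < ·)),
        V (S.app i (S.var s)) = V (S.app i (S.var n)) + 1 := by
      intro Θ hΘ K _ _ _ V
      grw [← hΘ] at *
      rw [V.teq hrs (isReal_add (hasReals.field hR) hrn (isReal_one hR)) e,
        V.add hrn (isReal_one hR), V.one]
    refine le_inf (le_of_linear_le hS hR (isReal_zero hR) hrs fun K _ _ _ V => ?_)
      (all_intro fun m Δ hΔ hm => ?_)
    · have := V.le (isReal_zero hR) hrn (and_left ih)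
      rw [e' le_rfl, V.zero]
      rw [V.zero] at this
      linarith
    · have e' := fun {Θ : H} (hΘ : Θ ≤ Δ) => e' (hΘ.trans hΔ)
      grw [← hΔ] at *
      refine sup_elim (isSucc_mem hs hm) (fun Δ hΔ h => ?_) fun Δ hΔ h => ?_ <;>
        have e' := fun {Θ : H} (hΘ : Θ ≤ Δ) => e' (hΘ.trans hΔ)
      all_goals grw [← hΔ] at *
      · have hrm := isReal_natCast hi (mem_omega_of_mem hS (hasReals.omega hR) hn h)
        refine le_of_linear_le hS hR hrm hrs fun K _ _ _ V => ?_
        have := V.le hrm hrn (all_elim (and_right ih) h :)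
        rw [e' le_rfl]
        linarith
      · have hrm := isReal_natCast hi (mem_left (eq_sym h) hn)
        refine le_of_linear_le hS hR hrm hrs fun K _ _ _ V => ?_
        rw [e' le_rfl, V.congr hrm hrn (app_congr (steq_var h))]
        linarith

theorem natCast_nonneg (hS : S.IsBishopModel) (hR : Γ ≤ S.hasReals N R)
    (hi : Γ ≤ S.isNatCast N R i) (hn : Γ ≤ S.mem n N) {K : Type*} [CommRing K] [LinearOrder K]
    (V : Valuation S R Γ K (· < ·)) : 0 ≤ V (S.app i (S.var n)) := by
  have := V.le (isReal_zero hR) (isReal_natCast hi hn)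
    (and_left (natCast_nonneg_mono hS hR hi hn))
  rwa [V.zero] at this

theorem natCast_mono (hS : S.IsBishopModel) (hR : Γ ≤ S.hasReals N R)
    (hi : Γ ≤ S.isNatCast N R i) (hm : Γ ≤ S.mem m N) (hn : Γ ≤ S.mem n N)
    (h : Γ ≤ S.mem m n ⊔ S.eq m n) :
    Γ ≤ S.le R (S.app i (S.var m)) (S.app i (S.var n)) := by
  refine sup_elim h (fun Δ hΔ h => ?_) fun Δ hΔ h => ?_ <;> grw [← hΔ] at *
  · exact (all_elim (and_right (natCast_nonneg_mono hS hR hi hn)) h :)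
  · have hrm := isReal_natCast hi hm
    have hrn := isReal_natCast hi hn
    exact le_of_linear_le hS hR hrm hrn fun K _ _ _ V =>
      (V.congr hrm hrn (app_congr (steq_var h))).le

end

/-! ### The norm of `f` -/

variable (S) in
/-- The term `‖f(x)‖`. -/
abbrev normAt (Y : NormedData M) (f x : M) : M → H := S.app Y.norm (S.app f (S.var x))

theorem isFun_norm (hY : Γ ≤ S.isNormedSpace R Y) : Γ ≤ S.isFun Y.norm Y.carrier R.carrier := by
  simp only [isNormedSpace, le_inf_iff] at hY
  exact hY.1.1.1.1.1.1.1.1.1.1.1.1.1.2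

theorem isFun₂_add (hY : Γ ≤ S.isNormedSpace R Y) :
    Γ ≤ S.isFun₂ Y.add Y.carrier Y.carrier Y.carrier := by
  simp only [isNormedSpace, le_inf_iff] at hY
  exact hY.1.1.1.1.1.1.1.1.1.1.1.1.1.1.1

theorem norm_add_le {x y : M} (hY : Γ ≤ S.isNormedSpace R Y) (hx : Γ ≤ S.mem x Y.carrier)
    (hy : Γ ≤ S.mem y Y.carrier) :
    Γ ≤ S.le R (S.app Y.norm (S.app₂ Y.add (S.var x) (S.var y)))
      (S.app₂ R.add (S.app Y.norm (S.var x)) (S.app Y.norm (S.var y))) := by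
  simp only [isNormedSpace, le_inf_iff] at hY
  exact (all_elim (all_elim hY.2 hx :) hy :)

theorem isReal_normAt {x : M} (hY : Γ ≤ S.isNormedSpace R Y)
    (hf : Γ ≤ S.isFun f X.carrier Y.carrier) (hx : Γ ≤ S.mem x X.carrier) :
    Γ ≤ S.isReal R (S.normAt Y f x) :=
  isIn_app (isFun_norm hY) (isIn_app hf (isIn_var hx))

variable (S) in
/-- `η` is a modulus of uniform continuity of `f` for `e`. -/
def isModulus (R : RealLineData M) (X : MetricData M) (Y : NormedData M) (f e η : M) : H :=
  S.all X.carrier fun x => S.all X.carrier fun y => S.lt R (S.dist X x y) (S.var η) ⇨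
    S.ex Y.carrier fun d => teq (S.app₂ Y.add (S.var d) (S.app f (S.var y))) (S.app f (S.var x)) ⊓
      S.lt R (S.app Y.norm (S.var d)) (S.var e)

/-- Since f(x) = d + f(y) with ‖d‖ < e, the triangle inequality applies directly. -/
theorem isModulus.lt_add (hS : S.IsBishopModel) {e η x y : M} (hR : Γ ≤ S.hasReals N R)
    (hY : Γ ≤ S.isNormedSpace R Y) (hf : Γ ≤ S.isFun f X.carrier Y.carrier)
    (he : Γ ≤ S.mem e R.carrier) (hη : Γ ≤ S.isModulus R X Y f e η) (hx : Γ ≤ S.mem x X.carrier)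
    (hy : Γ ≤ S.mem y X.carrier) (h : Γ ≤ S.lt R (S.dist X x y) (S.var η)) :
    Γ ≤ S.lt R (S.normAt Y f x) (S.app₂ R.add (S.normAt Y f y) (S.var e)) := by
  refine ex_elim (himp_elim (all_elim (all_elim hη hx :) hy :) h) fun d Δ hΔ hd h => ?_
  clear hη
  grw [← hΔ] at *
  refine isIn_elim (isIn_app hf (isIn_var hy)) fun b Δ hΔ hb hyb => ?_
  grw [← hΔ] at *
  have hrx := isReal_normAt hY hf hx
  have hry := isReal_normAt hY hf hy
  have hF := hasReals.field hR
  have hre := isIn_var (S := S) he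
  have hrd := isIn_app (isFun_norm hY) (isIn_var hd)
  have hrb := isIn_app (isFun_norm hY) (isIn_var hb)
  have hdb := isIn_app₂ (isFun₂_add hY) (isIn_var hd) (isIn_var hb)
  have hrdb := isIn_app (isFun_norm hY) hdb
  have e1 : Δ ≤ steq (S.app₂ Y.add (S.var d) (S.var b)) (S.app f (S.var x)) :=
    steq_trans (app₂_congr (steq_refl _) (steq_symm hyb)) (steq_of_teq
      (isIn_app₂ (isFun₂_add hY) (isIn_var hd) (isIn_app hf (isIn_var hy)))
      (isIn_app hf (isIn_var hx)) (and_left h))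
  refine lt_of_linear hS hR hrx (isReal_add hF hry hre) fun K _ _ _ V => ?_
  have h1 := V.le hrdb (isReal_add hF hrd hrb) (norm_add_le hY hd hb)
  have h2 := V.lt hrd hre (and_right h)
  rw [V.congr hrdb hrx (app_congr e1), V.add hrd hrb,
    ← V.congr hry hrb (app_congr hyb)] at h1
  rw [V.add hry hre]
  linarith

variable (S) in
/-- There is `δ > 0` such that `ρ(x, Z_f) < ε` whenever `‖f(x)‖ < δ`. -/
def isUniformlyZStableFor (R : RealLineData M) (X : MetricData M) (Y : NormedData M)
    (f ε : M) : H :=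
  S.exPos R fun δ => S.all X.carrier fun x => S.normLt R Y f x δ ⇨ S.nearZero R X Y f x ε

variable (S) in
/-- `z` enumerates a dense subset of the zero set of `f` on the detachable set `D`. -/
def isZeroEnum (N : M) (R : RealLineData M) (X : MetricData M) (Y : NormedData M)
    (f D z : M) : H :=
  (S.all D fun n => S.mem n N) ⊓
    (S.all N fun n => S.mem n D ⊔ (S.mem n D)ᶜ) ⊓
    S.isFun z D X.carrier ⊓
    (S.all D fun n => ⨅ y, S.rel z n y ⇨ S.isZero X Y f y) ⊓
    ⨅ x, S.isZero X Y f x ⇨ S.allPos R fun ε => S.ex D fun n =>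
      S.lt R (S.app₂ X.dist (S.var x) (S.app z (S.var n))) (S.var ε)

variable (S) in
/-- `n ‖f(x)‖ < 1`, and the distance of `x` from the points `z_j` with `j ≤ n` exceeds `h`. -/
def isFar (R : RealLineData M) (X : MetricData M) (Y : NormedData M) (f i D z h n x : M) : H :=
  S.lt R (S.app₂ R.mul (S.app i (S.var n)) (S.normAt Y f x)) (S.var R.one) ⊓
    S.all D fun j => (S.mem j n ⊔ S.eq j n) ⇨
      S.lt R (S.var h) (S.app₂ X.dist (S.var x) (S.app z (S.var j)))

section

instance {i D z h : M} {T U : (ℕ → M) → M} [hT : IsAtom T] [hU : IsAtom U] :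
    S.Definable fun v => S.isFar R X Y f i D z h (T v) (U v) := by
  have := hT.tail
  have := hU.tail
  unfold isFar
  infer_instance

/-- This truth value, though it depends on no variable, is a disjunct of the relation to which
countable choice is applied, and so must be definable. -/
instance {ε : M} : S.Definable fun _ => S.isUniformlyZStableFor R X Y f ε := by
  unfold isUniformlyZStableFor normLt nearZero isZero
  infer_instance

variable {i D z h₁ h n x y e ε : M}

theorem isReal_dist_enum (hX : Γ ≤ S.isMetricSpace R X) (hz : Γ ≤ S.isZeroEnum N R X Y f D z)
    {j : M} (hj : Γ ≤ S.mem j D) (hx : Γ ≤ S.mem x X.carrier) :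
    Γ ≤ S.isReal R (S.app₂ X.dist (S.var x) (S.app z (S.var j))) :=
  isIn_app₂ (and_left (and_left (and_left (and_left hX)))) (isIn_var hx)
    (isIn_app (and_right (and_left (and_left hz))) (isIn_var hj))

/-- Strict inequalities between reals are undecidable, but cotransitivity decides between
overlapping alternatives: ‖f(x)‖ < y or ‖f(x)‖ > e for e < y, and ρ(x, z_j) > h₁ or ρ(x, z_j) < h₁ +
h. Detachability of `D` decides for which j the second comparison is made. -/
theorem isFar_decide (hS : S.IsBishopModel) (hR : Γ ≤ S.hasReals N R)
    (hi : Γ ≤ S.isNatCast N R i) (hX : Γ ≤ S.isMetricSpace R X)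
    (hY : Γ ≤ S.isNormedSpace R Y) (hf : Γ ≤ S.isFun f X.carrier Y.carrier)
    (hz : Γ ≤ S.isZeroEnum N R X Y f D z) (hn : Γ ≤ S.mem n N) (hx : Γ ≤ S.mem x X.carrier)
    (hh₁ : Γ ≤ S.mem h₁ R.carrier) (hh : Γ ≤ S.mem h R.carrier)
    (hh0 : Γ ≤ S.lt R (S.var R.zero) (S.var h))
    (hy : Γ ≤ S.mem y R.carrier) (he : Γ ≤ S.mem e R.carrier)
    (hey : Γ ≤ S.lt R (S.var e) (S.var y))
    (hy0 : Γ ≤ S.lt R (S.var R.zero) (S.var y))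
    (hy1 : Γ ≤ steq (S.app₂ R.mul (S.app₂ R.add (S.app i (S.var n)) (S.var R.one)) (S.var y))
      (S.var R.one)) :
    Γ ≤ S.isFar R X Y f i D z h₁ n x ⊔ (S.lt R (S.var e) (S.normAt Y f x) ⊔
      S.ex D fun j => S.lt R (S.app₂ X.dist (S.var x) (S.app z (S.var j)))
        (S.app₂ R.add (S.var h₁) (S.var h))) := by
  have hF := hasReals.field hR
  have hrx := isReal_normAt hY hf hx
  refine sup_elim (lt_cotrans (hasReals.ordered hR) (isIn_var he) (isIn_var hy) hrx hey)
    (fun Δ hΔ h => inr (inl h)) fun Δ hΔ hl => ?_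
  grw [← hΔ] at *
  have hrn := isReal_natCast hi hn
  -- Here y = 1/(n + 1), so n‖f(x)‖ ≤ ny < (n + 1)y = 1; using n + 1 avoids dividing by zero at n =
  -- 0.
  have h1 : Δ ≤ S.lt R (S.app₂ R.mul (S.app i (S.var n)) (S.normAt Y f x)) (S.var R.one) := by
    refine lt_of_linear hS hR (isReal_mul hF hrn hrx) (isReal_one hR) fun K _ _ _ V => ?_
    have hn1 := isReal_add hF hrn (isReal_one hR)
    have e1 := V.congr (isReal_mul hF hn1 (isIn_var hy)) (isReal_one hR) hy1
    have e2 := V.lt hrx (isIn_var hy) hl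
    have e3 := V.lt (isReal_zero hR) (isIn_var hy) hy0
    have e4 := natCast_nonneg hS hR hi hn V
    rw [V.mul hn1 (isIn_var hy), V.add hrn (isReal_one hR), V.one] at e1
    rw [V.zero] at e3
    rw [V.mul hrn hrx, V.one]
    have := mul_le_mul_of_nonneg_left e2.le e4
    linarith
  -- The indices j ≤ n are the elements of m = n + 1, a finite set to which `finite_decision`
  -- applies.
  refine iSup_elim (hS.exists_insert n n) fun m Δ hΔ hm => ?_
  grw [← hΔ] at *
  have hmN := isOmega_succ (hasReals.omega hR) hn hm
  have hdec : Δ ≤ S.all m fun j =>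
      (S.mem j D ⊓ S.lt R (S.app₂ X.dist (S.var x) (S.app z (S.var j)))
        (S.app₂ R.add (S.var h₁) (S.var h))) ⊔
      (S.mem j D ⇨ S.lt R (S.var h₁) (S.app₂ X.dist (S.var x) (S.app z (S.var j)))) := by
    refine all_intro fun j Δ hΔ hj => ?_
    grw [← hΔ] at *
    have hjN := mem_omega_of_mem hS (hasReals.omega hR) hmN hj
    refine sup_elim (all_elim (and_right (and_left (and_left (and_left hz)))) hjN :)
      (fun Δ hΔ hjD => ?_) fun Δ hΔ hjD => ?_ <;> grw [← hΔ] at *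
    · have hrj := isReal_dist_enum hX hz hjD hx
      refine sup_elim (lt_cotrans (hasReals.ordered hR) (isIn_var hh₁)
        (isReal_add hF (isIn_var hh₁) (isIn_var hh)) hrj ?_) (fun Δ hΔ hl => inr ?_)
        fun Δ hΔ hl => inl ?_
      · refine lt_of_linear hS hR (isIn_var hh₁) (isReal_add hF (isIn_var hh₁) (isIn_var hh))
          fun K _ _ _ V => ?_
        have := V.lt (isReal_zero hR) (isIn_var hh) hh0
        rw [V.zero] at this
        rw [V.add (isIn_var hh₁) (isIn_var hh)]
        linarith
      · exact himp_intro fun Δ hΔ _ => hΔ.trans hl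
      · exact le_inf (hΔ.trans hjD) hl
    · exact inr (himp_intro fun Δ hΔ h => compl_elim (hΔ.trans hjD) h)
  refine sup_elim (hS.finite_decision (fun j => S.mem j D ⊓ S.lt R (S.app₂ X.dist (S.var x)
    (S.app z (S.var j))) (S.app₂ R.add (S.var h₁) (S.var h))) (fun j => S.mem j D ⇨
    S.lt R (S.var h₁) (S.app₂ X.dist (S.var x) (S.app z (S.var j)))) (hasReals.omega hR) hmN hdec)
    (fun Δ hΔ h => ?_) fun Δ hΔ h => ?_
  · exact ex_elim h fun j Δ hΔ _ h => inr (inr (ex_intro j (and_left h) (and_right h)))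
  · refine inl (le_inf (hΔ.trans h1) (all_intro fun j Δ' hΔ' hj => himp_intro fun Δ'' hΔ'' hl => ?_))
    exact himp_elim (all_elim (hΔ''.trans (hΔ'.trans h)) (mem_isSucc
      (hΔ''.trans (hΔ'.trans (hΔ.trans hm))) hl) :) (hΔ''.trans hj)

end

end SetInterp

/-! ### The dichotomy: a far point, or uniform stability for ε. -/

namespace SetInterp

variable {H : Type u} [Order.Frame H] {M : Type v} {S : SetInterp H M}
  {Γ Δ ψ : H} {N : M} {R : RealLineData M} {X : MetricData M} {Y : NormedData M} {f : M}
  {i D z h h₁ n x y e ε : M}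

theorem isZeroEnum.isZero {j a : M} (hz : Γ ≤ S.isZeroEnum N R X Y f D z) (hj : Γ ≤ S.mem j D)
    (ha : Γ ≤ S.rel z j a) : Γ ≤ S.isZero X Y f a :=
  himp_elim (iInf_elim (all_elim (and_right (and_left hz)) hj :) a :) ha

theorem isZeroEnum.isFun (hz : Γ ≤ S.isZeroEnum N R X Y f D z) : Γ ≤ S.isFun z D X.carrier :=
  and_right (and_left (and_left hz))

/-- Either some point at which `n ‖f‖ < 1` is far from the zeros enumerated up to `n`, or `f` is
uniformly stable for `ε`. -/
theorem exists_isFar_or_isUniformlyZStableFor (hS : S.IsBishopModel) (hR : Γ ≤ S.hasReals N R)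
    (hi : Γ ≤ S.isNatCast N R i) (hX : Γ ≤ S.isMetricSpace R X)
    (hT : Γ ≤ S.isTotallyBounded N R X)
    (hY : Γ ≤ S.isNormedSpace R Y) (hf : Γ ≤ S.isFun f X.carrier Y.carrier)
    (hc : Γ ≤ S.isUniformlyContinuous R X Y f)
    (hz : Γ ≤ S.isZeroEnum N R X Y f D z) (hn : Γ ≤ S.mem n N)
    (hε : Γ ≤ S.mem ε R.carrier)
    (hh₁ : Γ ≤ S.mem h₁ R.carrier) (hh : Γ ≤ S.mem h R.carrier)
    (hh0 : Γ ≤ S.lt R (S.var R.zero) (S.var h))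
    (hε₁ : Γ ≤ steq (S.app₂ R.add (S.var h₁) (S.var h₁)) (S.var ε))
    (hε₂ : Γ ≤ steq (S.app₂ R.add (S.var h) (S.var h)) (S.var h₁)) :
    Γ ≤ (S.ex X.carrier fun x => S.isFar R X Y f i D z h₁ n x) ⊔
      S.isUniformlyZStableFor R X Y f ε := by
  have hF := hasReals.field hR
  have hrn := isReal_natCast hi hn
  have hrn1 := isReal_add hF hrn (isReal_one hR)
  have hn1 : Γ ≤ S.lt R (S.var R.zero)
      (S.app₂ R.add (S.app i (S.var n)) (S.var R.one)) := by
    refine lt_of_linear hS hR (isReal_zero hR) hrn1 fun K _ _ _ V => ?_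
    have := natCast_nonneg hS hR hi hn V
    rw [V.zero, V.add hrn (isReal_one hR), V.one]
    positivity
  -- The constants are y = 1/(n + 1), e = y/2 and d = e/2. The last is both the tolerance for
  -- uniform continuity and the δ of uniform stability.
  refine exists_pos_inv hS hR hrn1 hn1 fun y Δ hΔ hy hy0 hy1 => ?_
  grw [← hΔ] at *
  refine exists_half hS hR (isIn_var hy) hy0 fun e Δ hΔ he he0 hey => ?_
  grw [← hΔ] at *
  refine exists_half hS hR (isIn_var he) he0 fun d Δ hΔ hd hd0 hde => ?_
  grw [← hΔ] at *
  refine exPos_elim (allPos_elim hc hd hd0 :) fun η Δ hΔ hη hη0 hm => ?_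
  replace hm : Δ ≤ S.isModulus R X Y f d η := hm
  grw [← hΔ] at *
  -- The net has mesh μ, below η to control f and below h to control distances.
  refine exists_lt_both hS hR (isIn_var hη) (isIn_var hh) hη0 hh0
    fun μ Δ hΔ hμ hμ0 hμη hμh => ?_
  grw [← hΔ] at *
  refine ex_elim (allPos_elim hT hμ hμ0 :) fun k Δ hΔ hk hp => ?_
  grw [← hΔ] at *
  refine iSup_elim hp fun p Δ hΔ hp => ?_
  clear hT
  grw [← hΔ] at *
  have hpF := and_left hp
  have hey' : Δ ≤ S.lt R (S.var e) (S.var y) := by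
    refine lt_of_linear hS hR (isIn_var he) (isIn_var hy) fun K _ _ _ V => ?_
    have e1 := V.congr (isReal_add hF (isIn_var he) (isIn_var he)) (isIn_var hy) hey
    have e2 := V.lt (isReal_zero hR) (isIn_var he) he0
    rw [V.add (isIn_var he) (isIn_var he)] at e1
    rw [V.zero] at e2
    linarith
  have hdec : Δ ≤ S.all k fun a => (⨆ x, S.rel p a x ⊓ S.isFar R X Y f i D z h₁ n x) ⊔
      ⨆ x, S.rel p a x ⊓ (S.lt R (S.var e) (S.normAt Y f x) ⊔
        S.ex D fun j => S.lt R (S.app₂ X.dist (S.var x) (S.app z (S.var j)))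
          (S.app₂ R.add (S.var h₁) (S.var h))) := by
    refine all_intro fun a Δ hΔ ha => ex_elim (isFun_total (hΔ.trans hpF) ha)
      fun x Δ' hΔ' hx hr => ?_
    grw [← hΔ', ← hΔ] at *
    exact sup_elim (isFar_decide hS hR hi hX hY hf hz hn hx hh₁ hh hh0 hy he hey' hy0 hy1)
      (fun Δ hΔ h => inl (iSup_intro x (le_inf (hΔ.trans hr) h)))
      fun Δ hΔ h => inr (iSup_intro x (le_inf (hΔ.trans hr) h))
  refine sup_elim (hS.finite_decision _ _ (hasReals.omega hR) hk hdec) (fun Δ hΔ h => inl ?_)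
    fun Δ hΔ hB => inr (exPos_intro (hΔ.trans hd) (hΔ.trans hd0) (all_intro fun x Δ' hΔ' hx =>
      himp_intro fun Δ'' hΔ'' hfx => ?_))
  · refine ex_elim h fun a Δ' hΔ' ha h => iSup_elim h fun x Δ'' hΔ'' h => ?_
    exact ex_intro x (isFun_cod (hΔ''.trans (hΔ'.trans (hΔ.trans hpF))) (and_left h)) (and_right h)
  clear hdec
  grw [← hΔ'', ← hΔ', ← hΔ] at *
  refine ex_elim (all_elim (and_right hp) hx :) fun a Δ hΔ ha hxa => ?_
  grw [← hΔ] at *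
  refine iSup_elim (all_elim hB ha :) fun x' Δ hΔ hq => ?_
  clear hB
  grw [← hΔ] at *
  have hx' := isFun_cod hpF (and_left hq)
  have hxx : Δ ≤ S.lt R (S.dist X x x') (S.var μ) :=
    lt_congr (app₂_congr (steq_refl _) (steq_app_var hpF (and_left hq))) (steq_refl _) hxa
  have hrd := isReal_dist hX hx hx'
  have hfx' : Δ ≤ S.lt R (S.normAt Y f x') (S.app₂ R.add (S.normAt Y f x) (S.var d)) := by
    refine isModulus.lt_add hS hR hY hf hd hm hx' hx ?_
    refine lt_of_linear hS hR (isReal_dist hX hx' hx) (isIn_var hη) fun K _ _ _ V => ?_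
    rw [V.dist_comm hX hx' hx]
    exact (V.lt hrd (isIn_var hμ) hxx).trans (V.lt (isIn_var hμ) (isIn_var hη) hμη)
  have hrx := isReal_normAt hY hf hx
  have hrx' := isReal_normAt hY hf hx'
  -- Let x' be a net point within μ of x. The alternative ‖f(x')‖ > e is impossible, as ‖f(x')‖ <
  -- ‖f(x)‖ + d < 2d = e. Otherwise an enumerated zero lies within h₁ + h of x', hence within h₁ +
  -- 2h = ε of x.
  refine sup_elim (and_right hq) (fun Δ hΔ hq => ?_) fun Δ hΔ hq => ?_ <;> grw [← hΔ] at *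
  · refine le_of_linear hS hR fun K _ _ _ V => ?_
    have h1 := V.lt hrx (isIn_var hd) hfx
    have h2 := V.lt (isIn_var he) hrx' hq
    have h3 := V.lt hrx' (isReal_add hF hrx (isIn_var hd)) hfx'
    have h4 := V.congr (isReal_add hF (isIn_var hd) (isIn_var hd)) (isIn_var he) hde
    rw [V.add hrx (isIn_var hd)] at h3
    rw [V.add (isIn_var hd) (isIn_var hd)] at h4
    linarith
  · refine ex_elim hq fun j Δ hΔ hj hl => ex_elim
      (isFun_total (hΔ.trans (isZeroEnum.isFun hz)) hj) fun a Δ' hΔ' ha hja => ?_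
    clear hq
    grw [← hΔ', ← hΔ] at *
    refine iSup_intro a (le_inf (isZeroEnum.isZero hz hj hja) ?_)
    have hxa : Δ' ≤ S.lt R (S.dist X x' a) (S.app₂ R.add (S.var h₁) (S.var h)) :=
      lt_congr (app₂_congr (steq_refl _) (steq_app_var (isZeroEnum.isFun hz) hja)) (steq_refl _) hl
    refine lt_of_linear hS hR (isReal_dist hX hx ha) (isIn_var hε) fun K _ _ _ V => ?_
    have h1 := V.lt hrd (isIn_var hμ) hxx
    have h2 := V.lt (isIn_var hμ) (isIn_var hh) hμh
    have h3 := V.lt (isReal_dist hX hx' ha) (isReal_add hF (isIn_var hh₁) (isIn_var hh)) hxa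
    have h4 := V.congr (isReal_add hF (isIn_var hh₁) (isIn_var hh₁)) (isIn_var hε) hε₁
    have h5 := V.congr (isReal_add hF (isIn_var hh) (isIn_var hh)) (isIn_var hh₁) hε₂
    have h6 := V.dist_triangle hR hX hx hx' ha
    rw [V.add (isIn_var hh₁) (isIn_var hh)] at h3
    rw [V.add (isIn_var hh₁) (isIn_var hh₁)] at h4
    rw [V.add (isIn_var hh) (isIn_var hh)] at h5
    linarith

end SetInterp

/-! ### The sequence of far points is bounded away from each point of X. -/

namespace SetInterp

variable {H : Type u} [Order.Frame H] {M : Type v} {S : SetInterp H M}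
  {Γ Δ ψ : H} {N : M} {R : RealLineData M} {X : MetricData M} {Y : NormedData M} {f : M}
  {i D z h h₁ n x y e ε E d w s k δ : M}

/-- Terms equal to `w` are at distance at least r from X, so a bound below both r and δ serves all
terms from `k` on. As `≤` is a negation, a term in X only has to be shown not to be closer than δ,
and `hT` is accordingly a refutation. -/
theorem isEventuallyBoundedAway_intro {T : M → M → H} (hS : S.IsBishopModel)
    (hR : Γ ≤ S.hasReals N R) (hX : Γ ≤ S.isMetricSpace R X) (hx : Γ ≤ S.mem x X.carrier)
    (hE : Γ ≤ S.isOnePointExtension R X ⟨E, d⟩ w) (hs : Γ ≤ S.isFun s N E)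
    (hsT : Γ ≤ S.all N fun n => ⨅ x, S.rel s n x ⇨
      ((S.mem x X.carrier ⊓ T n x) ⊔ (S.eq x w ⊓ ψ)))
    (hk : Γ ≤ S.mem k N) (hδ : Γ ≤ S.mem δ R.carrier)
    (hδ0 : Γ ≤ S.lt R (S.var R.zero) (S.var δ))
    (hT : ∀ n a, ∀ Θ ≤ Γ, Θ ≤ S.mem n N → Θ ≤ S.mem k n ⊔ S.eq k n → Θ ≤ S.mem a X.carrier →
      Θ ≤ T n a → Θ ≤ S.lt R (S.dist X x a) (S.var δ) → Θ ≤ ⊥) :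
    Γ ≤ S.isEventuallyBoundedAway N R ⟨E, d⟩ s x := by
  refine exPos_elim (and_right hE) fun r Δ hΔ hr hr0 hrw => ?_
  replace hT := fun n a Θ (hΘ : Θ ≤ Δ) => hT n a Θ (hΘ.trans hΔ)
  grw [← hΔ] at *
  refine exists_lt_both hS hR (isIn_var hδ) (isIn_var hr) hδ0 hr0
    fun μ Δ hΔ hμ hμ0 hμδ hμr => ?_
  replace hT := fun n a Θ (hΘ : Θ ≤ Δ) => hT n a Θ (hΘ.trans hΔ)
  grw [← hΔ] at *
  refine ex_intro k hk (exPos_intro hμ hμ0 (all_intro fun n Δ hΔ hn =>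
    himp_intro fun Δ' hΔ' hkn => ?_))
  replace hT := fun n a Θ (hΘ : Θ ≤ Δ') => hT n a Θ (hΘ.trans (hΔ'.trans hΔ))
  grw [← hΔ', ← hΔ] at *
  have hEm : Δ' ≤ S.isMetricSpace R ⟨E, d⟩ := and_left (and_left (and_left hE))
  have hXE : ∀ {a}, Δ' ≤ S.mem a X.carrier ⊔ S.eq a w → Δ' ≤ S.mem a E := fun {a} ha =>
    iff_mpr (iInf_elim (and_right (and_left (and_left hE))) a :) ha
  refine ex_elim (isFun_total hs hn) fun a Δ hΔ haE hna => ?_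
  replace hT := fun n a Θ (hΘ : Θ ≤ Δ) => hT n a Θ (hΘ.trans hΔ)
  have hxE := hΔ.trans (hXE (inl hx))
  clear hXE
  grw [← hΔ] at *
  refine le_congr (S := S) (steq_refl (S.var μ)) (app₂_congr (steq_refl (S.var x))
    (steq_symm (steq_app_var hs hna))) ?_
  have hxa : Δ ≤ S.isReal R (S.dist ⟨E, d⟩ x a) := isReal_dist hEm hxE haE
  change Δ ≤ S.le R (S.var μ) (S.dist ⟨E, d⟩ x a)
  refine sup_elim (himp_elim (iInf_elim (all_elim hsT hn :) a :) hna) (fun Δ hΔ h => ?_)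
    fun Δ hΔ h => ?_
  · rw [le_iff_compl (hΔ.trans (isIn_var hμ)) (hΔ.trans hxa)]
    refine compl_intro fun Θ hΘ hl => ?_
    replace hT := fun n a Θ' (hΘ' : Θ' ≤ Θ) => hT n a Θ' (hΘ'.trans (hΘ.trans hΔ))
    grw [← hΘ, ← hΔ] at *
    have ha := and_left h
    have e1 := all_elim (all_elim (and_right (and_left hE)) hx :) ha
    refine hT n a Θ le_rfl hn hkn ha (and_right h) ?_
    have hxa' := isReal_dist hX hx ha
    have e2 := steq_of_teq hxa hxa' e1
    refine lt_of_linear hS hR hxa' (isIn_var hδ) fun K _ _ _ V => ?_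
    rw [← V.congr hxa hxa' e2]
    exact (V.lt hxa (isIn_var hμ) hl).trans (V.lt (isIn_var hμ) (isIn_var hδ) hμδ)
  · clear hT
    grw [← hΔ] at *
    have hwE : Δ ≤ S.mem w E := mem_left (and_left h) haE
    have e1 := dist_congr (X := ⟨E, d⟩) (S.eq_refl x ▸ le_top : Δ ≤ S.eq x x) (and_left h)
    have hwx := isReal_dist hEm hwE hxE
    have hxw := isReal_dist hEm hxE hwE
    refine le_of_linear_le hS hR (isIn_var hμ) hxa fun K _ _ _ V => ?_
    have h1 := V.lt (isIn_var hμ) (isIn_var hr) hμr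
    have h2 := V.le (isIn_var hr) hwx (all_elim hrw hx :)
    rw [V.congr hxa hxw e1, V.dist_comm hEm hxE hwE]
    exact h1.le.trans h2

/-- A sequence of points that are far from the zeros enumerated so far is bounded away from each
point at which `f` is stable. -/
theorem isEventuallyBoundedAway_of_isFar (hS : S.IsBishopModel)
    (hR : Γ ≤ S.hasReals N R) (hi : Γ ≤ S.isNatCast N R i) (hX : Γ ≤ S.isMetricSpace R X)
    (hY : Γ ≤ S.isNormedSpace R Y) (hf : Γ ≤ S.isFun f X.carrier Y.carrier)
    (hc : Γ ≤ S.isUniformlyContinuous R X Y f)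
    (hz : Γ ≤ S.isZeroEnum N R X Y f D z) (hx : Γ ≤ S.mem x X.carrier)
    (hst : Γ ≤ S.isZStableAt R X Y f x)
    (hE : Γ ≤ S.isOnePointExtension R X ⟨E, d⟩ w) (hs : Γ ≤ S.isFun s N E)
    (hsT : Γ ≤ S.all N fun n => ⨅ x, S.rel s n x ⇨
      ((S.mem x X.carrier ⊓ S.isFar R X Y f i D z h₁ n x) ⊔ (S.eq x w ⊓ ψ)))
    (hh₁ : Γ ≤ S.mem h₁ R.carrier) (hh : Γ ≤ S.mem h R.carrier)
    (hh0 : Γ ≤ S.lt R (S.var R.zero) (S.var h))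
    (hhh : Γ ≤ steq (S.app₂ R.add (S.var h) (S.var h)) (S.var h₁)) :
    Γ ≤ S.isEventuallyBoundedAway N R ⟨E, d⟩ s x := by
  have hF := hasReals.field hR
  refine exists_half hS hR (isIn_var hh) hh0 fun b Δ hΔ hb hb0 hbh => ?_
  grw [← hΔ] at *
  refine exPos_elim (allPos_elim hst hb hb0 :) fun δ Δ hΔ hδ hδ0 hδx => ?_
  clear hst
  grw [← hΔ] at *
  have hrx := isReal_normAt hY hf hx
  -- Whether f vanishes at x is undecidable; cotransitivity of 0 < δ gives the overlapping cases
  -- ‖f(x)‖ > 0 and ‖f(x)‖ < δ.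
  refine sup_elim (lt_cotrans (hasReals.ordered hR) (isReal_zero hR) (isIn_var hδ) hrx hδ0)
    (fun Δ hΔ hpos => ?_) fun Δ hΔ hsmall => ?_ <;> grw [← hΔ] at *
  -- With e = ‖f(x)‖/2 and k > 1/e, a point a with ρ(x, a) < η has ‖f(a)‖ > e, so n‖f(a)‖ ≥ ne > 1
  -- for n ≥ k, which contradicts being far.
  · refine exists_half hS hR hrx hpos fun e Δ hΔ he he0 hex => ?_
    grw [← hΔ] at *
    refine exists_pos_inv hS hR (isIn_var he) he0 fun y Δ hΔ hy hy0 hey => ?_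
    grw [← hΔ] at *
    refine ex_elim (all_elim (and_right hi) hy :) fun k Δ hΔ hk hyk => ?_
    grw [← hΔ] at *
    refine exPos_elim (allPos_elim hc he he0 :) fun η Δ hΔ hη hη0 hm => ?_
    replace hm : Δ ≤ S.isModulus R X Y f e η := hm
    grw [← hΔ] at *
    refine isEventuallyBoundedAway_intro hS hR hX hx hE hs hsT hk hη hη0
      fun n a Θ hΘ hn hkn ha hfar hxa => ?_
    clear hsT hc hδx hE hz
    grw [← hΘ] at *
    have hra := isReal_normAt hY hf ha
    have hrn := isReal_natCast hi hn
    have hrk := isReal_natCast hi hk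
    have hna := isReal_mul hF hrn hra
    have hxa' := isModulus.lt_add hS hR hY hf he hm hx ha hxa
    have hle := natCast_mono hS hR hi hk hn hkn
    refine le_of_linear hS hR fun K _ _ _ V => ?_
    have h1 := V.lt hrx (isReal_add hF hra (isIn_var he)) hxa'
    have h2 := V.congr (isReal_add hF (isIn_var he) (isIn_var he)) hrx hex
    have h3 := V.congr (isReal_mul hF (isIn_var he) (isIn_var hy)) (isReal_one hR) hey
    have h4 := V.lt (isIn_var hy) hrk hyk
    have h5 := V.le hrk hrn hle
    have h6 := V.lt hna (isReal_one hR) (and_left hfar)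
    have h7 := V.lt (isReal_zero hR) (isIn_var he) he0
    have h8 := natCast_nonneg hS hR hi hn V
    rw [V.add hra (isIn_var he)] at h1
    rw [V.add (isIn_var he) (isIn_var he)] at h2
    rw [V.mul (isIn_var he) (isIn_var hy), V.one] at h3
    rw [V.mul hrn hra, V.one] at h6
    rw [V.zero] at h7
    have h9 := mul_le_mul_of_nonneg_left (by linarith : V (S.var e) ≤ V (S.normAt Y f a)) h8
    have h10 := mul_le_mul_of_nonneg_left (h4.le.trans h5) h7.le
    linarith
  -- Stability gives a zero u within b = h/2 of x, and density an enumerated zero z_j within b of u.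
  -- For n ≥ j, a term within h of x is within 2h = h₁ of z_j, which contradicts being far.
  · refine iSup_elim (himp_elim hδx hsmall) fun u Δ hΔ hu => ?_
    clear hδx
    grw [← hΔ] at *
    refine ex_elim (allPos_elim (himp_elim (iInf_elim (and_right hz) u :) (and_left hu)) hb hb0 :)
      fun j Δ hΔ hj huj => ?_
    grw [← hΔ] at *
    have hjN : Δ ≤ S.mem j N :=
      (all_elim (and_left (and_left (and_left (and_left hz)))) hj :)
    refine isEventuallyBoundedAway_intro hS hR hX hx hE hs hsT hjN hh hh0
      fun n a Θ hΘ hn hkn ha hfar hxa => ?_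
    clear hsT hc hE
    grw [← hΘ] at *
    refine ex_elim (isFun_total (isZeroEnum.isFun hz) hj) fun c Δ hΔ hc hjc => ?_
    grw [← hΔ] at *
    have hu' := and_left (and_left hu)
    have huc : Δ ≤ S.lt R (S.dist X u c) (S.var b) :=
      lt_congr (app₂_congr (steq_refl _) (steq_app_var (isZeroEnum.isFun hz) hjc)) (steq_refl _) huj
    have hac : Δ ≤ S.lt R (S.var h₁) (S.dist X a c) :=
      lt_congr (steq_refl _) (app₂_congr (steq_refl _) (steq_app_var (isZeroEnum.isFun hz) hjc))
        (himp_elim (all_elim (and_right hfar) hj :) hkn)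
    refine le_of_linear hS hR fun K _ _ _ V => ?_
    have h1 := V.lt (isReal_dist hX hu' hc) (isIn_var hb) huc
    have h2 := V.lt (isIn_var hh₁) (isReal_dist hX ha hc) hac
    have h3 := V.lt (isReal_dist hX hx ha) (isIn_var hh) hxa
    have h4 := V.lt (isReal_dist hX hx hu') (isIn_var hb) (and_right hu)
    have h5 := V.dist_triangle hR hX ha hx hc
    have h6 := V.dist_triangle hR hX hx hu' hc
    have h7 := V.congr (isReal_add hF (isIn_var hh) (isIn_var hh)) (isIn_var hh₁) hhh
    have h8 := V.congr (isReal_add hF (isIn_var hb) (isIn_var hb)) (isIn_var hh) hbh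
    rw [V.add (isIn_var hh) (isIn_var hh)] at h7
    rw [V.add (isIn_var hb) (isIn_var hb)] at h8
    rw [V.dist_comm hX ha hx] at h5
    linarith

end SetInterp

/-! ### Conclusion from the limited anti-Specker property. -/

namespace SetInterp

variable {H : Type u} [Order.Frame H] {M : Type v} {S : SetInterp H M}
  {Γ Δ ψ : H} {N : M} {R : RealLineData M} {X : MetricData M} {Y : NormedData M} {f : M}

/-- The size of a 1-net is zero or a successor: in the first case X is empty and any δ serves, in
the second the net supplies a point. -/
theorem isUniformlyZStableFor_or_inhabited {ε : M} (hS : S.IsBishopModel)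
    (hR : Γ ≤ S.hasReals N R) (hT : Γ ≤ S.isTotallyBounded N R X) :
    Γ ≤ S.isUniformlyZStableFor R X Y f ε ⊔ ⨆ x, S.mem x X.carrier := by
  have h01 := zero_lt_one (hasReals.ordered hR)
  refine ex_elim (allPos_elim hT (one_mem (hasReals.field hR)) h01 :) fun k Δ hΔ hk h =>
    iSup_elim h fun p Δ' hΔ' hp => ?_
  clear h
  grw [← hΔ', ← hΔ] at *
  refine sup_elim (hS.nat_cases (hasReals.omega hR) hk) (fun Δ hΔ he => inl ?_)
    fun Δ hΔ hs => inr ?_ <;> grw [← hΔ] at *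
  · refine exPos_intro (one_mem (hasReals.field hR)) h01 (all_intro fun x Δ hΔ hx => ?_)
    grw [← hΔ] at *
    exact ex_elim (all_elim (and_right hp) hx :) fun a Δ hΔ ha _ =>
      compl_elim (iInf_elim (hΔ.trans he) a) ha
  · refine ex_elim hs fun m Δ hΔ hm hs => ?_
    exact ex_elim (isFun_total (hΔ.trans (and_left hp)) (mem_isSucc hs (inr eq_rfl)))
      fun x Δ hΔ hx _ => iSup_intro x hx

/-- If `w` were in X, the lower bound r > 0 would apply to ρ(w, w) = 0. -/
theorem isOnePointExtension.not_mem {E d w : M} (hS : S.IsBishopModel)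
    (hR : Γ ≤ S.hasReals N R) (hE : Γ ≤ S.isOnePointExtension R X ⟨E, d⟩ w) :
    Γ ≤ (S.mem w X.carrier)ᶜ := by
  refine compl_intro fun Δ hΔ hw => ?_
  grw [← hΔ] at *
  have hEm : Δ ≤ S.isMetricSpace R ⟨E, d⟩ := and_left (and_left (and_left hE))
  have hwE : Δ ≤ S.mem w E := iff_mpr (iInf_elim (and_right (and_left (and_left hE))) w :) (inl hw)
  refine exPos_elim (and_right hE) fun r Δ hΔ hr hr0 hrw => ?_
  grw [← hΔ] at *
  refine le_of_linear hS hR fun K _ _ _ V => ?_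
  have h1 := V.lt (isReal_zero hR) (isIn_var hr) hr0
  have h2 := V.le (isIn_var hr) (isReal_dist hEm hwE hwE) (all_elim hrw hw :)
  rw [V.dist_self hR hEm hwE] at h2
  rw [V.zero] at h1
  linarith

theorem isUniformlyZStable_of_hasLimitedAntiSpecker (hS : S.IsBishopModel)
    (hR : Γ ≤ S.hasReals N R) (hX : Γ ≤ S.isMetricSpace R X)
    (hT : Γ ≤ S.isTotallyBounded N R X) (hA : Γ ≤ S.hasLimitedAntiSpecker N R X)
    (hY : Γ ≤ S.isNormedSpace R Y) (hf : Γ ≤ S.isFun f X.carrier Y.carrier)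
    (hst : Γ ≤ S.isZStable R X Y f) (hc : Γ ≤ S.isUniformlyContinuous R X Y f)
    (hsep : Γ ≤ S.hasSeparableZeroSet N R X Y f) : Γ ≤ S.isUniformlyZStable R X Y f := by
  refine iSup_elim hsep fun D Δ hΔ hD => iSup_elim hD fun z Δ' hΔ' hz => ?_
  replace hz : Δ' ≤ S.isZeroEnum N R X Y f D z := hz
  clear hsep hD
  grw [← hΔ', ← hΔ] at *
  refine allPos_intro fun ε Δ hΔ hε hε0 => ?_
  grw [← hΔ] at *
  change Δ ≤ S.isUniformlyZStableFor R X Y f ε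
  refine iSup_elim (hasReals.exists_isNatCast hR) fun i Δ hΔ hi => ?_
  grw [← hΔ] at *
  refine exists_half hS hR (isIn_var hε) hε0 fun h₁ Δ hΔ hh₁ hh₁0 hε₁ => ?_
  grw [← hΔ] at *
  refine exists_half hS hR (isIn_var hh₁) hh₁0 fun h Δ hΔ hh hh0 hε₂ => ?_
  grw [← hΔ] at *
  refine sup_elim (isUniformlyZStableFor_or_inhabited hS hR hT) (fun _ _ hu => hu)
    fun Δ hΔ hx => iSup_elim hx fun x₀ Δ' hΔ' hx₀ => ?_
  clear hx
  grw [← hΔ', ← hΔ] at *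
  refine iSup_elim (exists_onePointExtension hS hR hX hx₀) fun E Δ₁ hΔ₁ hE₁ =>
    iSup_elim hE₁ fun d Δ₂ hΔ₂ hE₂ => iSup_elim hE₂ fun w Δ hΔ hE => ?_
  clear hE₁ hE₂
  grw [← hΔ, ← hΔ₂, ← hΔ₁] at *
  have hmE := and_right (and_left (and_left hE))
  -- The disjunct for `w` carries the desired conclusion along, so finding the value `w` in the
  -- sequence is enough.
  have htotal : Δ ≤ S.all N fun n => S.ex E fun x =>
      (S.mem x X.carrier ⊓ S.isFar R X Y f i D z h₁ n x) ⊔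
        (S.eq x w ⊓ S.isUniformlyZStableFor R X Y f ε) := by
    refine all_intro fun n Δ hΔ hn => ?_
    grw [← hΔ] at *
    refine sup_elim (exists_isFar_or_isUniformlyZStableFor hS hR hi hX hT hY hf hc hz hn hε hh₁ hh
      hh0 hε₁ hε₂) (fun Δ hΔ hl => ex_elim hl fun x Δ' hΔ' hx hfar => ?_)
      fun Δ hΔ hu => ?_
    · exact ex_intro x (iff_mpr (iInf_elim (hΔ'.trans (hΔ.trans hmE)) x :) (inl hx))
        (inl (le_inf hx hfar))
    · exact ex_intro w (iff_mpr (iInf_elim (hΔ.trans hmE) w :) (inr eq_rfl))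
        (inr (le_inf eq_rfl hu))
  refine iSup_elim (hS.countable_choice (fun n x =>
      (S.mem x X.carrier ⊓ S.isFar R X Y f i D z h₁ n x) ⊔
        (S.eq x w ⊓ S.isUniformlyZStableFor R X Y f ε)) (hasReals.omega hR) htotal)
    fun s Δ hΔ hs => ?_
  clear htotal
  grw [← hΔ] at *
  have haway : Δ ≤ S.all X.carrier fun x => S.isEventuallyBoundedAway N R ⟨E, d⟩ s x := by
    refine all_intro fun x Δ hΔ hx => ?_
    grw [← hΔ] at *
    exact isEventuallyBoundedAway_of_isFar hS hR hi hX hY hf hc hz hx (all_elim hst hx :) hE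
      (and_left hs) (and_right hs) hh₁ hh hh0 hε₂
  have key := himp_elim (iInf_elim (iInf_elim (iInf_elim (iInf_elim hA E :) d :) w :) s :)
    (le_inf (le_inf hE (and_left hs)) haway)
  refine ex_elim key fun n Δ hΔ hn hnw => ?_
  clear key
  grw [← hΔ] at *
  -- At an index where the value is `w`, the first disjunct would place `w` in X; the second is the
  -- claim.
  refine sup_elim (himp_elim (iInf_elim (all_elim (and_right hs) hn :) w :) hnw)
    (fun Δ hΔ hl => compl_elim (hΔ.trans (isOnePointExtension.not_mem hS hR hE)) (and_left hl))
    fun Δ _ hr => and_right hr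

end SetInterp

theorem mainTheorem3 {H : Type*} [Order.Frame H] {M : Type*} (S : SetInterp H M)
    (hS : S.IsBishopModel)
    (N : M) (R : RealLineData M) (X : MetricData M) (Y : NormedData M) (f : M) :
    S.isOmega N ⊓ S.isRealLine N R ⊓
      S.isMetricSpace R X ⊓ S.isCompact N R X ⊓ S.hasLimitedAntiSpecker N R X ⊓
      S.isNormedSpace R Y ⊓ S.isFun f X.carrier Y.carrier ⊓
      S.isZStable R X Y f ⊓ S.isUniformlyContinuous R X Y f ⊓
      S.hasSeparableZeroSet N R X Y f
    ≤ S.isUniformlyZStable R X Y f := by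
  have main : ∀ Γ, Γ ≤ S.isOmega N ⊓ S.isRealLine N R ⊓
      S.isMetricSpace R X ⊓ S.isCompact N R X ⊓ S.hasLimitedAntiSpecker N R X ⊓
      S.isNormedSpace R Y ⊓ S.isFun f X.carrier Y.carrier ⊓
      S.isZStable R X Y f ⊓ S.isUniformlyContinuous R X Y f ⊓
      S.hasSeparableZeroSet N R X Y f → Γ ≤ S.isUniformlyZStable R X Y f := by
    intro Γ h
    simp only [le_inf_iff] at h
    obtain ⟨⟨⟨⟨⟨⟨⟨⟨⟨hN, hR⟩, hX⟩, hT⟩, hA⟩, hY⟩, hf⟩, hst⟩, hc⟩, hsep⟩ := h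
    exact SetInterp.isUniformlyZStable_of_hasLimitedAntiSpecker hS (le_inf hN hR) hX
      (Frm.and_right hT) hA hY hf hst hc hsep
  exact main _ le_rfl
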